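/- Let $(A,\mathfrak m)$ be a Gorenstein local ring (a Noetherian local ring of finite injective dimension over itself) of Krull dimension $d>0$. Let $Q$ be a parameter ideal of $A$, that is, an ideal generated by $d$ elements with $\sqrt Q=\mathfrak m$, and put $I=Q:_A\mathfrak m^2$. Write $\mathrm v(A/Q)=\ell(\overline{\mathfrak m}/\overline{\mathfrak m}^2)$ for the embedding dimension of $A/Q$, where $\overline{\mathfrak m}=\mathfrak m/Q$. Let $\mathcal R(I)=A[IT]\subseteq A[T]$ be the Rees algebra, $\mathcal R'(I)=A[IT,T^{-1}]\subseteq A[T,T^{-1}]$ the extended Rees algebra, $\mathrm G(I)=\mathcal R'(I)/T^{-1}\mathcal R'(I)$ the associated graded ring and $\mathrm F(I)=\mathcal R(I)/\mathfrak m\mathcal R(I)$ the fiber cone of $I$, where $T$ is an indeterminate. Suppose that $\mathrm v(A/Q)>1$ and that $I$ is integral over $Q$, i.e. every $x\in I$ satisfies an equation $x^n+c_1x^{n-1}+\cdots+c_n=0$ with $n\ge 1$ and $c_i\in Q^i$ for $1\le i\le n$. Then: 1. $I^3=QI^2$. 2. $\mathrm G(I)$ and $\mathrm F(I)$ are Cohen–Macaulay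 rings. Moreover, if $d\ge 3$, then $\mathcal R(I)$ is a Cohen–Macaulay ring. -/

import Mathlib

open IsLocalRing

universe u

/-- A Gorenstein local ring: a Noetherian local ring of finite self-injective dimension. -/
structure IsGorensteinLocal (A : Type u) [CommRing A] : Prop where
  isLocalRing : IsLocalRing A
  isNoetherianRing : IsNoetherianRing A
  finite_injectiveDimension :
    ∃ n : ℕ, CategoryTheory.HasInjectiveDimensionLE (ModuleCat.of A A) n

/-- A Cohen-Macaulay local ring: a Noetherian local ring whose maximal ideal contains
a regular sequence of length equal to the Krull dimension. -/
structure IsCohenMacaulayLocal (R : Type*) [CommRing R] [IsLocalRing R] : Prop where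
  isNoetherianRing : IsNoetherianRing R
  exists_isRegular : ∃ rs : List R, (∀ r ∈ rs, r ∈ maximalIdeal R) ∧
    RingTheory.Sequence.IsRegular R rs ∧ (rs.length : WithBot ℕ∞) = ringKrullDim R

/-- A Cohen-Macaulay ring: a Noetherian ring all of whose localizations at maximal ideals
are Cohen-Macaulay local rings. -/
structure IsCohenMacaulay (R : Type*) [CommRing R] : Prop where
  isNoetherianRing : IsNoetherianRing R
  localization : ∀ (M : Ideal R) [M.IsMaximal],
    IsCohenMacaulayLocal (Localization.AtPrime M)

/-- A parameter ideal of a local ring of dimension `d`: an ideal generated by `d` elements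
whose radical is the maximal ideal. -/
def IsParameterIdeal {A : Type*} [CommRing A] [IsLocalRing A] (Q : Ideal A) : Prop :=
  ∃ (d : ℕ) (a : Fin d → A), ringKrullDim A = d ∧ Q = Ideal.span (Set.range a) ∧
    Q.radical = maximalIdeal A

/-- The quotient of a local ring by a parameter ideal is again a local ring. -/
theorem IsParameterIdeal.isLocalRing_quotient {A : Type*} [CommRing A] [IsLocalRing A]
    {Q : Ideal A} (hQ : IsParameterIdeal Q) : IsLocalRing (A ⧸ Q) := by
  obtain ⟨d, a, -, -, hrad⟩ := hQ
  have hne : Q ≠ ⊤ := by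
    rintro rfl
    rw [Ideal.radical_top] at hrad
    exact (maximalIdeal.isMaximal A).ne_top hrad.symm
  have : Nontrivial (A ⧸ Q) := Ideal.Quotient.nontrivial_iff.mpr hne
  exact IsLocalRing.of_surjective' (Ideal.Quotient.mk Q) Ideal.Quotient.mk_surjective

/-- The embedding dimension `v(R)`, the length of the `R`-module `𝔪 / 𝔪 ^ 2`. -/
noncomputable def embDim (R : Type*) [CommRing R] [IsLocalRing R] : ℕ∞ :=
  Module.length R (maximalIdeal R).Cotangent

/-- The ideal `I` is integral over the ideal `Q`: every `x ∈ I` satisfies an equation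
`x ^ n + c₁ x ^ (n - 1) + ⋯ + cₙ = 0` with `n ≥ 1` and `cᵢ ∈ Q ^ i`. -/
def Ideal.IsIntegralOverIdeal {A : Type*} [CommRing A] (I Q : Ideal A) : Prop :=
  ∀ x ∈ I, ∃ (n : ℕ) (c : ℕ → A), 0 < n ∧ (∀ i, c i ∈ Q ^ i) ∧
    x ^ n + ∑ i ∈ Finset.Icc 1 n, c i * x ^ (n - i) = 0

/-- The extended Rees algebra `R'(I) = A[IT, T⁻¹] ⊆ A[T, T⁻¹]`. -/
noncomputable def extendedReesAlgebra {A : Type*} [CommRing A] (I : Ideal A) :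
    Subalgebra A (LaurentPolynomial A) :=
  Algebra.adjoin A ({f | ∃ a ∈ I, f = LaurentPolynomial.C a * LaurentPolynomial.T 1} ∪
    {LaurentPolynomial.T (-1)})

/-- The element `T⁻¹` of the extended Rees algebra. -/
noncomputable def extendedReesAlgebra.Tinv {A : Type*} [CommRing A] (I : Ideal A) :
    extendedReesAlgebra I :=
  ⟨LaurentPolynomial.T (-1), Algebra.subset_adjoin (Or.inr rfl)⟩

/-- The associated graded ring `G(I) = R'(I) / T⁻¹ R'(I)` of the ideal `I`. -/
abbrev AssociatedGradedRing {A : Type*} [CommRing A] (I : Ideal A) : Type _ :=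
  extendedReesAlgebra I ⧸ Ideal.span {extendedReesAlgebra.Tinv I}

/-- The fiber cone `F(I) = R(I) / 𝔪 R(I)` of an ideal `I` of a local ring,
where `R(I) = A[IT] ⊆ A[T]` is the Rees algebra. -/
abbrev FiberCone {A : Type*} [CommRing A] [IsLocalRing A] (I : Ideal A) : Type _ :=
  reesAlgebra I ⧸ (maximalIdeal A).map (algebraMap A (reesAlgebra I))

/-! ### Regular sequences modulo an ideal, globally and locally at a prime -/

section RegularMod

variable {R : Type*} [CommRing R]

/-! Write `𝔪` for the maximal ideal and `R` for the Rees algebra `A[It]`. Dividing by a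
nonzerodivisor lowers the self-injective dimension, and a Noetherian local ring of depth zero and
finite self-injective dimension is self-injective. Hence systems of parameters of `A` are regular
sequences and `A ⧸ Q` is self-injective: ideals above `Q` are their own double annihilators modulo
`Q`, and the socle of `A ⧸ Q` is simple. Integrality makes `Q` a reduction of `I`, and since `Q` has
only `d` generators this forces `Q ∩ 𝔪I = 𝔪Q` (`inf_maximalIdeal_mul_le`).

The heart is `𝔪I² = 𝔪QI` (`maximalIdeal_mul_sq_le`). For `a ∈ 𝔪` and `y, w ∈ I`, the elements `ay`
and `aw` are in the socle modulo `Q`. If one of them lies in `Q`, it lies in `Q ∩ 𝔪I = 𝔪Q`.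
Otherwise `v(A/Q) > 1` gives `f ∈ 𝔪`, independent of `a` modulo `𝔪² + Q`, with `fw ∈ Q`; duality
gives `w' ∈ I` with `fw' ∉ Q`. As the socle is simple, `ay` is a multiple of `fw'` up to an error in
`Q ∩ 𝔪I`, so `ayw` is a multiple of `(fw)w'` up to an element of `𝔪QI`. Because `Q` is generated by
a regular sequence, `x ∈ Q^n` and `𝔪²x ⊆ Q^(n+1)` imply `x ∈ Q^n I` (`mem_pow_mul_colon`). This
yields `Q ∩ I² = QI` (`inf_sq_le`) and then `I³ = QI²` (`pow_three_le`).

It follows that `Q ∩ I^(n+1) = QI^n` and `Q ∩ 𝔪I^(n+1) = 𝔪QI^n` for all `n`. By the argument of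
Valabrega and Valla, the elements `X j = q j t` form a regular sequence on `R/IR = G(I)` and on
`R/𝔪R = F(I)`. At an arbitrary maximal ideal, the `X j` are replaced by monic polynomials in them,
whose leading forms are powers of the `X j`.

For the Rees algebra, maximal ideals `M` are of three kinds. If `M` does not contain `I`, then `R`
is locally `A[t]` and `A` is Cohen–Macaulay. If `M ⊇ I` but some `X j ∉ M`, then `IR` is locally
generated by the nonzerodivisor `q j`, with quotient `G(I)`. If `M` contains `I` and all `X j`, the
sequence `q 0, q 1 - q 0 t, …, q (d-1) - q (d-2) t, q (d-1) t` is regular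
(`ReductionSystem.regularMod_reesParameter`); only here does `d ≥ 3` enter, through `I³ = QI²`. -/

theorem Ideal.mem_sup_span_singleton_iff {J : Ideal R} {x u : R} :
    u ∈ J ⊔ Ideal.span {x} ↔ ∃ j ∈ J, ∃ w, u = j + x * w := by
  rw [sup_comm, Ideal.mem_span_singleton_sup]
  constructor
  · rintro ⟨a, b, hb, rfl⟩
    exact ⟨b, hb, a, by ring⟩
  · rintro ⟨j, hj, w, rfl⟩
    exact ⟨w, j, hj, by ring⟩

theorem Ideal.mul_mem_sup_span_singleton (J : Ideal R) (x w : R) :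
    x * w ∈ J ⊔ Ideal.span {x} :=
  Ideal.mem_sup_right (Ideal.mul_mem_right _ _ (Ideal.mem_span_singleton_self x))

/-- The list `xs` is a weakly regular sequence on `R ⧸ J`. -/
def RegularMod : Ideal R → List R → Prop
  | _, [] => True
  | J, x :: xs => (∀ u, x * u ∈ J → u ∈ J) ∧ RegularMod (J ⊔ Ideal.span {x}) xs

/-- The list `xs` is a weakly regular sequence on the localization of `R ⧸ J` at the
complement of `M`. -/
def LocallyRegularMod (M : Ideal R) : Ideal R → List R → Prop
  | _, [] => True
  | J, x :: xs => (∀ u, x * u ∈ J → ∃ s ∉ M, s * u ∈ J) ∧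
      LocallyRegularMod M (J ⊔ Ideal.span {x}) xs

theorem RegularMod.locally {M : Ideal R} (hM : M ≠ ⊤) {J : Ideal R} {xs : List R}
    (h : RegularMod J xs) : LocallyRegularMod M J xs := by
  induction xs generalizing J with
  | nil => trivial
  | cons x xs ih =>
    exact ⟨fun u hu => ⟨1, fun h1 => hM ((Ideal.eq_top_iff_one M).2 h1),
      by simpa using h.1 u hu⟩, ih h.2⟩

theorem Ideal.sup_ofList_cons (J : Ideal R) (x : R) (xs : List R) :
    J ⊔ Ideal.ofList (x :: xs) = J ⊔ Ideal.span {x} ⊔ Ideal.ofList xs := by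
  rw [Ideal.ofList_cons, sup_assoc]

theorem regularMod_append {J : Ideal R} {xs ys : List R} :
    RegularMod J (xs ++ ys) ↔ RegularMod J xs ∧ RegularMod (J ⊔ Ideal.ofList xs) ys := by
  induction xs generalizing J with
  | nil => simp [RegularMod]
  | cons x xs ih => rw [List.cons_append, RegularMod, RegularMod, ih, Ideal.sup_ofList_cons, and_assoc]

theorem locallyRegularMod_append {M J : Ideal R} {xs ys : List R} :
    LocallyRegularMod M J (xs ++ ys) ↔
      LocallyRegularMod M J xs ∧ LocallyRegularMod M (J ⊔ Ideal.ofList xs) ys := by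
  induction xs generalizing J with
  | nil => simp [LocallyRegularMod]
  | cons x xs ih =>
    rw [List.cons_append, LocallyRegularMod, LocallyRegularMod, ih, Ideal.sup_ofList_cons,
      and_assoc]

/-- The ideal generated by the first `i` members of a sequence. -/
def initialSpan (g : ℕ → R) (i : ℕ) : Ideal R := Ideal.span (g '' Set.Iio i)

theorem initialSpan_zero (g : ℕ → R) : initialSpan g 0 = ⊥ := by
  simp [initialSpan, Set.Iio]

theorem initialSpan_succ (g : ℕ → R) (i : ℕ) :
    initialSpan g (i + 1) = initialSpan g i ⊔ Ideal.span {g i} := by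
  rw [initialSpan, initialSpan, ← Ideal.span_union]
  congr 1
  ext x
  simp only [Set.mem_image, Set.mem_Iio, Set.mem_union, Set.mem_singleton_iff]
  constructor
  · rintro ⟨j, hj, rfl⟩
    rcases Nat.lt_succ_iff_lt_or_eq.1 hj with h | rfl
    · exact Or.inl ⟨j, h, rfl⟩
    · exact Or.inr rfl
  · rintro (⟨j, hj, rfl⟩ | rfl)
    · exact ⟨j, by omega, rfl⟩
    · exact ⟨i, by omega, rfl⟩

theorem initialSpan_mono (g : ℕ → R) {i j : ℕ} (h : i ≤ j) :
    initialSpan g i ≤ initialSpan g j :=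
  Ideal.span_mono (Set.image_mono (Set.Iio_subset_Iio h))

theorem mem_initialSpan (g : ℕ → R) {i j : ℕ} (h : i < j) : g i ∈ initialSpan g j :=
  Ideal.subset_span ⟨i, h, rfl⟩

theorem initialSpan_le {g : ℕ → R} {i : ℕ} {K : Ideal R} (h : ∀ j < i, g j ∈ K) :
    initialSpan g i ≤ K := by
  rw [initialSpan, Ideal.span_le]
  rintro _ ⟨j, hj, rfl⟩
  exact h j hj

theorem ofList_map_range (g : ℕ → R) (i : ℕ) :
    Ideal.ofList ((List.range i).map g) = initialSpan g i := by
  rw [initialSpan, Ideal.ofList]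
  congr 1
  ext x
  simp

theorem regularMod_map_range_iff {J : Ideal R} {g : ℕ → R} {d : ℕ} :
    RegularMod J ((List.range d).map g) ↔
      ∀ i < d, ∀ u, g i * u ∈ J ⊔ initialSpan g i → u ∈ J ⊔ initialSpan g i := by
  induction d with
  | zero => simp [RegularMod]
  | succ d ih =>
    rw [List.range_succ, List.map_append, regularMod_append, ih, ofList_map_range]
    simp only [List.map_cons, List.map_nil, RegularMod, and_true]
    constructor
    · rintro ⟨h1, h2⟩ i hi
      rcases Nat.lt_succ_iff_lt_or_eq.1 hi with h | rfl
      · exact h1 i h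
      · exact h2
    · intro h
      exact ⟨fun i hi => h i (by omega), h d (by omega)⟩

/-- If `a` is regular modulo `J` and `ys` is a weakly regular sequence on `R ⧸ (J, a)` and on
`R ⧸ (J, b)`, then it is one on `R ⧸ (J, a * b)`. -/
theorem RegularMod.sup_span_mul {J : Ideal R} {a b : R} {ys : List R}
    (ha : ∀ u, a * u ∈ J → u ∈ J) (h1 : RegularMod (J ⊔ Ideal.span {a}) ys)
    (h2 : RegularMod (J ⊔ Ideal.span {b}) ys) : RegularMod (J ⊔ Ideal.span {a * b}) ys := by
  induction ys generalizing J with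
  | nil => trivial
  | cons y ys ih =>
    refine ⟨fun u hu => ?_, ?_⟩
    · obtain ⟨j, hj, w, hw⟩ := Ideal.mem_sup_span_singleton_iff.1 hu
      have hua : u ∈ J ⊔ Ideal.span {a} := h1.1 u
        (Ideal.mem_sup_span_singleton_iff.2 ⟨j, hj, b * w, by rw [hw]; ring⟩)
      obtain ⟨j', hj', v, rfl⟩ := Ideal.mem_sup_span_singleton_iff.1 hua
      have h3 : y * v - b * w ∈ J := ha _ <| by
        have : a * (y * v - b * w) = j - y * j' := by linear_combination hw
        rw [this]
        exact sub_mem hj (J.mul_mem_left _ hj')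
      have h4 := h2.1 v (Ideal.mem_sup_span_singleton_iff.2 ⟨_, h3, w, by ring⟩)
      obtain ⟨k, hk, z, rfl⟩ := Ideal.mem_sup_span_singleton_iff.1 h4
      exact Ideal.mem_sup_span_singleton_iff.2
        ⟨j' + a * k, add_mem hj' (J.mul_mem_left _ hk), z, by ring⟩
    · rw [sup_right_comm]
      -- The induction now runs over `J + (y)` and needs `a` regular there. The exchange `a, y ↦ y,
      -- a` provides this without any local hypothesis.
      refine ih (fun u hu => ?_) (by rw [sup_right_comm]; exact h1.2)
        (by rw [sup_right_comm]; exact h2.2)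
      obtain ⟨j, hj, w, hw⟩ := Ideal.mem_sup_span_singleton_iff.1 hu
      have hwa : w ∈ J ⊔ Ideal.span {a} := h1.1 w
        (Ideal.mem_sup_span_singleton_iff.2 ⟨-j, neg_mem hj, u, by rw [hw]; ring⟩)
      obtain ⟨j', hj', v, rfl⟩ := Ideal.mem_sup_span_singleton_iff.1 hwa
      have h3 : u - y * v ∈ J := ha _ <| by
        have : a * (u - y * v) = j + y * j' := by linear_combination hw
        rw [this]
        exact add_mem hj (J.mul_mem_left _ hj')
      exact Ideal.mem_sup_span_singleton_iff.2 ⟨_, h3, v, by ring⟩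

theorem RegularMod.sup_span_pow {J : Ideal R} {a : R} {ys : List R}
    (ha : ∀ u, a * u ∈ J → u ∈ J) (h : RegularMod (J ⊔ Ideal.span {a}) ys) (n : ℕ) :
    RegularMod (J ⊔ Ideal.span {a ^ n}) ys := by
  induction n with
  | zero =>
    have : ∀ (ys : List R), RegularMod ⊤ ys := by
      intro ys
      induction ys with
      | nil => trivial
      | cons y ys ih => exact ⟨fun _ _ => trivial, by simpa using ih⟩
    simpa [Ideal.span_singleton_one] using this ys
  | succ n ih =>
    rw [pow_succ']
    exact RegularMod.sup_span_mul ha h ih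

/-- Used because the leading form of a monic polynomial in `q j t` is a power of `q j t`. -/
theorem regularMod_pow {J : Ideal R} {g : ℕ → R} (n : ℕ → ℕ) {l : List ℕ}
    (h : RegularMod J (l.map g)) : RegularMod J (l.map fun i => g i ^ n i) := by
  induction l generalizing J with
  | nil => trivial
  | cons i l ih =>
    refine ⟨fun u hu => ?_, ?_⟩
    · change g i ^ n i * u ∈ J at hu
      generalize n i = k at hu
      induction k with
      | zero => simpa using hu
      | succ k ihk =>
        rw [pow_succ', mul_assoc] at hu
        exact ihk (h.1 _ hu)
    · exact RegularMod.sup_span_pow h.1 (ih h.2) _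

/-- If `s * J' ⊆ J ⊆ J'` for some `s` outside the prime ideal `M`, then local regularity modulo
`J'` implies local regularity modulo `J`. -/
theorem LocallyRegularMod.of_mul_le {M : Ideal R} [M.IsPrime] {s : R} (hs : s ∉ M)
    {J J' : Ideal R} (hle : J ≤ J') (hmul : ∀ u ∈ J', s * u ∈ J) {xs : List R}
    (h : LocallyRegularMod M J' xs) : LocallyRegularMod M J xs := by
  induction xs generalizing J J' with
  | nil => trivial
  | cons x xs ih =>
    refine ⟨fun u hu => ?_, ih (sup_le_sup_right hle _) (fun u hu => ?_) h.2⟩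
    · obtain ⟨r, hr, hru⟩ := h.1 u (hle hu)
      refine ⟨s * r, fun hh => (Ideal.IsPrime.mem_or_mem ‹_› hh).elim hs hr, ?_⟩
      rw [mul_assoc]
      exact hmul _ hru
    · obtain ⟨j, hj, w, rfl⟩ := Ideal.mem_sup_span_singleton_iff.1 hu
      exact Ideal.mem_sup_span_singleton_iff.2 ⟨s * j, hmul j hj, s * w, by ring⟩

end RegularMod

/-! ### A criterion for a localized quotient to be Cohen–Macaulay -/

section CohenMacaulayCriterion

open RingTheory.Sequence

variable {R : Type*} [CommRing R]

theorem regularMod_iff_isWeaklyRegular (xs : List R) :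
    RegularMod (⊥ : Ideal R) xs ↔ IsWeaklyRegular R xs := by
  induction xs using List.reverseRecOn with
  | nil => simp [RegularMod]
  | append_singleton xs x ih =>
    rw [regularMod_append, ih, isWeaklyRegular_append_iff, isWeaklyRegular_singleton_iff]
    refine and_congr_right fun _ => ?_
    simp only [RegularMod, and_true, bot_sup_eq]
    rw [isSMulRegular_quotient_iff_mem_of_smul_mem]
    simp

variable {S : Type*} [CommRing S]

theorem isNoetherianRing_of_surjective_up_to_units [IsNoetherianRing R] (f : R →+* S)
    (h : ∀ y : S, ∃ r s, IsUnit (f s) ∧ y * f s = f r) : IsNoetherianRing S := by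
  refine (isNoetherianRing_iff_ideal_fg S).2 fun a => ?_
  have : a = (a.comap f).map f := by
    refine le_antisymm (fun y hy => ?_) Ideal.map_comap_le
    obtain ⟨r, s, hs, hrs⟩ := h y
    have hr : f r ∈ (a.comap f).map f := by
      apply Ideal.mem_map_of_mem
      rw [Ideal.mem_comap, ← hrs]
      exact a.mul_mem_right _ hy
    rw [← hrs] at hr
    exact (Ideal.mul_unit_mem_iff_mem _ hs).1 hr
  rw [this]
  exact Ideal.FG.map (IsNoetherian.noetherian _) f

/-- A criterion for a localization `S` of `R ⧸ J` at the prime ideal `M` to be Cohen-Macaulay. -/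
theorem isCohenMacaulayLocal_of_locallyRegularMod [IsLocalRing S] [IsNoetherianRing R] {M J : Ideal R}
    [M.IsPrime] (f : R →+* S) (hunit : ∀ s ∉ M, IsUnit (f s))
    (hsurj : ∀ y : S, ∃ r, ∃ s ∉ M, y * f s = f r)
    (hker : ∀ r, f r = 0 ↔ ∃ s ∉ M, s * r ∈ J)
    (xs : List R) (hreg : LocallyRegularMod M J xs)
    (hmin : M ∈ (J ⊔ Ideal.ofList xs).minimalPrimes) : IsCohenMacaulayLocal S := by
  have hN : IsNoetherianRing S := isNoetherianRing_of_surjective_up_to_units f fun y => by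
    obtain ⟨r, s, hs, h⟩ := hsurj y
    exact ⟨r, s, hunit s hs, h⟩
  have hmul : ∀ {a b : R}, a ∉ M → b ∉ M → a * b ∉ M := fun ha hb h =>
    (Ideal.IsPrime.mem_or_mem ‹_› h).elim ha hb
  -- Elements of the extended ideal are fractions with numerator in `K`; the kernel of `f`, which is
  -- `J` up to factors outside `M`, is absorbed by `K`.
  have hmapmem : ∀ (K : Ideal R), J ≤ K → ∀ u, f u ∈ K.map f → ∃ s ∉ M, s * u ∈ K := by
    intro K hJK u hu
    have key : ∀ y ∈ K.map f, ∃ r ∈ K, ∃ s ∉ M, y * f s = f r := by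
      intro y hy
      induction hy using Submodule.span_induction with
      | mem y hy =>
        obtain ⟨r, hr, rfl⟩ := hy
        exact ⟨r, hr, 1, fun h => Ideal.IsPrime.ne_top ‹_› ((Ideal.eq_top_iff_one M).2 h),
          by simp⟩
      | zero => exact ⟨0, K.zero_mem, 1,
          fun h => Ideal.IsPrime.ne_top ‹_› ((Ideal.eq_top_iff_one M).2 h), by simp⟩
      | add y z _ _ hy hz =>
        obtain ⟨r, hr, s, hs, h⟩ := hy
        obtain ⟨r', hr', s', hs', h'⟩ := hz
        refine ⟨r * s' + r' * s, add_mem (K.mul_mem_right _ hr) (K.mul_mem_right _ hr'), s * s',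
          hmul hs hs', ?_⟩
        simp only [map_mul, map_add]
        linear_combination f s' * h + f s * h'
      | smul a y _ hy =>
        obtain ⟨r, hr, s, hs, h⟩ := hy
        obtain ⟨r', s', hs', h'⟩ := hsurj a
        refine ⟨r' * r, K.mul_mem_left _ hr, s' * s, hmul hs' hs, ?_⟩
        simp only [map_mul, smul_eq_mul]
        linear_combination f r' * h + y * f s * h'
    obtain ⟨r, hr, s, hs, h⟩ := key _ hu
    have h0 : f (u * s - r) = 0 := by simp [h]
    obtain ⟨t, ht, htJ⟩ := (hker _).1 h0
    refine ⟨t * s, hmul ht hs, ?_⟩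
    have := add_mem (hJK htJ) (K.mul_mem_left t hr)
    convert! this using 1
    ring
  have hMmem : ∀ r ∈ M, f r ∈ maximalIdeal S := by
    intro r hr hu
    obtain ⟨v, hv⟩ := hu.exists_right_inv
    obtain ⟨a, s, hs, h⟩ := hsurj v
    have h0 : f (r * a - s) = 0 := by
      rw [map_sub, map_mul, ← h]
      linear_combination (f s) * hv
    obtain ⟨t, ht, htJ⟩ := (hker _).1 h0
    have h1 : t * (r * a - s) ∈ M := hmin.1.2 (Ideal.mem_sup_left htJ)
    have h2 : t * s ∈ M := by
      have := sub_mem (M.mul_mem_left t (M.mul_mem_right a hr)) h1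
      convert! this using 1
      ring
    exact hmul ht hs h2
  have hmapJ : J.map f = ⊥ := by
    rw [Ideal.map_eq_bot_iff_le_ker]
    intro j hj
    exact (hker j).2 ⟨1, fun h => Ideal.IsPrime.ne_top ‹_› ((Ideal.eq_top_iff_one M).2 h),
      by simpa using hj⟩
  have hregS : ∀ (xs : List R) (K : Ideal R), J ≤ K → LocallyRegularMod M K xs →
      RegularMod (K.map f) (xs.map f) := by
    intro xs
    induction xs with
    | nil => intros; trivial
    | cons x xs ih =>
      intro K hJK h
      refine ⟨fun v hv => ?_, ?_⟩
      · obtain ⟨a, s, hs, hvs⟩ := hsurj v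
        have h1 : f (x * a) ∈ K.map f := by
          rw [map_mul, ← hvs, ← mul_assoc]
          exact Ideal.mul_mem_right _ _ hv
        obtain ⟨t, ht, htK⟩ := hmapmem K hJK _ h1
        obtain ⟨t', ht', htK'⟩ := h.1 (t * a) (by convert! htK using 1; ring)
        have h2 : f (t' * (t * a)) ∈ K.map f := Ideal.mem_map_of_mem f htK'
        have h3 : v * f (t' * t * s) ∈ K.map f := by
          convert! h2 using 1
          simp only [map_mul, ← hvs]
          ring
        exact (Ideal.mul_unit_mem_iff_mem _ (hunit _ (hmul (hmul ht' ht) hs))).1 h3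
      · have := ih (K ⊔ Ideal.span {x}) (hJK.trans le_sup_left) h.2
        rwa [Ideal.map_sup, Ideal.map_span, Set.image_singleton] at this
  have hwr : IsWeaklyRegular S (xs.map f) := by
    rw [← regularMod_iff_isWeaklyRegular, ← hmapJ]
    exact hregS xs J le_rfl hreg
  have hxs : ∀ r ∈ xs.map f, r ∈ maximalIdeal S := by
    intro r hr
    obtain ⟨x, hx, rfl⟩ := List.mem_map.1 hr
    exact hMmem x (hmin.1.2 (Ideal.mem_sup_right (Ideal.subset_span hx)))
  have hr : IsRegular S (xs.map f) :=
    (IsLocalRing.isRegular_iff_isWeaklyRegular_of_subset_maximalIdeal hxs).2 hwr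
  refine ⟨hN, xs.map f, hxs, hr, ?_⟩
  rw [← ringKrullDim_add_length_eq_ringKrullDim_of_isRegular _ hr]
  have hle : Ideal.ofList (xs.map f) ≤ maximalIdeal S := Ideal.span_le.2 hxs
  have hnt : Nontrivial (S ⧸ Ideal.ofList (xs.map f)) :=
    Ideal.Quotient.nontrivial_iff.2 fun h => by
      rw [h, top_le_iff] at hle
      exact (maximalIdeal.isMaximal S).ne_top hle
  -- A regular sequence lowers the dimension by exactly its length, so only this is left. A prime of
  -- the quotient contracts to a prime of `R` inside `M` containing `J` and `xs`, which is `M` by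
  -- minimality.
  have hdim : ringKrullDim (S ⧸ Ideal.ofList (xs.map f)) = 0 := by
    refine le_antisymm ?_ ringKrullDim_nonneg_of_nontrivial
    suffices h : Ring.KrullDimLE 0 (S ⧸ Ideal.ofList (xs.map f)) by
      exact Ring.krullDimLE_iff.1 h
    rw [Ring.krullDimLE_zero_iff]
    intro P hP
    have hPc : (P.comap (Ideal.Quotient.mk (Ideal.ofList (xs.map f)))).comap f = M := by
      have hprime : ((P.comap (Ideal.Quotient.mk (Ideal.ofList (xs.map f)))).comap f).IsPrime :=
        inferInstance
      have hleM : (P.comap (Ideal.Quotient.mk (Ideal.ofList (xs.map f)))).comap f ≤ M := by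
        intro r hr'
        by_contra hrM
        have := hunit r hrM
        rw [Ideal.mem_comap, Ideal.mem_comap] at hr'
        exact hP.ne_top (Ideal.eq_top_of_isUnit_mem _ hr' (this.map _))
      refine le_antisymm hleM (hmin.2 ⟨hprime, ?_⟩ hleM)
      refine sup_le (fun j hj => ?_) (Ideal.span_le.2 fun x hx => ?_)
      · have : f j = 0 := by
          rw [← Ideal.mem_bot, ← hmapJ]
          exact Ideal.mem_map_of_mem f hj
        simp [Ideal.mem_comap, this]
      · simp only [SetLike.mem_coe, Ideal.mem_comap]
        have h0 : Ideal.Quotient.mk (Ideal.ofList (xs.map f)) (f x) = 0 :=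
          Ideal.Quotient.eq_zero_iff_mem.2 (Ideal.subset_span (List.mem_map_of_mem hx))
        rw [h0]
        exact P.zero_mem
    have hmax : P.comap (Ideal.Quotient.mk (Ideal.ofList (xs.map f))) = maximalIdeal S := by
      refine le_antisymm (le_maximalIdeal (Ideal.IsPrime.ne_top inferInstance)) fun y hy => ?_
      obtain ⟨r, s, hs, h⟩ := hsurj y
      have hrM : r ∈ M := by
        by_contra hrM
        have := hunit r hrM
        rw [← h] at this
        exact hy (isUnit_of_mul_isUnit_left this)
      rw [← hPc, Ideal.mem_comap, ← h] at hrM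
      exact (Ideal.mul_unit_mem_iff_mem _ (hunit s hs)).1 hrM
    have hmax' : (P.comap (Ideal.Quotient.mk (Ideal.ofList (xs.map f)))).IsMaximal :=
      hmax ▸ maximalIdeal.isMaximal S
    have := Ideal.map_eq_top_or_isMaximal_of_surjective
      (Ideal.Quotient.mk (Ideal.ofList (xs.map f))) Ideal.Quotient.mk_surjective hmax'
    rw [Ideal.map_comap_of_surjective _ Ideal.Quotient.mk_surjective] at this
    exact this.resolve_left hP.ne_top
  rw [hdim]
  exact (zero_add _).symm

end CohenMacaulayCriterion

/-! ### Self-injective dimension modulo a nonzerodivisor -/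

section ChangeOfRings

open CategoryTheory

variable {A : Type u} [CommRing A] (x : A)

/-- The torsion submodule is `Hom(A/x, E)`. An extension over `A` of a map into it still has
`x`-torsion values, since its source is killed by `x`. -/
theorem injective_torsionBy (E : Type u) [AddCommGroup E] [Module A E] [Module.Injective A E] :
    Module.Injective (A ⧸ Ideal.span {x}) (Submodule.torsionBy A E x) := by
  refine ⟨fun X Y _ _ _ _ f hf g => ?_⟩
  let mX : Module A X := Module.compHom X (Ideal.Quotient.mk (Ideal.span {x}))
  let mY : Module A Y := Module.compHom Y (Ideal.Quotient.mk (Ideal.span {x}))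
  let f' : X →ₗ[A] Y := { toFun := f, map_add' := map_add f, map_smul' := fun a v => map_smul f (Ideal.Quotient.mk _ a) v }
  let g' : X →ₗ[A] E :=
    { toFun := fun v => (g v : E)
      map_add' := fun v w => by simp
      map_smul' := fun a v => by
        have : g (a • v) = a • g v := map_smul g (Ideal.Quotient.mk _ a) v
        simp [this] }
  obtain ⟨h, hh⟩ := Module.Injective.out f' hf g'
  have hx : ∀ y : Y, x • y = 0 := fun y => by
    change (Ideal.Quotient.mk (Ideal.span {x}) x) • y = 0
    rw [Ideal.Quotient.eq_zero_iff_mem.2 (Ideal.mem_span_singleton_self x), zero_smul]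
  refine ⟨{ toFun := fun y => ⟨h y, ?_⟩, map_add' := ?_, map_smul' := ?_ }, ?_⟩
  · rw [Submodule.mem_torsionBy_iff, ← map_smul, hx, map_zero]
  · intro y z
    ext
    simp
  · intro a y
    obtain ⟨a, rfl⟩ := Ideal.Quotient.mk_surjective a
    ext
    exact map_smul h a y
  · intro v
    ext
    exact hh v

/-- The map induced by a linear map on `x`-torsion submodules. -/
def torsionByMap {M N : Type*} [AddCommGroup M] [Module A M] [AddCommGroup N] [Module A N]
    (f : M →ₗ[A] N) :
    Submodule.torsionBy A M x →ₗ[A ⧸ Ideal.span {x}] Submodule.torsionBy A N x where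
  toFun v := ⟨f v, by
    have h := v.2
    rw [Submodule.mem_torsionBy_iff] at h ⊢
    rw [← map_smul, h, map_zero]⟩
  map_add' v w := by
    ext
    simp
  map_smul' a v := by
    obtain ⟨a, rfl⟩ := Ideal.Quotient.mk_surjective a
    ext
    exact map_smul f a (v : M)

theorem Module.Injective.exists_smul_eq {x : A} (hx : ∀ a : A, x * a = 0 → a = 0)
    (E : Type u) [AddCommGroup E] [Module A E] [Module.Injective A E] (e : E) :
    ∃ e', x • e' = e := by
  have hinj : Function.Injective (LinearMap.mulLeft A x) := by
    rw [injective_iff_map_eq_zero]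
    exact fun a ha => hx a ha
  obtain ⟨h, hh⟩ := Module.Injective.extension_property A E A A (LinearMap.mulLeft A x) hinj
    (LinearMap.toSpanSingleton A E e)
  refine ⟨h 1, ?_⟩
  have := LinearMap.congr_fun hh 1
  simp only [LinearMap.comp_apply, LinearMap.mulLeft_apply, LinearMap.toSpanSingleton_apply,
    one_smul, mul_one] at this
  rw [← map_smul, smul_eq_mul, mul_one, this]

/-- On `x`-divisible modules `x`-torsion is an exact functor, and it preserves injectives. Injective
modules and the quotients of them are divisible, so a whole injective resolution of `C` is carried
over. -/
theorem hasInjectiveDimensionLE_torsionBy {x : A} (hx : ∀ a : A, x * a = 0 → a = 0) (n : ℕ)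
    (C : Type u) [AddCommGroup C] [Module A C]
    (hdiv : ∀ c : C, ∃ c', x • c' = c) (h : HasInjectiveDimensionLE (ModuleCat.of A C) n) :
    HasInjectiveDimensionLE
      (ModuleCat.of (A ⧸ Ideal.span {x}) (Submodule.torsionBy A C x)) n := by
  induction n generalizing C with
  | zero =>
    simp only [HasInjectiveDimensionLE, zero_add, ← injective_iff_hasInjectiveDimensionLT_one]
      at h ⊢
    rw [← Module.injective_iff_injective_object] at h ⊢
    exact injective_torsionBy x C
  | succ n ih =>
    obtain ⟨I, hI, f, hf⟩ := EnoughInjectives.presentation (ModuleCat.of A C)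
    have injf : Function.Injective f.hom := (ModuleCat.mono_iff_injective f).mp hf
    have hIm : Module.Injective A I := Module.injective_module_of_injective_object A I
    let S : ShortComplex (ModuleCat.{u} A) :=
      ModuleCat.shortComplexOfCompEqZero _ _ f.hom.exact_map_mkQ_range.linearMap_comp_eq_zero
    have hS : S.ShortExact := ModuleCat.shortComplex_shortExact S
      f.hom.exact_map_mkQ_range injf (Submodule.mkQ_surjective _)
    have hQ : HasInjectiveDimensionLE (ModuleCat.of A (I ⧸ f.hom.range)) n :=
      (hS.hasInjectiveDimensionLT_X₃_iff n hI).2 h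
    have hQ' := ih (I ⧸ f.hom.range) (fun c => by
      obtain ⟨e, rfl⟩ := Submodule.mkQ_surjective _ c
      obtain ⟨e', rfl⟩ := Module.Injective.exists_smul_eq hx I e
      exact ⟨Submodule.mkQ _ e', (map_smul _ _ _).symm⟩) hQ
    have hex : Function.Exact (torsionByMap x f.hom) (torsionByMap x (Submodule.mkQ f.hom.range)) := by
      intro e
      constructor
      · intro he
        have h1 : Submodule.mkQ f.hom.range (e : I) = 0 := congrArg Subtype.val he
        rw [Submodule.mkQ_apply, Submodule.Quotient.mk_eq_zero] at h1
        obtain ⟨c, hc⟩ := h1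
        refine ⟨⟨c, ?_⟩, Subtype.ext hc⟩
        rw [Submodule.mem_torsionBy_iff]
        apply injf
        have := e.2
        rw [Submodule.mem_torsionBy_iff] at this
        rw [map_smul, hc, this, map_zero]
      · rintro ⟨c, rfl⟩
        ext
        exact (Submodule.Quotient.mk_eq_zero _).2 ⟨_, rfl⟩
    let T : ShortComplex (ModuleCat.{u} (A ⧸ Ideal.span {x})) :=
      ModuleCat.shortComplexOfCompEqZero _ _ hex.linearMap_comp_eq_zero
    have hT : T.ShortExact := by
      refine ModuleCat.shortComplex_shortExact T hex ?_ ?_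
      · intro c c' hcc
        exact Subtype.ext (injf (congrArg Subtype.val hcc))
      · intro c
        obtain ⟨e, he⟩ := Submodule.mkQ_surjective _ (c : I ⧸ f.hom.range)
        have h1 : f.hom.range.mkQ (x • e) = 0 := by
          have := c.2
          rw [Submodule.mem_torsionBy_iff] at this
          rw [map_smul, he, this]
        rw [Submodule.mkQ_apply, Submodule.Quotient.mk_eq_zero] at h1
        obtain ⟨c₁, hc₁⟩ := h1
        obtain ⟨c₂, hc₂⟩ := hdiv c₁
        refine ⟨⟨e - f.hom c₂, ?_⟩, Subtype.ext ?_⟩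
        · rw [Submodule.mem_torsionBy_iff, smul_sub, ← map_smul, hc₂, hc₁, sub_self]
        · change f.hom.range.mkQ (e - f.hom c₂) = c
          rw [map_sub, he, sub_eq_self, Submodule.mkQ_apply, Submodule.Quotient.mk_eq_zero]
          exact ⟨c₂, rfl⟩
    have hTI : Injective T.X₂ := by
      change Injective (ModuleCat.of _ (Submodule.torsionBy A I x))
      rw [← Module.injective_iff_injective_object]
      exact injective_torsionBy x I
    exact (hT.hasInjectiveDimensionLT_X₃_iff n hTI).1 hQ'

/-- Dividing out a nonzerodivisor lowers the self-injective dimension by one. -/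
theorem hasInjectiveDimensionLE_quotient_span_singleton {x : A}
    (hx : ∀ a : A, x * a = 0 → a = 0) (n : ℕ)
    (h : HasInjectiveDimensionLE (ModuleCat.of A A) (n + 1)) :
    HasInjectiveDimensionLE
      (ModuleCat.of (A ⧸ Ideal.span {x}) (A ⧸ Ideal.span {x})) n := by
  obtain ⟨I, hI, f, hf⟩ := EnoughInjectives.presentation (ModuleCat.of A A)
  have injf : Function.Injective f.hom := (ModuleCat.mono_iff_injective f).mp hf
  have hIm : Module.Injective A I := Module.injective_module_of_injective_object A I
  let S : ShortComplex (ModuleCat.{u} A) :=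
    ModuleCat.shortComplexOfCompEqZero _ _ f.hom.exact_map_mkQ_range.linearMap_comp_eq_zero
  have hS : S.ShortExact := ModuleCat.shortComplex_shortExact S
    f.hom.exact_map_mkQ_range injf (Submodule.mkQ_surjective _)
  have hQ : HasInjectiveDimensionLE (ModuleCat.of A (I ⧸ f.hom.range)) n :=
    (hS.hasInjectiveDimensionLT_X₃_iff n hI).2 h
  have hQ' := hasInjectiveDimensionLE_torsionBy hx n (I ⧸ f.hom.range) (fun c => by
    obtain ⟨e, rfl⟩ := Submodule.mkQ_surjective _ c
    obtain ⟨e', rfl⟩ := Module.Injective.exists_smul_eq hx I e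
    exact ⟨Submodule.mkQ _ e', (map_smul _ _ _).symm⟩) hQ
  have hmem : ∀ c : Submodule.torsionBy A (I ⧸ f.hom.range) x, ∃ e : I, ∃ a : A,
      Submodule.mkQ f.hom.range e = c ∧ f.hom a = x • e := by
    intro c
    obtain ⟨e, he⟩ := Submodule.mkQ_surjective _ (c : I ⧸ f.hom.range)
    have h1 : f.hom.range.mkQ (x • e) = 0 := by
      have := c.2
      rw [Submodule.mem_torsionBy_iff] at this
      rw [map_smul, he, this]
    rw [Submodule.mkQ_apply, Submodule.Quotient.mk_eq_zero] at h1
    obtain ⟨a, ha⟩ := h1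
    exact ⟨e, a, he, ha⟩
  choose e a he ha using hmem
  have hconn : ∀ (c : Submodule.torsionBy A (I ⧸ f.hom.range) x) (e' : I) (a' : A),
      Submodule.mkQ f.hom.range e' = c → f.hom a' = x • e' →
      Ideal.Quotient.mk (Ideal.span {x}) (a c) = Ideal.Quotient.mk _ a' := by
    intro c e' a' he' ha'
    have h1 : f.hom.range.mkQ (e c - e') = 0 := by rw [map_sub, he, he', sub_self]
    rw [Submodule.mkQ_apply, Submodule.Quotient.mk_eq_zero] at h1
    obtain ⟨b, hb⟩ := h1
    rw [Ideal.Quotient.eq, Ideal.mem_span_singleton']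
    refine ⟨b, injf ?_⟩
    rw [map_sub, ha, ha', ← smul_sub, ← hb, ← map_smul, smul_eq_mul, mul_comm]
  -- The connecting map of the snake lemma for multiplication by `x` on `0 → A → I → I/A → 0`. As
  -- `A` has no `x`-torsion and `I` is divisible, it gives `0 → I[x] → (I/A)[x] → A/x → 0`, in which
  -- the first term is injective and the second has dimension at most `n`.
  let δ : Submodule.torsionBy A (I ⧸ f.hom.range) x →ₗ[A ⧸ Ideal.span {x}] A ⧸ Ideal.span {x} :=
    { toFun := fun c => Ideal.Quotient.mk _ (a c)
      map_add' := fun c c' => by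
        rw [hconn (c + c') (e c + e c') (a c + a c') (by rw [map_add, he, he]; rfl)
          (by rw [map_add, ha, ha, smul_add]), map_add]
      map_smul' := fun r c => by
        obtain ⟨r, rfl⟩ := Ideal.Quotient.mk_surjective r
        rw [hconn (Ideal.Quotient.mk _ r • c) (r • e c) (r * a c)
          (by rw [map_smul, he]; rfl)
          (by rw [← smul_eq_mul, map_smul, ha, smul_comm]), map_mul]
        rfl }
  have hex : Function.Exact (torsionByMap x (Submodule.mkQ f.hom.range)) δ := by
    intro c
    constructor
    · intro hc
      have h1 : Ideal.Quotient.mk (Ideal.span {x}) (a c) = 0 := hc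
      rw [Ideal.Quotient.eq_zero_iff_mem, Ideal.mem_span_singleton'] at h1
      obtain ⟨b, hb⟩ := h1
      refine ⟨⟨e c - f.hom b, ?_⟩, Subtype.ext ?_⟩
      · rw [Submodule.mem_torsionBy_iff, smul_sub, ← map_smul, ← ha, ← hb, smul_eq_mul,
          mul_comm, sub_self]
      · change f.hom.range.mkQ (e c - f.hom b) = c
        rw [map_sub, he, sub_eq_self, Submodule.mkQ_apply, Submodule.Quotient.mk_eq_zero]
        exact ⟨b, rfl⟩
    · rintro ⟨c', rfl⟩
      have h0 := c'.2
      rw [Submodule.mem_torsionBy_iff] at h0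
      change Ideal.Quotient.mk (Ideal.span {x}) (a _) = 0
      rw [hconn _ (c' : I) 0 rfl (by rw [h0, map_zero]), map_zero]
  let T : ShortComplex (ModuleCat.{u} (A ⧸ Ideal.span {x})) :=
    ModuleCat.shortComplexOfCompEqZero _ _ hex.linearMap_comp_eq_zero
  have hT : T.ShortExact := by
    refine ModuleCat.shortComplex_shortExact T hex ?_ ?_
    · change Function.Injective (torsionByMap x (Submodule.mkQ f.hom.range))
      rw [injective_iff_map_eq_zero]
      intro c hc
      have h1 : Submodule.mkQ f.hom.range (c : I) = 0 := congrArg Subtype.val hc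
      rw [Submodule.mkQ_apply, Submodule.Quotient.mk_eq_zero] at h1
      obtain ⟨b, hb⟩ := h1
      have h0 := c.2
      rw [Submodule.mem_torsionBy_iff, ← hb, ← map_smul] at h0
      have := hx b (injf (by rw [← smul_eq_mul, h0, map_zero]))
      ext
      rw [← hb, this, map_zero]
      rfl
    · intro b
      obtain ⟨b, rfl⟩ := Ideal.Quotient.mk_surjective b
      obtain ⟨e', he'⟩ := Module.Injective.exists_smul_eq hx I (f.hom b)
      refine ⟨⟨Submodule.mkQ f.hom.range e', ?_⟩, ?_⟩
      · rw [Submodule.mem_torsionBy_iff, ← map_smul, he', Submodule.mkQ_apply,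
          Submodule.Quotient.mk_eq_zero]
        exact ⟨b, rfl⟩
      · change Ideal.Quotient.mk (Ideal.span {x}) (a _) = _
        exact hconn _ e' b rfl he'.symm
  have hTI : HasInjectiveDimensionLT T.X₁ (n + 1 + 1) := by
    have : Injective (ModuleCat.of (A ⧸ Ideal.span {x}) (Submodule.torsionBy A I x)) := by
      rw [← Module.injective_iff_injective_object]
      exact injective_torsionBy x I
    have h1 : HasInjectiveDimensionLT (ModuleCat.of (A ⧸ Ideal.span {x})
      (Submodule.torsionBy A I x)) 1 := inferInstance
    exact hasInjectiveDimensionLT_of_ge _ 1 (n + 1 + 1) (by omega)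
  exact hT.hasInjectiveDimensionLT_X₃ (n + 1) hQ' hTI

end ChangeOfRings

/-! ### Depth zero and finite self-injective dimension -/

section InjectiveDimensionZero

open CategoryTheory Abelian

variable {A : Type u} [CommRing A]

/-- Baer's criterion is the case `n = 0`: if `Ext¹(A/J, M)` vanishes, maps `J → M` extend to `A`.
Embedding `M` in an injective module shifts the degree. -/
theorem hasInjectiveDimensionLE_of_ext_quotient (n : ℕ) (M : ModuleCat.{u} A)
    (h : ∀ J : Ideal A, Subsingleton (Ext (ModuleCat.of A (A ⧸ J)) M (n + 1))) :
    HasInjectiveDimensionLE M n := by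
  induction n generalizing M with
  | zero =>
    simp only [HasInjectiveDimensionLE, zero_add, ← injective_iff_hasInjectiveDimensionLT_one]
    rw [← Module.injective_iff_injective_object]
    apply Module.Baer.injective
    intro J g
    have hS := LinearMap.shortExact_shortComplexKer (Submodule.mkQ_surjective J)
    let S := (Submodule.mkQ J).shortComplexKer
    let e : LinearMap.ker (Submodule.mkQ J) ≃ₗ[A] J := LinearEquiv.ofEq _ _ (Submodule.ker_mkQ J)
    have hJ : Subsingleton (Ext (ModuleCat.of A (A ⧸ J)) M 1) := h J
    obtain ⟨y, hy⟩ := Ext.contravariant_sequence_exact₁ hS M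
      (Ext.mk₀ (ModuleCat.ofHom (g ∘ₗ e.toLinearMap))) (add_zero 1) (Subsingleton.elim _ _)
    obtain ⟨k, rfl⟩ := Ext.homEquiv₀.symm.surjective y
    rw [Ext.homEquiv₀_symm_apply, Ext.mk₀_comp_mk₀] at hy
    have hy' := Ext.homEquiv₀.symm.injective hy
    refine ⟨k.hom, fun r hr => ?_⟩
    exact LinearMap.congr_fun (congrArg ModuleCat.Hom.hom hy') (e.symm ⟨r, hr⟩)
  | succ n ih =>
    obtain ⟨I, hI, f, hf⟩ := EnoughInjectives.presentation M
    have injf : Function.Injective f.hom := (ModuleCat.mono_iff_injective f).mp hf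
    let S : ShortComplex (ModuleCat.{u} A) :=
      ModuleCat.shortComplexOfCompEqZero _ _ f.hom.exact_map_mkQ_range.linearMap_comp_eq_zero
    have hS : S.ShortExact := ModuleCat.shortComplex_shortExact S
      f.hom.exact_map_mkQ_range injf (Submodule.mkQ_surjective _)
    have h3 : HasInjectiveDimensionLE S.X₃ n := by
      refine ih S.X₃ fun J => ⟨fun a b => ?_⟩
      rw [← sub_eq_zero]
      generalize a - b = c
      have hJ := h J
      obtain ⟨y, rfl⟩ := Ext.covariant_sequence_exact₃ _ hS c rfl (Subsingleton.elim _ _)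
      have : Injective S.X₂ := hI
      rw [Ext.eq_zero_of_injective y, Ext.zero_comp]
    exact (hS.hasInjectiveDimensionLT_X₃_iff n hI).1 h3

/-- A Noetherian local ring of depth zero and finite self-injective dimension is
self-injective. -/
theorem injective_self_of_hasInjectiveDimensionLE [IsLocalRing A] [IsNoetherianRing A]
    {b : A} (hb : b ≠ 0) (hmb : ∀ r ∈ maximalIdeal A, r * b = 0) {n : ℕ}
    (h : HasInjectiveDimensionLE (ModuleCat.of A A) n) : Module.Injective A A := by
  induction n with
  | zero =>
    simp only [HasInjectiveDimensionLE, zero_add, ← injective_iff_hasInjectiveDimensionLT_one] at h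
    rwa [← Module.injective_iff_injective_object] at h
  | succ n ih =>
    refine ih (hasInjectiveDimensionLE_of_ext_quotient n _ fun J => ?_)
    have hvan : ∀ N : ModuleCat.{u} A, Subsingleton (Ext N (ModuleCat.of A A) (n + 2)) :=
      fun N => HasInjectiveDimensionLT.subsingleton (ModuleCat.of A A) (n + 1 + 1) (n + 2) le_rfl N
    have hfree : Subsingleton (Ext (ModuleCat.of A A) (ModuleCat.of A A) (n + 1)) :=
      ⟨fun a b => by rw [Ext.eq_zero_of_projective a, Ext.eq_zero_of_projective b]⟩
    let motive : (N : Type u) → [AddCommGroup N] → [Module A N] → [Module.Finite A N] → Prop :=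
      fun N _ _ _ => Subsingleton (Ext (ModuleCat.of A N) (ModuleCat.of A A) (n + 1))
    have hiso : ∀ {N N' : ModuleCat.{u} A} (e : N ≅ N'),
        Subsingleton (Ext N' (ModuleCat.of A A) (n + 1)) →
        Subsingleton (Ext N (ModuleCat.of A A) (n + 1)) := by
      intro N N' e hN
      refine ⟨fun a b => ?_⟩
      have key : ∀ c : Ext N (ModuleCat.of A A) (n + 1), c = 0 := by
        intro c
        have h1 : (Ext.mk₀ e.inv).comp c (zero_add _) = 0 := Subsingleton.elim _ _
        have h2 : (Ext.mk₀ e.hom).comp ((Ext.mk₀ e.inv).comp c (zero_add _)) (zero_add _) = c := by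
          rw [← Ext.comp_assoc_of_second_deg_zero, Ext.mk₀_comp_mk₀]
          simp
        rw [← h2, h1, Ext.comp_zero]
      rw [key a, key b]
    -- Dévissage to `A ⧸ p`. For `p = 𝔪`, the embedding `A/𝔪 → A` given by `b` places
    -- `Ext^(n+1)(A/𝔪, A)` between `Ext^(n+1)(A, A) = 0` and an `Ext^(n+2)`, which vanishes by the
    -- dimension bound.
    refine IsNoetherianRing.induction_on_isQuotientEquivQuotientPrime (motive := motive) A
      (M := A ⧸ J) inferInstance ?_ ?_ ?_
    · intro N _ _ _ _
      exact ⟨fun a b => by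
        have h0 : 𝟙 (ModuleCat.of A N) = 0 := by
          ext y
          exact Subsingleton.elim (α := N) _ _
        have key : ∀ c : Ext (ModuleCat.of A N) (ModuleCat.of A A) (n + 1), c = 0 := by
          intro c
          rw [← Ext.mk₀_id_comp c, h0, Ext.mk₀_zero, Ext.zero_comp]
        rw [key a, key b]⟩
    · intro N _ _ _ p e
      refine hiso e.toModuleIso ?_
      by_cases hp : p.1 = maximalIdeal A
      · -- `A ⧸ 𝔪` embeds into `A` via `b`
        let g : (A ⧸ p.1) →ₗ[A] A := Submodule.liftQ p.1 (LinearMap.toSpanSingleton A A b)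
          (fun r hr => by
            rw [LinearMap.mem_ker, LinearMap.toSpanSingleton_apply, smul_eq_mul]
            exact hmb r (hp ▸ hr))
        have hg : Function.Injective g := by
          rw [← LinearMap.ker_eq_bot]
          apply Submodule.ker_liftQ_eq_bot'
          refine le_antisymm (fun r hr => ?_) (fun r hr => ?_)
          · rw [LinearMap.mem_ker, LinearMap.toSpanSingleton_apply, smul_eq_mul]
            exact hmb r (hp ▸ hr)
          · rw [LinearMap.mem_ker, LinearMap.toSpanSingleton_apply, smul_eq_mul] at hr
            rw [hp]
            intro hu
            exact hb ((IsUnit.mul_right_eq_zero hu).1 hr)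
        let S : ShortComplex (ModuleCat.{u} A) :=
          ModuleCat.shortComplexOfCompEqZero _ _ g.exact_map_mkQ_range.linearMap_comp_eq_zero
        have hS : S.ShortExact := ModuleCat.shortComplex_shortExact S
          g.exact_map_mkQ_range hg (Submodule.mkQ_surjective _)
        have key : ∀ c : Ext (ModuleCat.of A (A ⧸ p.1)) (ModuleCat.of A A) (n + 1), c = 0 := by
          intro c
          have := hvan S.X₃
          obtain ⟨y, rfl⟩ := Ext.contravariant_sequence_exact₁ hS (ModuleCat.of A A) c
            (n₁ := n + 2) (by omega) (Subsingleton.elim _ _)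
          have hy : y = 0 := hfree.elim _ _
          rw [hy, Ext.comp_zero]
        exact ⟨fun a b => by rw [key a, key b]⟩
      -- Multiplication by `x ∈ 𝔪 \ p` is injective on `A ⧸ p`, and `Ext^(n+2)` of its cokernel
      -- vanishes. So `x` acts surjectively on the finite module `Ext^(n+1)(A ⧸ p, A)`, and Nakayama
      -- applies.
      · have hlt : p.1 < maximalIdeal A := lt_of_le_of_ne (le_maximalIdeal p.2.ne_top) hp
        obtain ⟨x, hxm, hxp⟩ := SetLike.exists_of_lt hlt
        let P := ModuleCat.of A (A ⧸ p.1)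
        let g : (A ⧸ p.1) →ₗ[A] (A ⧸ p.1) := x • LinearMap.id
        have hg : Function.Injective g := by
          rw [injective_iff_map_eq_zero]
          intro a ha
          obtain ⟨a, rfl⟩ := Ideal.Quotient.mk_surjective a
          have h1 : Ideal.Quotient.mk p.1 (x * a) = 0 := ha
          rw [Ideal.Quotient.eq_zero_iff_mem] at h1 ⊢
          exact (p.2.mem_or_mem h1).resolve_left hxp
        let S : ShortComplex (ModuleCat.{u} A) :=
          ModuleCat.shortComplexOfCompEqZero _ _ g.exact_map_mkQ_range.linearMap_comp_eq_zero
        have hS : S.ShortExact := ModuleCat.shortComplex_shortExact S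
          g.exact_map_mkQ_range hg (Submodule.mkQ_surjective _)
        have hfin : Module.Finite A (Ext P (ModuleCat.of A A) (n + 1)) := inferInstance
        have htop : (⊤ : Submodule A (Ext P (ModuleCat.of A A) (n + 1))) ≤
            maximalIdeal A • ⊤ := by
          intro c _
          have := hvan S.X₃
          obtain ⟨y, rfl⟩ := Ext.contravariant_sequence_exact₁ hS (ModuleCat.of A A) c
            (n₁ := n + 2) (by omega) (Subsingleton.elim _ _)
          have hSf : S.f = x • 𝟙 P := rfl
          rw [hSf, Ext.mk₀_smul, Ext.smul_comp, Ext.mk₀_id_comp]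
          exact Submodule.smul_mem_smul hxm trivial
        have hbot := Submodule.eq_bot_of_le_smul_of_le_jacobson_bot (maximalIdeal A) _
          hfin.fg_top htop (IsLocalRing.maximalIdeal_le_jacobson _)
        exact (Submodule.subsingleton_iff A).1 (subsingleton_of_bot_eq_top hbot.symm)
    · intro N₁ _ _ _ N₂ _ _ _ N₃ _ _ _ f g hf hg hfg h1 h3
      let S : ShortComplex (ModuleCat.{u} A) :=
        ModuleCat.shortComplexOfCompEqZero f g hfg.linearMap_comp_eq_zero
      have hS : S.ShortExact := ModuleCat.shortComplex_shortExact S hfg hf hg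
      have key : ∀ c : Ext (ModuleCat.of A N₂) (ModuleCat.of A A) (n + 1), c = 0 := by
        intro c
        obtain ⟨y, rfl⟩ := Ext.contravariant_sequence_exact₂ hS (ModuleCat.of A A) c
          (h1.elim _ _)
        have hy : y = 0 := h3.elim _ _
        rw [hy, Ext.comp_zero]
      exact ⟨fun a b => by rw [key a, key b]⟩

end InjectiveDimensionZero

/-! ### Duality in self-injective local rings -/

section SelfInjective

variable {A : Type u} [CommRing A]

/-- The annihilators of the powers of `x` stabilize, so `x^(n+1) ↦ x^n` is well defined on the ideal
`(x^(n+1))`. Extending it to `A` gives `x^n = x^(n+1) c`, and `1 - xc` is a unit. -/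
theorem isNilpotent_of_injective_self [IsLocalRing A] [IsNoetherianRing A] [Module.Injective A A]
    {x : A} (hx : x ∈ maximalIdeal A) : IsNilpotent x := by
  obtain ⟨n, hn⟩ := monotone_stabilizes_iff_noetherian.2
    (inferInstance : IsNoetherian A A)
    ⟨fun k => LinearMap.ker (LinearMap.mulLeft A (x ^ k)), by
      refine monotone_nat_of_le_succ fun k a ha => ?_
      rw [LinearMap.mem_ker, LinearMap.mulLeft_apply] at ha ⊢
      rw [pow_succ', mul_assoc, ha, mul_zero]⟩
  have hker : ∀ a, x ^ (n + 1) * a = 0 → x ^ n * a = 0 := by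
    intro a ha
    have h1 : LinearMap.ker (LinearMap.mulLeft A (x ^ n)) =
      LinearMap.ker (LinearMap.mulLeft A (x ^ (n + 1))) := hn (n + 1) (by omega)
    have h2 : a ∈ LinearMap.ker (LinearMap.mulLeft A (x ^ (n + 1))) := ha
    rw [← h1] at h2
    exact h2
  obtain ⟨h, hh⟩ := Module.Injective.extension_property A A
    (A ⧸ LinearMap.ker (LinearMap.mulLeft A (x ^ (n + 1)))) A
    (Submodule.liftQ _ (LinearMap.mulLeft A (x ^ (n + 1))) le_rfl)
    (LinearMap.ker_eq_bot.1 (Submodule.ker_liftQ_eq_bot' _ _ rfl))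
    (Submodule.liftQ _ (LinearMap.mulLeft A (x ^ n)) (fun a ha => hker a ha))
  have h1 := LinearMap.congr_fun hh (Submodule.Quotient.mk 1)
  simp only [LinearMap.comp_apply, Submodule.liftQ_apply, LinearMap.mulLeft_apply, mul_one] at h1
  have h2 : h (x ^ (n + 1)) = x ^ (n + 1) * h 1 := by
    rw [← smul_eq_mul, ← map_smul, smul_eq_mul, mul_one]
  have h4 : x ^ (n + 1) * h 1 = x ^ n := by
    rw [← h2, h1]
    exact mul_one _
  have h3 : x ^ n * (1 - x * h 1) = 0 := by linear_combination -h4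
  have hu : IsUnit (1 - x * h 1) := by
    by_contra hcon
    have : (1 : A) ∈ maximalIdeal A := by
      have := add_mem ((mem_maximalIdeal _).2 hcon) ((maximalIdeal A).mul_mem_right (h 1) hx)
      rwa [sub_add_cancel] at this
    exact (maximalIdeal.isMaximal A).ne_top ((Ideal.eq_top_iff_one _).2 this)
  exact ⟨n, (IsUnit.mul_left_eq_zero hu).1 h3⟩

theorem exists_ne_zero_forall_mul_eq_zero [IsLocalRing A] [IsNoetherianRing A]
    (h : ∀ x ∈ maximalIdeal A, IsNilpotent x) :
    ∃ b : A, b ≠ 0 ∧ ∀ r ∈ maximalIdeal A, r * b = 0 := by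
  obtain ⟨k, hk⟩ := Ideal.exists_pow_le_of_le_radical_of_fg (I := maximalIdeal A) (J := ⊥)
    (fun x hx => by
      obtain ⟨n, hn⟩ := h x hx
      exact ⟨n, by simp [hn]⟩) (IsNoetherian.noetherian _)
  have hex : ∃ k, maximalIdeal A ^ k ≤ ⊥ := ⟨k, hk⟩
  classical
  obtain ⟨n, hn, hmin⟩ := (⟨Nat.find hex, Nat.find_spec hex, fun m hm => Nat.find_min hex hm⟩ :
    ∃ n, maximalIdeal A ^ n ≤ ⊥ ∧ ∀ m < n, ¬ maximalIdeal A ^ m ≤ ⊥)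
  cases n with
  | zero =>
    have h1 : (1 : A) ∈ (⊥ : Ideal A) := hn (by simp)
    exact absurd ((Submodule.mem_bot A).1 h1) one_ne_zero
  | succ n =>
    obtain ⟨b, hb, hb0⟩ := SetLike.not_le_iff_exists.1 (hmin n (by omega))
    refine ⟨b, by simpa using hb0, fun r hr => ?_⟩
    have := hn (by rw [pow_succ']; exact Ideal.mul_mem_mul hr hb)
    simpa using this

/-- The annihilator of the annihilator of an ideal `J` of a self-injective Noetherian local ring
is `J`. -/
theorem exists_forall_mul_eq_zero_and_mul_ne_zero [IsLocalRing A] [IsNoetherianRing A]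
    [Module.Injective A A] {J : Ideal A} {x : A} (hx : x ∉ J) :
    ∃ y, (∀ j ∈ J, j * y = 0) ∧ x * y ≠ 0 := by
  obtain ⟨b, hb, hmb⟩ := exists_ne_zero_forall_mul_eq_zero
    (fun (x : A) hx => isNilpotent_of_injective_self hx)
  -- Since `x ∉ J`, the annihilator of `x` modulo `J` lies in `𝔪` and kills the socle element `b`.
  -- Hence `x ↦ b` extends to a map `A ⧸ J → A`, and `y` is the image of `1`.
  let φ : A →ₗ[A] A ⧸ J := LinearMap.toSpanSingleton A (A ⧸ J) (Ideal.Quotient.mk J x)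
  have hφ : LinearMap.ker φ ≤ LinearMap.ker (LinearMap.toSpanSingleton A A b) := by
    intro r hr
    rw [LinearMap.mem_ker, LinearMap.toSpanSingleton_apply, smul_eq_mul]
    refine hmb r fun hu => hx ?_
    have h1 : Ideal.Quotient.mk J (r * x) = 0 := hr
    rw [Ideal.Quotient.eq_zero_iff_mem] at h1
    exact (Ideal.unit_mul_mem_iff_mem _ hu).1 h1
  obtain ⟨h, hh⟩ := Module.Injective.extension_property A A (A ⧸ LinearMap.ker φ) (A ⧸ J)
    (Submodule.liftQ _ φ le_rfl) (LinearMap.ker_eq_bot.1 (Submodule.ker_liftQ_eq_bot' _ _ rfl))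
    (Submodule.liftQ _ _ hφ)
  have hmk : ∀ a, h (Ideal.Quotient.mk J a) = a * h (Ideal.Quotient.mk J 1) := by
    intro a
    rw [← smul_eq_mul, ← map_smul]
    congr 1
    change _ = Ideal.Quotient.mk J (a * 1)
    rw [mul_one]
  refine ⟨h (Ideal.Quotient.mk J 1), fun j hj => ?_, ?_⟩
  · rw [← hmk, Ideal.Quotient.eq_zero_iff_mem.2 hj, map_zero]
  · rw [← hmk]
    have h1 := LinearMap.congr_fun hh (Submodule.Quotient.mk 1)
    simp only [LinearMap.comp_apply, Submodule.liftQ_apply, φ,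
      LinearMap.toSpanSingleton_apply, one_smul] at h1
    rw [h1]
    exact hb

end SelfInjective

/-! ### Transfer of these results to quotients `A ⧸ J` -/

section GorensteinModulo

open CategoryTheory

variable {A : Type u} [CommRing A]

/-- The ring `A ⧸ J` has self-injective dimension at most `n`. -/
def SelfInjectiveDimensionLE (J : Ideal A) (n : ℕ) : Prop :=
  HasInjectiveDimensionLE (ModuleCat.of (A ⧸ J) (A ⧸ J)) n

attribute [local instance] RingHomInvPair.of_ringEquiv in
theorem hasInjectiveDimensionLE_of_ringEquiv {B C : Type u} [CommRing B] [CommRing C]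
    (e : B ≃+* C) {n : ℕ} (h : HasInjectiveDimensionLE (ModuleCat.of B B) n) :
    HasInjectiveDimensionLE (ModuleCat.of C C) n := by
  let e' : B ≃ₛₗ[RingHomClass.toRingHom e] C :=
    { e.toAddEquiv with map_smul' := fun a b => map_mul e a b }
  exact (ModuleCat.hasInjectiveDimensionLE_iff_of_semiLinearEquiv e
    (M := ModuleCat.of B B) (N := ModuleCat.of C C) e' n).1 h

/-- The quotient of `A ⧸ J` by `x` is `A ⧸ (J, x)`. -/
noncomputable def quotientSupSpanSingletonEquiv (J : Ideal A) (x : A) :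
    ((A ⧸ J) ⧸ Ideal.span {Ideal.Quotient.mk J x}) ≃+* A ⧸ (J ⊔ Ideal.span {x}) :=
  (Ideal.quotEquivOfEq (by rw [Ideal.map_span, Set.image_singleton])).trans
    (DoubleQuot.quotQuotEquivQuotSup J (Ideal.span {x}))

theorem SelfInjectiveDimensionLE.sup_span_singleton {J : Ideal A} {n : ℕ} {x : A}
    (h : SelfInjectiveDimensionLE J (n + 1)) (hx : ∀ u, x * u ∈ J → u ∈ J) :
    SelfInjectiveDimensionLE (J ⊔ Ideal.span {x}) n := by
  refine hasInjectiveDimensionLE_of_ringEquiv (quotientSupSpanSingletonEquiv J x)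
    (hasInjectiveDimensionLE_quotient_span_singleton (fun a ha => ?_) n h)
  obtain ⟨a, rfl⟩ := Ideal.Quotient.mk_surjective a
  rw [← map_mul, Ideal.Quotient.eq_zero_iff_mem] at ha
  exact Ideal.Quotient.eq_zero_iff_mem.2 (hx a ha)

variable [IsLocalRing A]

theorem isLocalRing_quotient_of_le {J : Ideal A} (hJ : J ≤ maximalIdeal A) :
    IsLocalRing (A ⧸ J) := by
  have : Nontrivial (A ⧸ J) := Ideal.Quotient.nontrivial_iff.mpr fun h =>
    (maximalIdeal.isMaximal A).ne_top (top_le_iff.1 (h ▸ hJ))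
  exact IsLocalRing.of_surjective' (Ideal.Quotient.mk J) Ideal.Quotient.mk_surjective

theorem mk_mem_maximalIdeal_iff {J : Ideal A} (hJ : J ≤ maximalIdeal A)
    [IsLocalRing (A ⧸ J)] {r : A} :
    Ideal.Quotient.mk J r ∈ maximalIdeal (A ⧸ J) ↔ r ∈ maximalIdeal A := by
  constructor
  · intro h hu
    exact h (hu.map _)
  · intro h hu
    obtain ⟨s, hs⟩ := hu.exists_right_inv
    obtain ⟨s, rfl⟩ := Ideal.Quotient.mk_surjective s
    rw [← map_mul, ← map_one (Ideal.Quotient.mk J), Ideal.Quotient.eq] at hs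
    have h1 : (1 : A) ∈ maximalIdeal A := by
      have := sub_mem ((maximalIdeal A).mul_mem_right s h) (hJ hs)
      rwa [sub_sub_cancel] at this
    exact (maximalIdeal.isMaximal A).ne_top ((Ideal.eq_top_iff_one _).2 h1)

variable [IsNoetherianRing A]

theorem SelfInjectiveDimensionLE.injective {J : Ideal A} {n : ℕ}
    (h : SelfInjectiveDimensionLE J n) (hJ : J ≤ maximalIdeal A) {b : A} (hb : b ∉ J)
    (hmb : ∀ r ∈ maximalIdeal A, r * b ∈ J) : Module.Injective (A ⧸ J) (A ⧸ J) := by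
  have := isLocalRing_quotient_of_le hJ
  refine injective_self_of_hasInjectiveDimensionLE (b := Ideal.Quotient.mk J b)
    (by rwa [Ne, Ideal.Quotient.eq_zero_iff_mem]) (fun r hr => ?_) h
  obtain ⟨r, rfl⟩ := Ideal.Quotient.mk_surjective r
  rw [mk_mem_maximalIdeal_iff hJ] at hr
  rw [← map_mul, Ideal.Quotient.eq_zero_iff_mem]
  exact hmb r hr

theorem maximalIdeal_le_radical_of_injective {J : Ideal A} (hJ : J ≤ maximalIdeal A)
    [Module.Injective (A ⧸ J) (A ⧸ J)] : maximalIdeal A ≤ J.radical := by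
  have := isLocalRing_quotient_of_le hJ
  intro x hx
  obtain ⟨n, hn⟩ := isNilpotent_of_injective_self ((mk_mem_maximalIdeal_iff hJ).2 hx)
  refine ⟨n, ?_⟩
  rwa [← map_pow, Ideal.Quotient.eq_zero_iff_mem] at hn

theorem exists_mul_notMem_of_injective {J : Ideal A} (hJ : J ≤ maximalIdeal A)
    [Module.Injective (A ⧸ J) (A ⧸ J)] {K : Ideal A} (hJK : J ≤ K) {x : A} (hx : x ∉ K) :
    ∃ y, (∀ k ∈ K, k * y ∈ J) ∧ x * y ∉ J := by
  have := isLocalRing_quotient_of_le hJ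
  obtain ⟨y, hy, hxy⟩ := exists_forall_mul_eq_zero_and_mul_ne_zero
    (J := K.map (Ideal.Quotient.mk J)) (x := Ideal.Quotient.mk J x) (by
      rwa [Ideal.mem_quotient_iff_mem hJK])
  obtain ⟨y, rfl⟩ := Ideal.Quotient.mk_surjective y
  refine ⟨y, fun k hk => ?_, ?_⟩
  · rw [← Ideal.Quotient.eq_zero_iff_mem, map_mul]
    exact hy _ (Ideal.mem_map_of_mem _ hk)
  · rwa [← Ideal.Quotient.eq_zero_iff_mem, map_mul]

omit [IsLocalRing A] in
theorem exists_isAssociated_ge (J : Ideal A) {b : A} (hb : b ∉ J) :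
    ∃ (P : Ideal A) (c : A), P.IsPrime ∧ (∀ r, r ∈ P ↔ r * c ∈ J) ∧ ∀ r, r * b ∈ J → r ∈ P := by
  obtain ⟨P, hP, hle⟩ := exists_le_isAssociatedPrime_of_isNoetherianRing A
    (Ideal.Quotient.mk J b) (by rwa [Ne, Ideal.Quotient.eq_zero_iff_mem])
  rw [isAssociatedPrime_iff] at hP
  obtain ⟨hP, c, hc⟩ := hP
  obtain ⟨c, rfl⟩ := Ideal.Quotient.mk_surjective c
  have key : ∀ r c : A, r ∈ (⊥ : Submodule A (A ⧸ J)).colon {Ideal.Quotient.mk J c} ↔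
      r * c ∈ J := by
    intro r c
    rw [Submodule.mem_colon_singleton, Submodule.mem_bot, ← Ideal.Quotient.eq_zero_iff_mem]
    rfl
  exact ⟨P, c, hP, fun r => by rw [hc, key], fun r hr => hle ((key r b).2 hr)⟩

-- Prime avoidance: the zerodivisors on `A ⧸ J` are the union of its finitely many associated
-- primes.
omit [IsLocalRing A] in
theorem exists_regular_mem_or_le_isAssociated (p J : Ideal A) :
    (∃ x ∈ p, ∀ u, x * u ∈ J → u ∈ J) ∨
      ∃ (P : Ideal A) (c : A), P.IsPrime ∧ (∀ r, r ∈ P ↔ r * c ∈ J) ∧ p ≤ P := by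
  by_cases h : (p : Set A) ⊆ ⋃ P ∈ associatedPrimes A (A ⧸ J), (P : Set A)
  · right
    rw [Ideal.subset_union_prime_finite (associatedPrimes.finite A (A ⧸ J)) ⊥ ⊥
      (fun P hP _ _ => hP.isPrime)] at h
    obtain ⟨P, hP, hle⟩ := h
    rw [AssociatedPrimes.mem_iff, isAssociatedPrime_iff] at hP
    obtain ⟨hP, c, hc⟩ := hP
    obtain ⟨c, rfl⟩ := Ideal.Quotient.mk_surjective c
    refine ⟨P, c, hP, fun r => ?_, hle⟩
    rw [hc, Submodule.mem_colon_singleton, Submodule.mem_bot, ← Ideal.Quotient.eq_zero_iff_mem]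
    rfl
  · left
    obtain ⟨x, hx, hx'⟩ := Set.not_subset.1 h
    refine ⟨x, hx, fun u hu => by_contra fun hu' => hx' ?_⟩
    rw [biUnion_associatedPrimes_eq_zero_divisors]
    refine ⟨Ideal.Quotient.mk J u, by rwa [Ne, Ideal.Quotient.eq_zero_iff_mem], ?_⟩
    change Ideal.Quotient.mk J (x * u) = 0
    rwa [Ideal.Quotient.eq_zero_iff_mem]

end GorensteinModulo

/-! ### Gorenstein rings are Cohen–Macaulay; systems of parameters -/

section ParameterSequences

variable {A : Type u} [CommRing A]

theorem ringKrullDim_quotient_mono {J K : Ideal A} (h : J ≤ K) :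
    ringKrullDim (A ⧸ K) ≤ ringKrullDim (A ⧸ J) :=
  ringKrullDim_le_of_surjective (Ideal.Quotient.factor h) (Ideal.Quotient.factor_surjective h)

theorem ringKrullDim_quotient_succ_le {P K : Ideal A} [P.IsPrime] (h : P ≤ K) {x : A}
    (hx : x ∈ K) (hxP : x ∉ P) : ringKrullDim (A ⧸ K) + 1 ≤ ringKrullDim (A ⧸ P) := by
  refine ringKrullDim_succ_le_of_surjective (Ideal.Quotient.factor h)
    (Ideal.Quotient.factor_surjective h) (r := Ideal.Quotient.mk P x) ?_ ?_
  · rw [mem_nonZeroDivisors_iff_ne_zero, Ne, Ideal.Quotient.eq_zero_iff_mem]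
    exact hxP
  · rw [Ideal.Quotient.factor_mk, Ideal.Quotient.eq_zero_iff_mem]
    exact hx

variable [IsLocalRing A]

theorem ringKrullDim_quotient_nonpos {J : Ideal A} (h : maximalIdeal A ≤ J.radical) :
    ringKrullDim (A ⧸ J) ≤ 0 := by
  suffices h : Ring.KrullDimLE 0 (A ⧸ J) from Ring.krullDimLE_iff.1 h
  rw [Ring.krullDimLE_zero_iff]
  intro P hP
  have h1 : maximalIdeal A ≤ P.comap (Ideal.Quotient.mk J) := by
    refine h.trans ?_
    rw [Ideal.IsPrime.radical_le_iff inferInstance]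
    intro j hj
    rw [Ideal.mem_comap, Ideal.Quotient.eq_zero_iff_mem.2 hj]
    exact P.zero_mem
  have h2 := (maximalIdeal.isMaximal A).eq_of_le (Ideal.IsPrime.ne_top inferInstance) h1
  have h3 : (P.comap (Ideal.Quotient.mk J)).IsMaximal := h2 ▸ maximalIdeal.isMaximal A
  have := Ideal.map_eq_top_or_isMaximal_of_surjective
    (Ideal.Quotient.mk J) Ideal.Quotient.mk_surjective h3
  rw [Ideal.map_comap_of_surjective _ Ideal.Quotient.mk_surjective] at this
  exact this.resolve_left hP.ne_top

variable [IsNoetherianRing A]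

theorem ringKrullDim_quotient_le_sup_span_singleton (J : Ideal A) {x : A}
    (hx : x ∈ maximalIdeal A) :
    ringKrullDim (A ⧸ J) ≤ ringKrullDim (A ⧸ (J ⊔ Ideal.span {x})) + 1 := by
  have h := ringKrullDim_le_ringKrullDim_quotient_add_encard {Ideal.Quotient.mk J x} (by
    rw [Set.singleton_subset_iff, SetLike.mem_coe, ← Ideal.jacobson_bot, Ideal.mem_jacobson_bot]
    intro y
    obtain ⟨y, rfl⟩ := Ideal.Quotient.mk_surjective y
    rw [← map_mul, ← map_one (Ideal.Quotient.mk J), ← map_add]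
    refine IsUnit.map _ ?_
    by_contra hcon
    have h1 : (1 : A) ∈ maximalIdeal A := by
      have := sub_mem ((mem_maximalIdeal _).2 hcon) ((maximalIdeal A).mul_mem_right y hx)
      rwa [add_sub_cancel_left] at this
    exact (maximalIdeal.isMaximal A).ne_top ((Ideal.eq_top_iff_one _).2 h1))
  rw [ringKrullDim_eq_of_ringEquiv (quotientSupSpanSingletonEquiv J x), Set.encard_singleton] at h
  exact h

theorem ringKrullDim_quotient_le_sup_ofList (J : Ideal A) {xs : List A}
    (hxs : ∀ x ∈ xs, x ∈ maximalIdeal A) :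
    ringKrullDim (A ⧸ J) ≤ ringKrullDim (A ⧸ (J ⊔ Ideal.ofList xs)) + xs.length := by
  induction xs generalizing J with
  | nil =>
    rw [Ideal.ofList_nil, sup_bot_eq]
    simp
  | cons x xs ih =>
    refine (ringKrullDim_quotient_le_sup_span_singleton J (hxs x (by simp))).trans ?_
    rw [Ideal.sup_ofList_cons, List.length_cons, Nat.cast_add, Nat.cast_one, ← add_assoc]
    exact add_le_add_left (ih _ fun y hy => hxs y (by simp [hy])) 1

/-- The length of a regular sequence on `A ⧸ J` is bounded by the dimension of `A ⧸ P` for each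
associated prime `P`. -/
theorem length_le_ringKrullDim_quotient {J : Ideal A} {rs : List A}
    (hrs : ∀ x ∈ rs, x ∈ maximalIdeal A) (hreg : RegularMod J rs) {P : Ideal A} (hP : P.IsPrime)
    {c : A} (hc : ∀ r, r ∈ P ↔ r * c ∈ J) : (rs.length : WithBot ℕ∞) ≤ ringKrullDim (A ⧸ P) := by
  induction rs generalizing J P c with
  | nil =>
    have : Nontrivial (A ⧸ P) := Ideal.Quotient.nontrivial_iff.2 hP.ne_top
    simpa using ringKrullDim_nonneg_of_nontrivial
  | cons x rs ih =>
    have hcJ : c ∉ J := fun h => hP.ne_top ((Ideal.eq_top_iff_one _).2 ((hc 1).2 (by simpa)))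
    have hJP : J ≤ P := fun j hj => (hc j).2 (J.mul_mem_right _ hj)
    -- the ideal `J : P`
    let N : Ideal A := J.colon (P : Set A)
    have hN : ∀ b, b ∈ N ↔ ∀ r ∈ P, r * b ∈ J := fun b => by
      simp only [N, Submodule.mem_colon, smul_eq_mul, SetLike.mem_coe]
      exact forall₂_congr fun r _ => by rw [mul_comm]
    -- Otherwise regularity of `x` gives `J : P ⊆ J + x(J : P)`, so `J : P = J` by Nakayama, against
    -- `c`. An associated prime of `J + (x)` above the annihilator of `b` then contains both `P` and
    -- `x`, while `x ∉ P`.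
    have hex : ∃ b ∈ N, b ∉ J ⊔ Ideal.span {x} := by
      by_contra hcon
      push Not at hcon
      have hle : N ≤ J ⊔ maximalIdeal A • N := by
        intro b hb
        obtain ⟨j, hj, w, rfl⟩ := Ideal.mem_sup_span_singleton_iff.1 (hcon b hb)
        refine add_mem (Ideal.mem_sup_left hj) (Ideal.mem_sup_right ?_)
        refine Submodule.smul_mem_smul (hrs x (by simp)) ((hN w).2 fun r hr => hreg.1 _ ?_)
        have h1 := (hN _).1 hb r hr
        have h2 := sub_mem h1 (J.mul_mem_left r hj)
        convert! h2 using 1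
        ring
      have h1 := Submodule.le_of_le_smul_of_le_jacobson_bot (IsNoetherian.noetherian N)
        (maximalIdeal_le_jacobson _) hle
      exact hcJ (h1 ((hN c).2 fun r hr => (hc r).1 hr))
    obtain ⟨b, hbN, hbJ⟩ := hex
    obtain ⟨P', c', hP', hc', hle⟩ := exists_isAssociated_ge _ hbJ
    have hPP' : P ≤ P' := fun r hr => hle r (Ideal.mem_sup_left ((hN b).1 hbN r hr))
    have hxP' : x ∈ P' := hle x (Ideal.mul_mem_sup_span_singleton J x b)
    have hxP : x ∉ P := fun h => hcJ (hreg.1 _ ((hc x).1 h))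
    rw [List.length_cons, Nat.cast_add, Nat.cast_one]
    exact (add_le_add_left (ih (fun y hy => hrs y (by simp [hy])) hreg.2 hP' hc') 1).trans
      (ringKrullDim_quotient_succ_le hPP' hxP' hxP)

/-- Each regular element of `𝔪` lowers the injective dimension. When there is none left, the depth
is zero, the quotient is self-injective, and its maximal ideal is nilpotent; so the sequence found
is as long as the dimension. -/
theorem SelfInjectiveDimensionLE.exists_regularMod {J : Ideal A} (hJ : J ≤ maximalIdeal A) {n : ℕ}
    (h : SelfInjectiveDimensionLE J n) :
    ∃ rs : List A, (∀ x ∈ rs, x ∈ maximalIdeal A) ∧ RegularMod J rs ∧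
      ringKrullDim (A ⧸ J) ≤ rs.length := by
  have hinj : Module.Injective (A ⧸ J) (A ⧸ J) → ∃ rs : List A,
      (∀ x ∈ rs, x ∈ maximalIdeal A) ∧ RegularMod J rs ∧ ringKrullDim (A ⧸ J) ≤ rs.length :=
    fun h0 => ⟨[], by simp, trivial,
      by simpa using ringKrullDim_quotient_nonpos (maximalIdeal_le_radical_of_injective hJ)⟩
  induction n generalizing J with
  | zero =>
    refine hinj ?_
    simp only [SelfInjectiveDimensionLE, CategoryTheory.HasInjectiveDimensionLE, zero_add,
      ← CategoryTheory.injective_iff_hasInjectiveDimensionLT_one] at h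
    rwa [← Module.injective_iff_injective_object] at h
  | succ n ih =>
    rcases exists_regular_mem_or_le_isAssociated (maximalIdeal A) J with
      ⟨x, hx, hreg⟩ | ⟨P, c, hP, hc, hle⟩
    · have hJ' : J ⊔ Ideal.span {x} ≤ maximalIdeal A :=
        sup_le hJ ((Ideal.span_singleton_le_iff_mem _).2 hx)
      obtain ⟨rs, h1, h2, h3⟩ := ih hJ' (h.sup_span_singleton hreg) (fun h0 => ⟨[], by simp, trivial,
        by simpa using ringKrullDim_quotient_nonpos (maximalIdeal_le_radical_of_injective hJ')⟩)
      refine ⟨x :: rs, ?_, ⟨hreg, h2⟩, ?_⟩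
      · intro y hy
        rcases List.mem_cons.1 hy with rfl | hy
        · exact hx
        · exact h1 y hy
      · refine (ringKrullDim_quotient_le_sup_span_singleton J hx).trans ?_
        rw [List.length_cons, Nat.cast_add, Nat.cast_one]
        exact add_le_add_left h3 1
    · refine hinj (h.injective hJ (b := c) (fun hcJ => hP.ne_top ?_)
        fun r hr => (hc r).1 (hle hr))
      exact (Ideal.eq_top_iff_one _).2 ((hc 1).2 (by simpa))

/-- Unmixedness. The natural number `l` between the two dimensions allows cancellation in `WithBot
ℕ∞`. -/
theorem SelfInjectiveDimensionLE.ringKrullDim_le_of_isAssociated {J : Ideal A}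
    (hJ : J ≤ maximalIdeal A) {n : ℕ} (h : SelfInjectiveDimensionLE J n) {P : Ideal A}
    (hP : P.IsPrime) {c : A} (hc : ∀ r, r ∈ P ↔ r * c ∈ J) :
    ∃ l : ℕ, ringKrullDim (A ⧸ J) ≤ l ∧ l ≤ ringKrullDim (A ⧸ P) := by
  obtain ⟨rs, h1, h2, h3⟩ := h.exists_regularMod hJ
  exact ⟨rs.length, h3, length_le_ringKrullDim_quotient h1 h2 hP hc⟩

/-- A system of parameters of a Gorenstein local ring `A ⧸ J` is a regular sequence, and the
quotient by it is again Gorenstein. -/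
theorem SelfInjectiveDimensionLE.regularMod_of_parameters {J : Ideal A} (hJ : J ≤ maximalIdeal A)
    {n : ℕ} (h : SelfInjectiveDimensionLE J n) {qs : List A}
    (hqs : ∀ x ∈ qs, x ∈ maximalIdeal A) (hdim : (qs.length : WithBot ℕ∞) ≤ ringKrullDim (A ⧸ J))
    (hrad : maximalIdeal A ≤ (J ⊔ Ideal.ofList qs).radical) :
    RegularMod J qs ∧ ∃ n, SelfInjectiveDimensionLE (J ⊔ Ideal.ofList qs) n := by
  induction qs generalizing J n with
  | nil => exact ⟨trivial, n, by simpa using h⟩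
  | cons q qs ih =>
    have hq : q ∈ maximalIdeal A := hqs q (by simp)
    have hqs' : ∀ x ∈ qs, x ∈ maximalIdeal A := fun y hy => hqs y (by simp [hy])
    rw [List.length_cons, Nat.cast_add, Nat.cast_one] at hdim
    -- A zerodivisor `q` lies in an associated prime `P`. Then the members of `qs` alone cut `A ⧸ P`
    -- down to dimension zero, so `dim A/P < dim A/J`, against unmixedness.
    have hreg : ∀ u, q * u ∈ J → u ∈ J := by
      intro u hu
      by_contra huJ
      obtain ⟨P, c, hP, hc, hle⟩ := exists_isAssociated_ge J huJ
      obtain ⟨l, hl1, hl2⟩ := h.ringKrullDim_le_of_isAssociated hJ hP hc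
      have h1 := ringKrullDim_quotient_le_sup_ofList P hqs'
      have h2 : ringKrullDim (A ⧸ (P ⊔ Ideal.ofList qs)) ≤ 0 := by
        refine ringKrullDim_quotient_nonpos (hrad.trans (Ideal.radical_mono ?_))
        rw [Ideal.sup_ofList_cons]
        refine sup_le_sup_right (sup_le (fun j hj => (hc j).2 (J.mul_mem_right _ hj)) ?_) _
        rw [Ideal.span_singleton_le_iff_mem]
        exact hle q hu
      have h3 : (l : WithBot ℕ∞) ≤ qs.length := by
        refine hl2.trans (h1.trans ?_)
        simpa using add_le_add_left h2 (qs.length : WithBot ℕ∞)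
      have h4 : ((qs.length + 1 : ℕ) : WithBot ℕ∞) ≤ (qs.length : ℕ) := by
        push_cast
        exact hdim.trans (hl1.trans h3)
      have h5 : qs.length + 1 ≤ qs.length := by exact_mod_cast h4
      omega
    have hdim' : (qs.length : WithBot ℕ∞) ≤ ringKrullDim (A ⧸ (J ⊔ Ideal.span {q})) := by
      have h1 := hdim.trans (ringKrullDim_quotient_le_sup_span_singleton J hq)
      exact ENat.WithBot.add_le_add_one_right_iff.1 h1
    have h' : SelfInjectiveDimensionLE J (n + 1) := by
      have : CategoryTheory.HasInjectiveDimensionLT (ModuleCat.of (A ⧸ J) (A ⧸ J)) (n + 1) := h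
      exact CategoryTheory.hasInjectiveDimensionLT_of_ge _ (n + 1) (n + 2) (by omega)
    have := ih (sup_le hJ ((Ideal.span_singleton_le_iff_mem _).2 hq))
      (h'.sup_span_singleton hreg) hqs' hdim' (by rwa [Ideal.sup_ofList_cons] at hrad)
    rw [Ideal.sup_ofList_cons]
    exact ⟨⟨hreg, this.1⟩, this.2⟩

/-- Every prime ideal `p` of a Gorenstein local ring is minimal over the ideal generated by a
regular sequence contained in `p`. -/
theorem SelfInjectiveDimensionLE.exists_regularMod_minimalPrimes {J : Ideal A} {n : ℕ}
    (h : SelfInjectiveDimensionLE J n) {p : Ideal A} (hp : p.IsPrime) (hJ : J ≤ p) :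
    ∃ xs : List A, (∀ x ∈ xs, x ∈ p) ∧ RegularMod J xs ∧
      p ∈ (J ⊔ Ideal.ofList xs).minimalPrimes := by
  induction n generalizing J with
  | zero =>
    refine ⟨[], by simp, trivial, ?_⟩
    simp only [SelfInjectiveDimensionLE, CategoryTheory.HasInjectiveDimensionLE, zero_add,
      ← CategoryTheory.injective_iff_hasInjectiveDimensionLT_one] at h
    rw [← Module.injective_iff_injective_object] at h
    have h1 := maximalIdeal_le_radical_of_injective (hJ.trans (le_maximalIdeal hp.ne_top))
    rw [Ideal.ofList_nil, sup_bot_eq]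
    refine ⟨⟨hp, hJ⟩, fun P hP _ => ?_⟩
    exact (le_maximalIdeal hp.ne_top).trans (h1.trans (hP.1.radical_le_iff.2 hP.2))
  | succ n ih =>
    rcases exists_regular_mem_or_le_isAssociated p J with ⟨x, hx, hreg⟩ | ⟨P, c, hP, hc, hle⟩
    · obtain ⟨xs, h1, h2, h3⟩ := ih (h.sup_span_singleton hreg)
        (sup_le hJ ((Ideal.span_singleton_le_iff_mem _).2 hx))
      refine ⟨x :: xs, ?_, ⟨hreg, h2⟩, by rwa [Ideal.sup_ofList_cons]⟩
      intro y hy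
      rcases List.mem_cons.1 hy with rfl | hy
      · exact hx
      · exact h1 y hy
    -- If `p` lies in an associated prime `P`, it is already minimal over `J`: a smaller prime `P' ⊇
    -- J` would give `dim A/P' > dim A/P ≥ dim A/J`.
    · refine ⟨[], by simp, trivial, ?_⟩
      rw [Ideal.ofList_nil, sup_bot_eq]
      refine ⟨⟨hp, hJ⟩, fun P' hP' hP'p => ?_⟩
      obtain ⟨l, hl1, hl2⟩ := h.ringKrullDim_le_of_isAssociated
        (hJ.trans (le_maximalIdeal hp.ne_top)) hP hc
      by_contra hcon
      obtain ⟨x, hx, hxP'⟩ := SetLike.not_le_iff_exists.1 hcon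
      have hP'1 := hP'.1
      have h1 := ringKrullDim_quotient_succ_le (hP'p.trans hle) (hle hx) hxP'
      have h2 : ((l + 1 : ℕ) : WithBot ℕ∞) ≤ (l : ℕ) := by
        push_cast
        exact (add_le_add_left hl2 1).trans
          (h1.trans ((ringKrullDim_quotient_mono hP'.2).trans hl1))
      have h5 : l + 1 ≤ l := by exact_mod_cast h2
      omega

end ParameterSequences

/-! ### Valabrega–Valla conditions and quasi-regularity -/

section FiltrationIntersection

variable {A : Type*} [CommRing A] {q : ℕ → A} {d : ℕ}

theorem mem_initialSpan_succ_mul {i : ℕ} {L : Ideal A} {x : A} :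
    x ∈ initialSpan q (i + 1) * L ↔ ∃ y ∈ initialSpan q i * L, ∃ w ∈ L, x = y + q i * w := by
  rw [initialSpan_succ, Ideal.sup_mul, Submodule.mem_sup]
  constructor
  · rintro ⟨y, hy, z, hz, rfl⟩
    obtain ⟨w, hw, rfl⟩ := Ideal.mem_span_singleton_mul.1 hz
    exact ⟨y, hy, w, hw, rfl⟩
  · rintro ⟨y, hy, w, hw, rfl⟩
    exact ⟨y, hy, _, Ideal.mem_span_singleton_mul.2 ⟨w, hw, rfl⟩, rfl⟩

/-- The Valabrega-Valla condition for a filtration passes to initial segments of a regular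
sequence. -/
theorem initialSpan_inf_le (hreg : ∀ i < d, ∀ u, q i * u ∈ initialSpan q i → u ∈ initialSpan q i)
    {L : ℕ → Ideal A} (hL0 : initialSpan q d ≤ L 0) (hL : ∀ j < d, ∀ n, ∀ x ∈ L n, q j * x ∈ L (n + 1))
    (hVV : ∀ n, initialSpan q d ⊓ L (n + 1) ≤ initialSpan q d * L n) {i : ℕ} (hi : i ≤ d) (n : ℕ) :
    initialSpan q i ⊓ L (n + 1) ≤ initialSpan q i * L n := by
  -- The case `i + 1` gives `x = y + q i * w`, and regularity puts `w` in `initialSpan q i`. The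
  -- inner induction on `n` then applies to `w`, and `q i` raises the filtration by one.
  induction hi using Nat.decreasingInduction generalizing n with
  | self => exact hVV n
  | of_succ i hi ih =>
    induction n with
    | zero =>
      intro x hx
      obtain ⟨hx1, hx2⟩ := Ideal.mem_inf.1 hx
      obtain ⟨y, hy, w, hw, rfl⟩ := mem_initialSpan_succ_mul.1
        (ih 0 (Ideal.mem_inf.2 ⟨initialSpan_mono q i.le_succ hx1, hx2⟩))
      have hy' : y ∈ initialSpan q i := Ideal.mul_le_left hy
      have h1 : w ∈ initialSpan q i := hreg i hi w ((Ideal.add_mem_iff_right _ hy').1 hx1)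
      refine add_mem hy ?_
      rw [mul_comm (q i)]
      exact Ideal.mul_mem_mul h1 (hL0 (mem_initialSpan q hi))
    | succ n ihn =>
      intro x hx
      obtain ⟨hx1, hx2⟩ := Ideal.mem_inf.1 hx
      obtain ⟨y, hy, w, hw, rfl⟩ := mem_initialSpan_succ_mul.1
        (ih (n + 1) (Ideal.mem_inf.2 ⟨initialSpan_mono q i.le_succ hx1, hx2⟩))
      have hy' : y ∈ initialSpan q i := Ideal.mul_le_left hy
      have h1 : w ∈ initialSpan q i := hreg i hi w ((Ideal.add_mem_iff_right _ hy').1 hx1)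
      refine add_mem hy ?_
      have h2 := ihn (Ideal.mem_inf.2 ⟨h1, hw⟩)
      have h3 : q i * w ∈ Ideal.span {q i} * (initialSpan q i * L n) :=
        Ideal.mem_span_singleton_mul.2 ⟨w, h2, rfl⟩
      rw [mul_left_comm] at h3
      refine Ideal.mul_mono_right ?_ h3
      intro z hz
      obtain ⟨w, hw, rfl⟩ := Ideal.mem_span_singleton_mul.1 hz
      exact hL i hi n w hw

/-- In degree `n`, this is the regularity of `q i t` on `R(I)` modulo `𝔞` and the earlier `q j t`.
For `n = 0` the truncated exponent adds `initialSpan q i`, which is harmless as it lies in `𝔞`. -/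
theorem mem_of_mul_mem_sup {I 𝔞 : Ideal A}
    (hreg : ∀ i < d, ∀ u, q i * u ∈ initialSpan q i → u ∈ initialSpan q i)
    (hQI : initialSpan q d ≤ I) (hQ𝔞 : initialSpan q d ≤ 𝔞)
    (hI : ∀ n, initialSpan q d ⊓ I ^ (n + 1) ≤ initialSpan q d * I ^ n)
    (h𝔞 : ∀ n, initialSpan q d ⊓ 𝔞 * I ^ (n + 1) ≤ initialSpan q d * (𝔞 * I ^ n))
    {i n : ℕ} (hi : i < d) {x : A} (hx : x ∈ I ^ n)
    (h : q i * x ∈ 𝔞 * I ^ (n + 1) ⊔ initialSpan q i * I ^ n) :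
    x ∈ 𝔞 * I ^ n ⊔ initialSpan q i * I ^ (n - 1) := by
  obtain ⟨a, ha, y, hy, hay⟩ := Submodule.mem_sup.1 h
  have hq : ∀ j < d, q j ∈ I := fun j hj => hQI (mem_initialSpan q hj)
  have hy' : y ∈ initialSpan q i := Ideal.mul_le_left hy
  have h1 : a ∈ initialSpan q (i + 1) := by
    have : a = q i * x - y := by rw [← hay]; ring
    rw [this]
    exact sub_mem (Ideal.mul_mem_right _ _ (mem_initialSpan q i.lt_succ_self))
      (initialSpan_mono q i.le_succ hy')
  have hL : ∀ j < d, ∀ n, ∀ x ∈ 𝔞 * I ^ n, q j * x ∈ 𝔞 * I ^ (n + 1) := fun j hj n x hx => by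
    rw [pow_succ', mul_left_comm 𝔞 I]
    exact Ideal.mul_mem_mul (hq j hj) hx
  have h2 : a ∈ initialSpan q (i + 1) * (𝔞 * I ^ n) :=
    initialSpan_inf_le hreg (L := fun n => 𝔞 * I ^ n) (by simpa using hQ𝔞) hL h𝔞
      (Nat.succ_le_of_lt hi) n (Ideal.mem_inf.2 ⟨h1, ha⟩)
  obtain ⟨z, hz, w, hw, rfl⟩ := mem_initialSpan_succ_mul.1 h2
  have h3 : x - w ∈ initialSpan q i := hreg i hi _ <| by
    have : q i * (x - w) = z + y := by linear_combination -hay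
    rw [this]
    exact add_mem (Ideal.mul_le_left hz) hy'
  have hw' : w ∈ I ^ n := Ideal.mul_le_right hw
  have h4 : x - w ∈ I ^ n := sub_mem hx hw'
  have h5 : x - w ∈ initialSpan q i * I ^ (n - 1) := by
    rcases n with _ | n
    · simpa using h3
    · exact initialSpan_inf_le hreg (L := fun n => I ^ n) (by simp)
        (fun j hj n x hx => by
          rw [pow_succ']
          exact Ideal.mul_mem_mul (hq j hj) hx) hI hi.le n (Ideal.mem_inf.2 ⟨h3, h4⟩)
  have : x = w + (x - w) := by ring
  rw [this]
  exact Submodule.add_mem_sup hw h5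

/-- The associated graded ring of `Q` is a polynomial ring over `A ⧸ Q`, so annihilators of `𝔟` are
computed coefficientwise. The proof avoids this ring: it works modulo the first `i` variables, by
descending induction from the trivial case `i = d`, and uses `mem_of_mul_mem_sup` with both ideals
equal to `Q`. -/
theorem mem_pow_mul_colon_sup (hreg : ∀ i < d, ∀ u, q i * u ∈ initialSpan q i → u ∈ initialSpan q i)
    {Q 𝔟 : Ideal A} (hQ : Q = initialSpan q d) {i : ℕ} (hi : i ≤ d) {n : ℕ} {x : A}
    (hx : x ∈ Q ^ n) (h : ∀ b ∈ 𝔟, b * x ∈ Q ^ (n + 1) ⊔ initialSpan q i * Q ^ (n - 1)) :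
    x ∈ Q ^ n * Submodule.colon Q (𝔟 : Set A) ⊔ initialSpan q i * Q ^ (n - 1) := by
  have hle : ∀ i ≤ d, initialSpan q i ≤ Q := fun i hi => hQ ▸ initialSpan_mono q hi
  have hzero : ∀ i ≤ d, ∀ x, (∀ b ∈ 𝔟, b * x ∈ Q ^ (0 + 1) ⊔ initialSpan q i * Q ^ (0 - 1)) →
      x ∈ Q ^ 0 * Submodule.colon Q (𝔟 : Set A) ⊔ initialSpan q i * Q ^ (0 - 1) := by
    intro i hi x h
    refine Ideal.mem_sup_left ?_
    rw [pow_zero, one_mul, Submodule.mem_colon]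
    intro b hb
    have := h b hb
    simp only [zero_add, pow_one, zero_tsub, pow_zero, mul_one, sup_eq_left.2 (hle i hi)] at this
    rwa [smul_eq_mul, mul_comm]
  induction hi using Nat.decreasingInduction generalizing n x with
  | self =>
    rcases n with _ | n
    · exact hzero d le_rfl x h
    · refine Ideal.mem_sup_right ?_
      rwa [← hQ, Nat.add_sub_cancel, ← pow_succ']
  | of_succ i hi ih =>
    induction n generalizing x with
    | zero => exact hzero i hi.le x h
    | succ n ihn =>
      have h1 := ih hx fun b hb => sup_le_sup_left
        (Ideal.mul_mono_left (initialSpan_mono q i.le_succ)) _ (h b hb)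
      obtain ⟨y, hy, z, hz, hyz⟩ := Submodule.mem_sup.1 h1
      obtain ⟨z', hz', w, hw, rfl⟩ := mem_initialSpan_succ_mul.1 hz
      rw [Nat.add_sub_cancel] at hz' hw ⊢
      have h2 : w ∈ Q ^ n * Submodule.colon Q (𝔟 : Set A) ⊔ initialSpan q i * Q ^ (n - 1) := by
        refine ihn hw fun b hb => ?_
        have h3 : q i * (b * w) ∈ Q * Q ^ (n + 1) ⊔ initialSpan q i * Q ^ n := by
          have h4 := h b hb
          rw [Nat.add_sub_cancel, pow_succ'] at h4
          have h5 : b * y ∈ Q * Q ^ (n + 1) := by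
            refine Submodule.mul_induction_on hy (fun s hs t ht => ?_) fun s t hs ht => ?_
            · rw [show b * (s * t) = t * b * s by ring]
              exact Ideal.mul_mem_mul (Submodule.mem_colon.1 ht b hb) hs
            · rw [mul_add]
              exact add_mem hs ht
          have : q i * (b * w) = b * x - b * y - b * z' := by rw [← hyz]; ring
          rw [this]
          exact sub_mem (sub_mem h4 (Ideal.mem_sup_left h5))
            (Ideal.mem_sup_right (Ideal.mul_mem_left _ _ hz'))
        rw [pow_succ']
        refine mem_of_mul_mem_sup hreg hQ.ge hQ.ge (fun n => ?_) (fun n => ?_) hi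
          (Ideal.mul_mem_left _ _ hw) h3
        · rw [pow_succ', ← hQ]
          exact inf_le_right
        · rw [pow_succ', ← hQ]
          exact inf_le_right
      obtain ⟨s, hs, t, ht, rfl⟩ := Submodule.mem_sup.1 h2
      have hqQ : q i ∈ Q := hle d le_rfl (mem_initialSpan q hi)
      have h6 : q i * s ∈ Q ^ (n + 1) * Submodule.colon Q (𝔟 : Set A) := by
        rw [pow_succ', mul_assoc]
        exact Ideal.mul_mem_mul hqQ hs
      have h7 : q i * t ∈ initialSpan q i * Q ^ n := by
        rcases n with _ | n
        · simpa using Ideal.mul_mem_left _ (q i) ht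
        · rw [pow_succ', mul_left_comm]
          exact Ideal.mul_mem_mul hqQ ht
      have : x = (y + q i * s) + (z' + q i * t) := by rw [← hyz]; ring
      rw [this]
      exact Submodule.add_mem_sup (add_mem hy h6) (add_mem hz' h7)

/-- For an ideal `Q` generated by a regular sequence, an element of `Q ^ n` that is multiplied into
`Q ^ (n + 1)` by `𝔟` lies in `Q ^ n * (Q : 𝔟)`. -/
theorem mem_pow_mul_colon (hreg : ∀ i < d, ∀ u, q i * u ∈ initialSpan q i → u ∈ initialSpan q i)
    {Q 𝔟 : Ideal A} (hQ : Q = initialSpan q d) {n : ℕ} {x : A}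
    (hx : x ∈ Q ^ n) (h : ∀ b ∈ 𝔟, b * x ∈ Q ^ (n + 1)) :
    x ∈ Q ^ n * Submodule.colon Q (𝔟 : Set A) := by
  have := mem_pow_mul_colon_sup hreg hQ (Nat.zero_le d) hx
    fun b hb => Ideal.mem_sup_left (h b hb)
  rwa [initialSpan_zero, Ideal.bot_mul, sup_bot_eq] at this

end FiltrationIntersection

/-! ### Integral ideals and reductions -/

section Reduction

variable {A : Type*} [CommRing A]

/-- A finitely generated ideal integral over an ideal `Q ≤ I` has `Q` as a reduction. -/
theorem Ideal.IsIntegralOverIdeal.exists_pow_succ_le {I Q : Ideal A} (hfg : I.FG) (hQI : Q ≤ I)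
    (h : I.IsIntegralOverIdeal Q) : ∃ N, I ^ (N + 1) ≤ Q * I ^ N := by
  classical
  have key : ∀ s : Finset A, (s : Set A) ⊆ I →
      ∃ N, (Q ⊔ Ideal.span s) ^ (N + 1) ≤ Q * (Q ⊔ Ideal.span s) ^ N := by
    intro s
    induction s using Finset.induction with
    | empty => exact fun _ => ⟨0, by simp⟩
    | insert x s hx ih =>
      intro hs
      rw [Finset.coe_insert, Set.insert_subset_iff] at hs
      obtain ⟨N, hN⟩ := ih hs.2
      obtain ⟨n, c, hn, hc, hxc⟩ := h x hs.1
      set K := Q ⊔ Ideal.span (s : Set A) with hK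
      have hL : Q ⊔ Ideal.span (↑(insert x s) : Set A) = K ⊔ Ideal.span {x} := by
        rw [Finset.coe_insert, Ideal.span_insert, hK, sup_assoc, sup_comm (Ideal.span {x})]
      rw [hL]
      set L := K ⊔ Ideal.span {x} with hLdef
      have hxL : x ∈ L := Ideal.mem_sup_right (Ideal.mem_span_singleton_self x)
      have hKL : K ≤ L := le_sup_left
      have hQK : Q ≤ K := le_sup_left
      obtain ⟨m, rfl⟩ := Nat.exists_eq_succ_of_ne_zero hn.ne'
      have hxn : x ^ (m + 1) ∈ K * L ^ m := by
        rw [eq_neg_of_add_eq_zero_left hxc]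
        refine neg_mem (Ideal.sum_mem _ fun i hi => ?_)
        obtain ⟨hi1, hi2⟩ := Finset.mem_Icc.1 hi
        have h1 : c i * x ^ (m + 1 - i) ∈ Q ^ i * L ^ (m + 1 - i) :=
          Ideal.mul_mem_mul (hc i) (Ideal.pow_mem_pow hxL _)
        obtain ⟨k, rfl⟩ := Nat.exists_eq_add_of_le hi1
        refine (?_ : Q ^ (1 + k) * L ^ (m + 1 - (1 + k)) ≤ _) h1
        rw [pow_add, pow_one, mul_assoc]
        refine Ideal.mul_mono hQK ?_
        calc Q ^ k * L ^ (m + 1 - (1 + k)) ≤ L ^ k * L ^ (m + 1 - (1 + k)) :=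
              Ideal.mul_mono_left (Ideal.pow_right_mono (hQK.trans hKL) k)
          _ = L ^ m := by rw [← pow_add]; congr 1; omega
      have hLK : ∀ k, L ^ (k + 1) ≤ K * L ^ k ⊔ Ideal.span {x ^ (k + 1)} := by
        intro k
        induction k with
        | zero => simp [hLdef]
        | succ k ihk =>
          rw [pow_succ' L (k + 1)]
          nth_rewrite 1 [hLdef]
          rw [Ideal.sup_mul]
          refine sup_le le_sup_left ?_
          refine (Ideal.mul_mono_right ihk).trans ?_
          rw [Ideal.mul_sup, Ideal.span_singleton_mul_span_singleton, ← pow_succ', mul_left_comm]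
          refine sup_le_sup_right (Ideal.mul_mono_right ?_) _
          rw [pow_succ']
          exact Ideal.mul_mono_left le_sup_right
      have hLm : L ^ (m + 1) ≤ K * L ^ m :=
        (hLK m).trans (sup_le le_rfl ((Ideal.span_singleton_le_iff_mem _).2 hxn))
      have hLj : ∀ j, L ^ (m + j) ≤ K ^ j * L ^ m := by
        intro j
        induction j with
        | zero => simp
        | succ j ihj =>
          calc L ^ (m + (j + 1)) = L * L ^ (m + j) := by rw [← add_assoc, pow_succ']
            _ ≤ L * (K ^ j * L ^ m) := Ideal.mul_mono_right ihj
            _ = K ^ j * L ^ (m + 1) := by rw [pow_succ']; ring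
            _ ≤ K ^ j * (K * L ^ m) := Ideal.mul_mono_right hLm
            _ = K ^ (j + 1) * L ^ m := by ring
      -- `N` comes from `K` and `m + 1` is the degree of the equation of `x` over `Q`: the latter
      -- trades surplus factors `L` for `K`, and `N + 1` factors `K` yield one `Q`.
      refine ⟨N + m, ?_⟩
      calc L ^ (N + m + 1) = L ^ (m + (N + 1)) := by congr 1; omega
        _ ≤ K ^ (N + 1) * L ^ m := hLj _
        _ ≤ Q * K ^ N * L ^ m := Ideal.mul_mono_left hN
        _ ≤ Q * L ^ N * L ^ m := Ideal.mul_mono_left (Ideal.mul_mono_right (Ideal.pow_right_mono hKL N))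
        _ = Q * L ^ (N + m) := by ring
  obtain ⟨s, hs⟩ := hfg
  have := key s (hs ▸ Ideal.subset_span)
  rw [show Q ⊔ Ideal.span (s : Set A) = I by
    rw [show Ideal.span (s : Set A) = I from hs]; exact sup_eq_right.2 hQI] at this
  exact this

end Reduction

/-! ### Powers of the quasi-socle ideal `I = Q : 𝔪²` -/

section QuasiSocle

theorem inf_pow_succ_le {A : Type*} [CommRing A] {Q I : Ideal A} (hsq : Q ⊓ I ^ 2 ≤ Q * I) (h3 : I ^ 3 ≤ Q * I ^ 2) (n : ℕ) :
    Q ⊓ I ^ (n + 1) ≤ Q * I ^ n := by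
  rcases n with _ | _ | n
  · simp
  · simpa using hsq
  · calc Q ⊓ I ^ (n + 1 + 1 + 1) ≤ I ^ (n + 1 + 1 + 1) := inf_le_right
      _ = I ^ 3 * I ^ n := by ring
      _ ≤ Q * I ^ 2 * I ^ n := Ideal.mul_mono_left h3
      _ = Q * I ^ (n + 1 + 1) := by ring

variable {A : Type u} [CommRing A] [IsLocalRing A]

/-- In a Gorenstein Artinian quotient `A ⧸ Q`, the socle is generated by any of its nonzero
elements. -/
theorem exists_eq_add_mul_of_mem_socle {Q : Ideal A}
    (hdual : ∀ K : Ideal A, Q ≤ K → ∀ x ∉ K, ∃ y, (∀ k ∈ K, k * y ∈ Q) ∧ x * y ∉ Q)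
    {s x : A} (hs : s ∉ Q) (hx : ∀ a ∈ maximalIdeal A, a * x ∈ Q) :
    ∃ j ∈ Q, ∃ c, x = j + s * c := by
  rw [← Ideal.mem_sup_span_singleton_iff]
  by_contra hcon
  obtain ⟨y, hy, hxy⟩ := hdual (Q ⊔ Ideal.span {s}) le_sup_left x hcon
  have hu : IsUnit y := by
    by_contra hu
    exact hxy (by rw [mul_comm]; exact hx y hu)
  have h1 := hy s (Ideal.mem_sup_right (Ideal.mem_span_singleton_self s))
  exact hs ((Ideal.mul_unit_mem_iff_mem _ hu).1 h1)

variable {Q I : Ideal A}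

theorem mul_mem_of_mem_colon_sq (hI : I = Submodule.colon Q ((maximalIdeal A ^ 2 : Ideal A) : Set A))
    {a b x : A} (ha : a ∈ maximalIdeal A) (hb : b ∈ maximalIdeal A) (hx : x ∈ I) :
    b * (a * x) ∈ Q := by
  rw [hI, Submodule.mem_colon] at hx
  have := hx (b * a) (by rw [pow_two]; exact Ideal.mul_mem_mul hb ha)
  rw [smul_eq_mul] at this
  convert! this using 1
  ring

/-- The hypothesis `hemb` encodes embedding dimension greater than one. It lets the socle generator
be represented as `f * w'` with `f * w ∈ Q`. The errors incurred lie in `Q ∩ 𝔪I`, which `hQmI`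
improves to `𝔪Q`. -/
theorem maximalIdeal_mul_sq_le
    (hdual : ∀ K : Ideal A, Q ≤ K → ∀ x ∉ K, ∃ y, (∀ k ∈ K, k * y ∈ Q) ∧ x * y ∉ Q)
    (hI : I = Submodule.colon Q ((maximalIdeal A ^ 2 : Ideal A) : Set A))
    (hemb : ∀ a ∈ maximalIdeal A, ∃ f ∈ maximalIdeal A,
      f ∉ Ideal.span {a} ⊔ (maximalIdeal A ^ 2 ⊔ Q))
    (hQmI : Q ⊓ maximalIdeal A * I ≤ maximalIdeal A * Q) :
    maximalIdeal A * I ^ 2 ≤ maximalIdeal A * (Q * I) := by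
  have hQ : ∀ a ∈ maximalIdeal A, ∀ y ∈ I, ∀ w ∈ I, a * y ∈ Q →
      a * y * w ∈ maximalIdeal A * (Q * I) := by
    intro a ha y hy w hw h
    rw [← mul_assoc]
    exact Ideal.mul_mem_mul (hQmI (Ideal.mem_inf.2 ⟨h, Ideal.mul_mem_mul ha hy⟩)) hw
  refine Ideal.mul_le.2 fun a ha z hz => ?_
  rw [pow_two] at hz
  refine Submodule.mul_induction_on hz (fun y hy w hw => ?_) fun y w hy hw => ?_
  swap
  · rw [mul_add]
    exact add_mem hy hw
  rw [← mul_assoc a]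
  by_cases hay : a * y ∈ Q
  · exact hQ a ha y hy w hw hay
  by_cases haw : a * w ∈ Q
  · rw [mul_right_comm a]
    exact hQ a ha w hw y hy haw
  obtain ⟨f, hf, hfK⟩ := hemb a ha
  -- modify `f` by a multiple of `a` so that `f * w ∈ Q`
  obtain ⟨f, hf, hfK, hfw⟩ : ∃ f ∈ maximalIdeal A,
      f ∉ Ideal.span {a} ⊔ (maximalIdeal A ^ 2 ⊔ Q) ∧ f * w ∈ Q := by
    obtain ⟨j, hj, c, hc⟩ := exists_eq_add_mul_of_mem_socle hdual haw
      fun b hb => mul_mem_of_mem_colon_sq hI hf hb hw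
    refine ⟨f - a * c, sub_mem hf (Ideal.mul_mem_right _ _ ha), fun h => hfK ?_, ?_⟩
    · have h1 := add_mem h (Ideal.mem_sup_left (Ideal.mul_mem_right c _
        (Ideal.mem_span_singleton_self a)))
      rwa [sub_add_cancel] at h1
    · rw [show (f - a * c) * w = j by linear_combination hc]
      exact hj
  obtain ⟨w', hw', hfw'⟩ := hdual _ (le_sup_right.trans le_sup_right) f hfK
  have hw'I : w' ∈ I := by
    rw [hI, Submodule.mem_colon]
    intro b hb
    rw [smul_eq_mul, mul_comm]
    exact hw' b (Ideal.mem_sup_right (Ideal.mem_sup_left hb))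
  obtain ⟨j, hj, c, hc⟩ := exists_eq_add_mul_of_mem_socle hdual hfw'
    fun b hb => mul_mem_of_mem_colon_sq hI ha hb hy
  have hjm : j ∈ maximalIdeal A * I := by
    rw [eq_sub_of_add_eq hc.symm]
    exact sub_mem (Ideal.mul_mem_mul ha hy)
      (Ideal.mul_mem_right _ _ (Ideal.mul_mem_mul hf hw'I))
  have h1 : j * w ∈ maximalIdeal A * (Q * I) := by
    rw [← mul_assoc]
    exact Ideal.mul_mem_mul (hQmI (Ideal.mem_inf.2 ⟨hj, hjm⟩)) hw
  rw [hc, show (j + f * w' * c) * w = j * w + c * (f * w * w') by ring]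
  exact add_mem h1 (Ideal.mul_mem_left _ _ (hQ f hf w hw w' hw'I hfw))

variable {q : ℕ → A} {d : ℕ}

/-- From `𝔪²I² ⊆ 𝔪²QI ⊆ Q²`, an element of `Q ∩ I²` is multiplied into `Q²` by `𝔪²`, hence lies in
`Q(Q : 𝔪²)`. -/
theorem inf_sq_le (hreg : ∀ i < d, ∀ u, q i * u ∈ initialSpan q i → u ∈ initialSpan q i)
    (hQ : Q = initialSpan q d)
    (hI : I = Submodule.colon Q ((maximalIdeal A ^ 2 : Ideal A) : Set A))
    (hmI : maximalIdeal A * I ^ 2 ≤ maximalIdeal A * (Q * I)) : Q ⊓ I ^ 2 ≤ Q * I := by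
  intro x hx
  obtain ⟨hx1, hx2⟩ := Ideal.mem_inf.1 hx
  have h := mem_pow_mul_colon hreg hQ (𝔟 := maximalIdeal A ^ 2) (n := 1) (by simpa using hx1) ?_
  · rwa [pow_one, ← hI] at h
  intro b hb
  have h1 : b * x ∈ maximalIdeal A ^ 2 * I ^ 2 := Ideal.mul_mem_mul hb hx2
  refine (?_ : maximalIdeal A ^ 2 * I ^ 2 ≤ _) h1
  calc maximalIdeal A ^ 2 * I ^ 2 = maximalIdeal A * (maximalIdeal A * I ^ 2) := by ring
    _ ≤ maximalIdeal A * (maximalIdeal A * (Q * I)) := Ideal.mul_mono_right hmI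
    _ = Q * (maximalIdeal A * (maximalIdeal A * I)) := by ring
    _ ≤ Q * Q := Ideal.mul_mono_right (Ideal.mul_le.2 fun b hb z hz => by
        refine Submodule.mul_induction_on hz (fun a ha x hx => ?_) fun y w hy hw => ?_
        · exact mul_mem_of_mem_colon_sq hI ha hb hx
        · rw [mul_add]
          exact add_mem hy hw)
    _ = Q ^ (1 + 1) := by ring

theorem maximalIdeal_mul_mul_le
    (hI : I = Submodule.colon Q ((maximalIdeal A ^ 2 : Ideal A) : Set A)) :
    maximalIdeal A * (maximalIdeal A * I) ≤ Q :=
  Ideal.mul_le.2 fun b hb z hz => by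
    refine Submodule.mul_induction_on hz (fun a ha x hx => ?_) fun y w hy hw => ?_
    · exact mul_mem_of_mem_colon_sq hI ha hb hx
    · rw [mul_add]
      exact add_mem hy hw

/-- If `I² ⊆ Q`, then `I² = QI` already. Otherwise an element of `I²` generates the socle modulo
`Q`, so `𝔪I ⊆ Q + I²` and `I³ ⊆ 𝔪QI ⊆ Q² + QI²`. The component in `Q²` also lies in `I³`, and `𝔪²I³
⊆ Q³` places it in `Q²I`. -/
theorem pow_three_le
    (hdual : ∀ K : Ideal A, Q ≤ K → ∀ x ∉ K, ∃ y, (∀ k ∈ K, k * y ∈ Q) ∧ x * y ∉ Q)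
    (hreg : ∀ i < d, ∀ u, q i * u ∈ initialSpan q i → u ∈ initialSpan q i)
    (hQ : Q = initialSpan q d) (hIm : I ≤ maximalIdeal A) (hQI : Q ≤ I)
    (hI : I = Submodule.colon Q ((maximalIdeal A ^ 2 : Ideal A) : Set A))
    (hmI : maximalIdeal A * I ^ 2 ≤ maximalIdeal A * (Q * I)) : I ^ 3 ≤ Q * I ^ 2 := by
  have hmm := maximalIdeal_mul_mul_le hI
  by_cases hIQ : I ^ 2 ≤ Q
  · calc I ^ 3 = I * I ^ 2 := by ring
      _ ≤ I * (Q * I) := Ideal.mul_mono_right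
          ((le_inf hIQ le_rfl).trans (inf_sq_le hreg hQ hI hmI))
      _ = Q * I ^ 2 := by ring
  obtain ⟨s, hsI, hsQ⟩ := SetLike.not_le_iff_exists.1 hIQ
  have hmIs : maximalIdeal A * I ≤ Q ⊔ I ^ 2 := by
    intro x hx
    obtain ⟨j, hj, c, rfl⟩ := exists_eq_add_mul_of_mem_socle hdual hsQ
      fun a ha => hmm (Ideal.mul_mem_mul ha hx)
    exact Submodule.add_mem_sup hj (Ideal.mul_mem_right _ _ hsI)
  have h3 : I ^ 3 ≤ maximalIdeal A * (Q * I) := by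
    calc I ^ 3 = I * I ^ 2 := by ring
      _ ≤ maximalIdeal A * I ^ 2 := Ideal.mul_mono_left hIm
      _ ≤ _ := hmI
  have h3' : I ^ 3 ≤ Q ^ 2 ⊔ Q * I ^ 2 := by
    calc I ^ 3 ≤ maximalIdeal A * (Q * I) := h3
      _ = Q * (maximalIdeal A * I) := by ring
      _ ≤ Q * (Q ⊔ I ^ 2) := Ideal.mul_mono_right hmIs
      _ = Q ^ 2 ⊔ Q * I ^ 2 := by rw [Ideal.mul_sup, pow_two Q]
  have hQI3 : Q * I ^ 2 ≤ I ^ 3 := by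
    rw [pow_succ' I 2]
    exact Ideal.mul_mono_left hQI
  intro x hx
  obtain ⟨z, hz, r, hr, rfl⟩ := Submodule.mem_sup.1 (h3' hx)
  refine add_mem ?_ hr
  have hzI : z ∈ I ^ 3 := (Ideal.add_mem_iff_left _ (hQI3 hr)).1 hx
  have h := mem_pow_mul_colon hreg hQ (𝔟 := maximalIdeal A ^ 2) hz ?_
  · rw [← hI] at h
    refine (?_ : Q ^ 2 * I ≤ _) h
    calc Q ^ 2 * I = Q * (Q * I) := by ring
      _ ≤ Q * (I * I) := Ideal.mul_mono_right (Ideal.mul_mono_left hQI)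
      _ = Q * I ^ 2 := by ring
  intro b hb
  refine (?_ : maximalIdeal A ^ 2 * I ^ 3 ≤ _) (Ideal.mul_mem_mul hb hzI)
  calc maximalIdeal A ^ 2 * I ^ 3 = maximalIdeal A * I * (maximalIdeal A * I ^ 2) := by ring
    _ ≤ maximalIdeal A * I * (maximalIdeal A * (Q * I)) := Ideal.mul_mono_right hmI
    _ = Q * maximalIdeal A * (maximalIdeal A * I ^ 2) := by ring
    _ ≤ Q * maximalIdeal A * (maximalIdeal A * (Q * I)) := Ideal.mul_mono_right hmI
    _ = Q ^ 2 * (maximalIdeal A * (maximalIdeal A * I)) := by ring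
    _ ≤ Q ^ 2 * Q := Ideal.mul_mono_right hmm
    _ = Q ^ (2 + 1) := by ring

theorem inf_maximalIdeal_mul_pow_succ_le (hQmI : Q ⊓ maximalIdeal A * I ≤ maximalIdeal A * Q)
    (hmI : maximalIdeal A * I ^ 2 ≤ maximalIdeal A * (Q * I)) (n : ℕ) :
    Q ⊓ maximalIdeal A * I ^ (n + 1) ≤ Q * (maximalIdeal A * I ^ n) := by
  rcases n with _ | n
  · simpa [mul_comm] using hQmI
  · calc Q ⊓ maximalIdeal A * I ^ (n + 1 + 1) ≤ maximalIdeal A * I ^ (n + 1 + 1) := inf_le_right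
      _ = maximalIdeal A * I ^ 2 * I ^ n := by ring
      _ ≤ maximalIdeal A * (Q * I) * I ^ n := Ideal.mul_mono_left hmI
      _ = Q * (maximalIdeal A * I ^ (n + 1)) := by ring

theorem Ideal.IsIntegralOverIdeal.le_maximalIdeal (hint : I.IsIntegralOverIdeal Q)
    (hQ : Q ≤ maximalIdeal A) : I ≤ maximalIdeal A := by
  intro x hx
  obtain ⟨n, c, hn, hc, h⟩ := hint x hx
  have h1 : x ^ n ∈ maximalIdeal A := by
    rw [eq_neg_of_add_eq_zero_left h]
    refine neg_mem (Ideal.sum_mem _ fun i hi => Ideal.mul_mem_right _ _ ?_)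
    have := Finset.mem_Icc.1 hi
    exact hQ (Ideal.pow_le_self (by omega) (hc i))
  exact Ideal.IsPrime.mem_of_pow_mem inferInstance n h1

/-- If `A ⧸ Q` has embedding dimension greater than one, then the maximal ideal is not generated by
one element modulo `𝔪 ^ 2 + Q`. -/
theorem exists_notMem_of_one_lt_embDim [IsLocalRing (A ⧸ Q)] (hQ : Q ≤ maximalIdeal A)
    (hv : 1 < embDim (A ⧸ Q)) {a : A}
    (ha : a ∈ maximalIdeal A) :
    ∃ f ∈ maximalIdeal A, f ∉ Ideal.span {a} ⊔ (maximalIdeal A ^ 2 ⊔ Q) := by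
  by_contra! hcon
  refine not_le.2 hv ?_
  have hmap : (maximalIdeal A).map (Ideal.Quotient.mk Q) = maximalIdeal (A ⧸ Q) := by
    refine le_antisymm (Ideal.map_le_iff_le_comap.2 fun r hr => (mk_mem_maximalIdeal_iff hQ).2 hr)
      fun y hy => ?_
    obtain ⟨r, rfl⟩ := Ideal.Quotient.mk_surjective y
    exact Ideal.mem_map_of_mem _ ((mk_mem_maximalIdeal_iff hQ).1 hy)
  have hamem : Ideal.Quotient.mk Q a ∈ maximalIdeal (A ⧸ Q) := hmap ▸ Ideal.mem_map_of_mem _ ha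
  let x : (maximalIdeal (A ⧸ Q)).Cotangent := (maximalIdeal (A ⧸ Q)).toCotangent ⟨_, hamem⟩
  have hle : maximalIdeal (A ⧸ Q) ≤ LinearMap.ker (LinearMap.toSpanSingleton (A ⧸ Q) _ x) := by
    intro r hr
    rw [LinearMap.mem_ker, LinearMap.toSpanSingleton_apply, ← map_smul,
      Ideal.toCotangent_eq_zero, pow_two]
    exact Ideal.mul_mem_mul hr hamem
  -- If `a` generates `𝔪` modulo `𝔪² + Q`, the residue field maps onto the cotangent space, whose
  -- length is then at most one.
  let φ := Submodule.liftQ (maximalIdeal (A ⧸ Q)) _ hle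
  have hφ : Function.Surjective φ := by
    intro y
    obtain ⟨⟨y, hy⟩, rfl⟩ := Ideal.toCotangent_surjective _ y
    obtain ⟨f, rfl⟩ := Ideal.Quotient.mk_surjective y
    have hf : f ∈ maximalIdeal A := (mk_mem_maximalIdeal_iff hQ).1 hy
    obtain ⟨s, hs, t, ht, hst⟩ := Submodule.mem_sup.1 (hcon f hf)
    obtain ⟨r, rfl⟩ := Ideal.mem_span_singleton'.1 hs
    refine ⟨Submodule.Quotient.mk (Ideal.Quotient.mk Q r), ?_⟩
    rw [Submodule.liftQ_apply, LinearMap.toSpanSingleton_apply, ← map_smul, Ideal.toCotangent_eq]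
    have h1 : Ideal.Quotient.mk Q t ∈ maximalIdeal (A ⧸ Q) ^ 2 := by
      obtain ⟨t1, ht1, t2, ht2, rfl⟩ := Submodule.mem_sup.1 ht
      rw [map_add, Ideal.Quotient.eq_zero_iff_mem.2 ht2, add_zero, ← hmap, ← Ideal.map_pow]
      exact Ideal.mem_map_of_mem _ ht1
    have h2 := neg_mem h1
    convert! h2 using 1
    change Ideal.Quotient.mk Q r * Ideal.Quotient.mk Q a - Ideal.Quotient.mk Q f = _
    rw [← hst, map_add, map_mul]
    ring
  have h1 := Module.length_le_of_surjective φ hφ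
  have h2 : Module.length (A ⧸ Q) ((A ⧸ Q) ⧸ maximalIdeal (A ⧸ Q)) = 1 := by
    rw [Module.length_eq_one_iff, isSimpleModule_iff_isCoatom, ← Ideal.isMaximal_def]
    exact maximalIdeal.isMaximal _
  exact h1.trans h2.le

end QuasiSocle

/-! ### Extraction of the numerical conditions from the Gorenstein hypothesis -/

section Setup

variable {A : Type u} [CommRing A] [IsLocalRing A] [IsNoetherianRing A]

/-- If `Q` is a parameter ideal that is a reduction of `I`, then `Q ∩ 𝔪 I = 𝔪 Q`. -/
theorem inf_maximalIdeal_mul_le {Q I : Ideal A} {d : ℕ} {a : Fin d → A}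
    (hdim : (d : WithBot ℕ∞) ≤ ringKrullDim A) (hQa : Q = Ideal.span (Set.range a))
    (hQ : Q ≤ maximalIdeal A) (hrad : maximalIdeal A ≤ I.radical) {N : ℕ}
    (hN : I ^ (N + 1) ≤ Q * I ^ N) : Q ⊓ maximalIdeal A * I ≤ maximalIdeal A * Q := by
  intro x hx
  obtain ⟨hx1, hx2⟩ := Ideal.mem_inf.1 hx
  have hx3 := hx1
  rw [hQa, Ideal.mem_span_range_iff_exists_fun] at hx3
  obtain ⟨c, rfl⟩ := hx3
  have haQ : ∀ i, a i ∈ Q := fun i => hQa ▸ Ideal.subset_span ⟨i, rfl⟩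
  refine Ideal.sum_mem _ fun j _ => ?_
  by_contra hcj
  have hu : IsUnit (c j) := by
    by_contra hu
    exact hcj (Ideal.mul_mem_mul hu (haQ j))
  set x := ∑ i, c i * a i with hxdef
  let qs : List A := ((List.finRange d).erase j).map a
  have hqs : ∀ i ≠ j, a i ∈ Ideal.ofList qs := fun i hi => by
    refine Ideal.subset_span (List.mem_map.2 ⟨i, ?_, rfl⟩)
    exact (List.mem_erase_of_ne hi).2 (List.mem_finRange i)
  have hlen : qs.length + 1 = d := by
    have h1 := List.length_erase_add_one (List.mem_finRange j)
    simpa [qs] using h1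
  have hqsm : ∀ y ∈ qs, y ∈ maximalIdeal A := by
    intro y hy
    obtain ⟨i, -, rfl⟩ := List.mem_map.1 hy
    exact hQ (haQ i)
  -- The unit coefficient lets `x` replace `a j` among the generators. As `x ∈ 𝔪I`, Nakayama puts
  -- `I^(N+1)` into the ideal of the other `d - 1` generators, which are too few for an `𝔪`-primary
  -- ideal.
  have hle : Q ≤ Ideal.span {x} ⊔ Ideal.ofList qs := by
    rw [hQa, Ideal.span_le]
    rintro _ ⟨i, rfl⟩
    by_cases hi : i = j
    · subst hi
      refine (Ideal.unit_mul_mem_iff_mem _ hu).1 ?_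
      rw [eq_sub_of_add_eq (Finset.add_sum_erase Finset.univ (fun k => c k * a k) (Finset.mem_univ i))]
      refine sub_mem (Ideal.mem_sup_left (Ideal.mem_span_singleton_self x)) (Ideal.mem_sup_right ?_)
      exact Ideal.sum_mem _ fun k hk => Ideal.mul_mem_left _ _ (hqs k (Finset.ne_of_mem_erase hk))
    · exact Ideal.mem_sup_right (hqs i hi)
  have hIle : I ^ (N + 1) ≤ Ideal.ofList qs ⊔ maximalIdeal A • I ^ (N + 1) := by
    calc I ^ (N + 1) ≤ Q * I ^ N := hN
      _ ≤ (Ideal.span {x} ⊔ Ideal.ofList qs) * I ^ N := Ideal.mul_mono_left hle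
      _ = Ideal.span {x} * I ^ N ⊔ Ideal.ofList qs * I ^ N := Ideal.sup_mul _ _ _
      _ ≤ maximalIdeal A * I * I ^ N ⊔ Ideal.ofList qs := sup_le_sup
          (Ideal.mul_mono_left ((Ideal.span_singleton_le_iff_mem _).2 hx2)) Ideal.mul_le_left
      _ = Ideal.ofList qs ⊔ maximalIdeal A • I ^ (N + 1) := by
          rw [sup_comm, smul_eq_mul, pow_succ', mul_assoc]
  have hIle' : I ^ (N + 1) ≤ Ideal.ofList qs :=
    Submodule.le_of_le_smul_of_le_jacobson_bot (IsNoetherian.noetherian _)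
      (maximalIdeal_le_jacobson _) hIle
  have hrad' : maximalIdeal A ≤ (⊥ ⊔ Ideal.ofList qs).radical := by
    rw [bot_sup_eq]
    refine hrad.trans ?_
    rw [← Ideal.radical_pow I N.succ_ne_zero]
    exact Ideal.radical_mono hIle'
  have h1 := ringKrullDim_quotient_le_sup_ofList ⊥ hqsm
  rw [ringKrullDim_eq_of_ringEquiv (RingEquiv.quotientBot A)] at h1
  have h2 : ((qs.length + 1 : ℕ) : WithBot ℕ∞) ≤ (qs.length : ℕ) := by
    rw [hlen]
    refine hdim.trans (h1.trans ?_)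
    simpa using add_le_add_left (ringKrullDim_quotient_nonpos hrad') (qs.length : WithBot ℕ∞)
  have h3 : qs.length + 1 ≤ qs.length := by exact_mod_cast h2
  omega

/-- The properties of an ideal `I` with minimal reduction `(q 0, …, q (d - 1))` from which the
Cohen-Macaulay property of its blow-up algebras is derived. -/
structure ReductionSystem {A : Type*} [CommRing A] [IsLocalRing A] (I : Ideal A) (q : ℕ → A)
    (d : ℕ) : Prop where
  pos : 0 < d
  regular : ∀ i < d, ∀ u, q i * u ∈ initialSpan q i → u ∈ initialSpan q i
  nonzerodivisor : ∀ i < d, ∀ u, q i * u = 0 → u = 0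
  le : initialSpan q d ≤ I
  le_maximalIdeal : I ≤ maximalIdeal A
  le_radical : maximalIdeal A ≤ (initialSpan q d).radical
  inf_pow_le : ∀ n, initialSpan q d ⊓ I ^ (n + 1) ≤ initialSpan q d * I ^ n
  inf_maximalIdeal_mul_pow_le : ∀ n, initialSpan q d ⊓ maximalIdeal A * I ^ (n + 1) ≤
    initialSpan q d * (maximalIdeal A * I ^ n)
  pow_three_le : I ^ 3 ≤ initialSpan q d * I ^ 2
  isIntegral : I.IsIntegralOverIdeal (initialSpan q d)

theorem SelfInjectiveDimensionLE.injective_of_le_radical {J : Ideal A} (hJ : J ≤ maximalIdeal A)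
    {n : ℕ} (h : SelfInjectiveDimensionLE J n) (hrad : maximalIdeal A ≤ J.radical) :
    Module.Injective (A ⧸ J) (A ⧸ J) := by
  have h1 : (1 : A) ∉ J := fun h1 =>
    (maximalIdeal.isMaximal A).ne_top ((Ideal.eq_top_iff_one _).2 (hJ h1))
  obtain ⟨P, c, hP, hc, -⟩ := exists_isAssociated_ge J h1
  have hJP : J ≤ P := fun j hj => (hc j).2 (J.mul_mem_right _ hj)
  have hmP : maximalIdeal A ≤ P := hrad.trans (hP.radical_le_iff.2 hJP)
  exact h.injective hJ (b := c) (fun hcJ => hP.ne_top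
    ((Ideal.eq_top_iff_one _).2 ((hc 1).2 (by simpa)))) fun r hr => (hc r).1 (hmP hr)

theorem regularMod_bot_of_parameters (hA : IsGorensteinLocal A) {qs : List A}
    (hqs : ∀ x ∈ qs, x ∈ maximalIdeal A) (hdim : (qs.length : WithBot ℕ∞) ≤ ringKrullDim A)
    (hrad : maximalIdeal A ≤ (Ideal.ofList qs).radical) :
    RegularMod ⊥ qs ∧ ∃ n, SelfInjectiveDimensionLE (Ideal.ofList qs) n := by
  obtain ⟨n, hn⟩ := hA.finite_injectiveDimension
  have h := (show SelfInjectiveDimensionLE (⊥ : Ideal A) n from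
    hasInjectiveDimensionLE_of_ringEquiv (RingEquiv.quotientBot A).symm hn).regularMod_of_parameters
    bot_le hqs (by rwa [ringKrullDim_eq_of_ringEquiv (RingEquiv.quotientBot A)])
    (by rwa [bot_sup_eq])
  rwa [bot_sup_eq] at h

theorem exists_reductionSystem (hA : IsGorensteinLocal A) (hdim : 0 < ringKrullDim A)
    (Q I : Ideal A) (hQ : IsParameterIdeal Q)
    (hI : I = Submodule.colon Q ((maximalIdeal A ^ 2 : Ideal A) : Set A))
    (hv : haveI := hQ.isLocalRing_quotient; 1 < embDim (A ⧸ Q))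
    (hint : I.IsIntegralOverIdeal Q) :
    ∃ (d : ℕ) (q : ℕ → A), ringKrullDim A = d ∧ Q = initialSpan q d ∧ ReductionSystem I q d := by
  have := hQ.isLocalRing_quotient
  obtain ⟨d, a, hd, hQa, hrad⟩ := hQ
  have hQm : Q ≤ maximalIdeal A := hrad ▸ Ideal.le_radical
  have hIm := hint.le_maximalIdeal hQm
  have hQI : Q ≤ I := by
    rw [hI]
    intro x hx
    rw [Submodule.mem_colon]
    exact fun b _ => Q.mul_mem_right _ hx
  let q : ℕ → A := fun i => if h : i < d then a ⟨i, h⟩ else 0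
  have hqa : ∀ i : Fin d, q i = a i := fun i => by simp [q]
  have hQq : Q = initialSpan q d := by
    rw [hQa, initialSpan]
    congr 1
    ext x
    simp only [Set.mem_range, Set.mem_image, Set.mem_Iio]
    constructor
    · rintro ⟨i, rfl⟩
      exact ⟨i, i.2, hqa i⟩
    · rintro ⟨i, hi, rfl⟩
      exact ⟨⟨i, hi⟩, (hqa ⟨i, hi⟩).symm⟩
  have hqQ : ∀ i < d, q i ∈ Q := fun i hi => hQq ▸ mem_initialSpan q hi
  obtain ⟨hreg, n, hn⟩ := regularMod_bot_of_parameters hA (qs := (List.range d).map q)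
    (by
      intro x hx
      obtain ⟨i, hi, rfl⟩ := List.mem_map.1 hx
      exact hQm (hqQ i (List.mem_range.1 hi)))
    (by simp [hd]) (by rw [ofList_map_range, ← hQq, hrad])
  rw [ofList_map_range, ← hQq] at hn
  have hreg' := regularMod_map_range_iff.1 hreg
  simp only [bot_sup_eq] at hreg'
  -- A system of parameters may be reordered to start with `q i`.
  have hnzd : ∀ i < d, ∀ u, q i * u = 0 → u = 0 := by
    intro i hi u hu
    have h1 := regularMod_bot_of_parameters hA (qs := q i :: ((List.range d).erase i).map q)
      (by
        intro x hx
        rcases List.mem_cons.1 hx with rfl | hx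
        · exact hQm (hqQ i hi)
        · obtain ⟨j, hj, rfl⟩ := List.mem_map.1 hx
          exact hQm (hqQ j (List.mem_range.1 (List.mem_of_mem_erase hj))))
      (by
        have h1 := List.length_erase_add_one (List.mem_range.2 hi)
        rw [List.length_cons, List.length_map, h1]
        simp [hd])
      (by
        rw [← hrad]
        refine Ideal.radical_mono ?_
        rw [hQq]
        refine initialSpan_le fun j hj => Ideal.subset_span ?_
        by_cases hji : j = i
        · subst hji
          exact List.mem_cons_self
        · exact List.mem_cons_of_mem _ (List.mem_map.2
            ⟨j, (List.mem_erase_of_ne hji).2 (List.mem_range.2 hj), rfl⟩))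
    exact h1.1.1 u hu
  have hinj := hn.injective_of_le_radical hQm hrad.ge
  have hdual : ∀ K : Ideal A, Q ≤ K → ∀ x ∉ K, ∃ y, (∀ k ∈ K, k * y ∈ Q) ∧ x * y ∉ Q :=
    fun K hK x hx => exists_mul_notMem_of_injective hQm hK hx
  obtain ⟨N, hN⟩ := hint.exists_pow_succ_le (IsNoetherian.noetherian _) hQI
  have hradI : maximalIdeal A ≤ I.radical := hrad ▸ Ideal.radical_mono hQI
  have hQmI := inf_maximalIdeal_mul_le hd.ge hQa hQm hradI hN
  have hmI := maximalIdeal_mul_sq_le hdual hI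
    (fun a ha => exists_notMem_of_one_lt_embDim hQm hv ha) hQmI
  have h3 := pow_three_le hdual hreg' hQq hIm hQI hI hmI
  refine ⟨d, q, hd, hQq, ?_, hreg', hnzd, hQq ▸ hQI, hIm, hQq ▸ hrad.ge, ?_, ?_, hQq ▸ h3,
    hQq ▸ hint⟩
  · rw [hd] at hdim
    exact_mod_cast hdim
  · rw [← hQq]
    exact inf_pow_succ_le (inf_sq_le hreg' hQq hI hmI) h3
  · rw [← hQq]
    exact inf_maximalIdeal_mul_pow_succ_le hQmI hmI

end Setup

/-! ### Homogeneous ideals and leading forms in the Rees algebra -/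

section ReesGrading

open Polynomial

variable {A : Type*} [CommRing A] {I : Ideal A}

theorem coeff_monomial_mul_eq_ite (N n : ℕ) (b : A) (w : A[X]) :
    (monomial N b * w).coeff n = if N ≤ n then b * w.coeff (n - N) else 0 := by
  rw [← C_mul_X_pow_eq_monomial, mul_assoc, coeff_C_mul, coeff_X_pow_mul', mul_ite, mul_zero]

/-- The homogeneous element `a t ^ n` of the Rees algebra. -/
noncomputable def reesMonomial (n : ℕ) {a : A} (ha : a ∈ I ^ n) : reesAlgebra I :=
  ⟨monomial n a, reesAlgebra.monomial_mem.2 ha⟩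

theorem coeff_mem_pow (u : reesAlgebra I) (n : ℕ) : (u : A[X]).coeff n ∈ I ^ n :=
  (mem_reesAlgebra_iff I (u : A[X])).1 u.2 n

/-- The degree `n` part of an ideal of the Rees algebra, as an ideal of the base ring. -/
def homogeneousPart (K : Ideal (reesAlgebra I)) (n : ℕ) : Ideal A where
  carrier := {c | ∃ v ∈ K, (v : A[X]) = monomial n c}
  zero_mem' := ⟨0, K.zero_mem, by simp⟩
  add_mem' := by
    rintro a b ⟨v, hv, hva⟩ ⟨w, hw, hwb⟩
    exact ⟨v + w, add_mem hv hw, by rw [Subalgebra.coe_add, hva, hwb, map_add]⟩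
  smul_mem' := by
    rintro c a ⟨v, hv, hva⟩
    refine ⟨c • v, ?_, by rw [Subalgebra.coe_smul, hva, smul_monomial]⟩
    rw [Algebra.smul_def]
    exact K.mul_mem_left _ hv

theorem reesMonomial_mem_iff {K : Ideal (reesAlgebra I)} {n : ℕ} {c : A} (hc : c ∈ I ^ n) :
    reesMonomial n hc ∈ K ↔ c ∈ homogeneousPart K n := by
  refine ⟨fun h => ⟨_, h, rfl⟩, ?_⟩
  rintro ⟨v, hv, hvc⟩
  have : reesMonomial n hc = v := Subtype.ext hvc.symm
  rwa [this]

theorem homogeneousPart_mono {K L : Ideal (reesAlgebra I)} (h : K ≤ L) (n : ℕ) :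
    homogeneousPart K n ≤ homogeneousPart L n := by
  rintro c ⟨v, hv, hvc⟩
  exact ⟨v, h hv, hvc⟩

theorem pow_mul_homogeneousPart_le (K : Ideal (reesAlgebra I)) (m n : ℕ) :
    I ^ m * homogeneousPart K n ≤ homogeneousPart K (m + n) := by
  rw [Ideal.mul_le]
  rintro a ha c ⟨v, hv, hvc⟩
  exact ⟨reesMonomial m ha * v, K.mul_mem_left _ hv, by
    rw [Subalgebra.coe_mul, hvc, reesMonomial, monomial_mul_monomial]⟩

theorem mem_of_forall_coeff_mem {K : Ideal (reesAlgebra I)} {u : reesAlgebra I}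
    (h : ∀ n, (u : A[X]).coeff n ∈ homogeneousPart K n) : u ∈ K := by
  have : u = ∑ n ∈ (u : A[X]).support, reesMonomial n (coeff_mem_pow u n) := by
    refine Subtype.ext ?_
    rw [AddSubmonoidClass.coe_finsetSum]
    exact as_sum_support _
  rw [this]
  exact Ideal.sum_mem _ fun n _ => (reesMonomial_mem_iff _).2 (h n)

/-- The ideal of the Rees algebra of all elements whose degree `n` coefficient lies in `W n`. -/
def coeffIdeal (I : Ideal A) (W : ℕ → Ideal A) (hW : ∀ m n, I ^ m * W n ≤ W (m + n)) :
    Ideal (reesAlgebra I) where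
  carrier := {u | ∀ n, (u : A[X]).coeff n ∈ W n}
  zero_mem' := fun n => by simp
  add_mem' := fun {u v} hu hv n => by
    rw [Subalgebra.coe_add, coeff_add]
    exact add_mem (hu n) (hv n)
  smul_mem' := fun r u hu n => by
    rw [smul_eq_mul, Subalgebra.coe_mul, coeff_mul]
    refine Ideal.sum_mem _ fun p hp => ?_
    rw [← Finset.HasAntidiagonal.mem_antidiagonal.1 hp]
    exact hW _ _ (Ideal.mul_mem_mul (coeff_mem_pow r _) (hu _))

/-- An ideal of the Rees algebra is homogeneous if it contains the components of its elements. -/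
def IsReesHomogeneous (K : Ideal (reesAlgebra I)) : Prop :=
  ∀ u ∈ K, ∀ n, (u : A[X]).coeff n ∈ homogeneousPart K n

theorem IsReesHomogeneous.sup {K L : Ideal (reesAlgebra I)} (hK : IsReesHomogeneous K)
    (hL : IsReesHomogeneous L) : IsReesHomogeneous (K ⊔ L) := by
  intro u hu n
  obtain ⟨v, hv, w, hw, rfl⟩ := Submodule.mem_sup.1 hu
  rw [Subalgebra.coe_add, coeff_add]
  exact add_mem (homogeneousPart_mono le_sup_left n (hK v hv n))
    (homogeneousPart_mono le_sup_right n (hL w hw n))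

theorem isReesHomogeneous_span_singleton {h : reesAlgebra I} {N : ℕ} {b : A}
    (hb : (h : A[X]) = monomial N b) : IsReesHomogeneous (Ideal.span {h}) := by
  intro u hu n
  obtain ⟨w, rfl⟩ := Ideal.mem_span_singleton'.1 hu
  rw [Subalgebra.coe_mul, hb, mul_comm, coeff_monomial_mul_eq_ite]
  split_ifs with hn
  · refine ⟨reesMonomial (n - N) (coeff_mem_pow w _) * h,
      Ideal.mul_mem_left _ _ (Ideal.mem_span_singleton_self h), ?_⟩
    rw [Subalgebra.coe_mul, hb, reesMonomial, monomial_mul_monomial, Nat.sub_add_cancel hn, mul_comm b]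
  · exact zero_mem _

/-- `Jh` is the ideal of leading forms of `Jg`. -/
structure IsInitialIdeal (Jg Jh : Ideal (reesAlgebra I)) : Prop where
  isReesHomogeneous : IsReesHomogeneous Jh
  coeff_mem : ∀ u ∈ Jg, ∀ n, (u : A[X]).natDegree ≤ n → (u : A[X]).coeff n ∈ homogeneousPart Jh n
  exists_coeff_eq : ∀ n, ∀ c ∈ homogeneousPart Jh n,
    ∃ u ∈ Jg, (u : A[X]).natDegree ≤ n ∧ (u : A[X]).coeff n = c

theorem IsReesHomogeneous.isInitialIdeal {J : Ideal (reesAlgebra I)} (hJ : IsReesHomogeneous J) :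
    IsInitialIdeal J J where
  isReesHomogeneous := hJ
  coeff_mem := fun u hu n _ => hJ u hu n
  exists_coeff_eq := by
    rintro n c ⟨v, hv, hvc⟩
    exact ⟨v, hv, hvc ▸ natDegree_monomial_le c, by rw [hvc, coeff_monomial_same]⟩

theorem degree_sub_lt_of_coeff_eq {u v : A[X]} {n : ℕ} (hu : u.natDegree ≤ n)
    (hv : v.natDegree ≤ n) (h : v.coeff n = u.coeff n) : (u - v).degree < n := by
  rw [degree_lt_iff_coeff_zero]
  intro k hk
  rcases hk.eq_or_lt with rfl | hk
  · rw [coeff_sub, h, sub_self]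
  · rw [coeff_sub, coeff_eq_zero_of_natDegree_lt (hu.trans_lt hk),
      coeff_eq_zero_of_natDegree_lt (hv.trans_lt hk), sub_self]

theorem natDegree_le_of_degree_lt_succ {u : A[X]} {n : ℕ} (h : u.degree < (n + 1 : ℕ)) :
    u.natDegree ≤ n := by
  rw [degree_lt_iff_coeff_zero] at h
  exact natDegree_le_iff_coeff_eq_zero.2 fun k hk => h k hk

section Step

variable {Jg Jh : Ideal (reesAlgebra I)} {g h : reesAlgebra I} {N : ℕ}

theorem coeff_mem_homogeneousPart_of_regular (hh : (h : A[X]) = monomial N ((g : A[X]).coeff N))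
    (hreg : ∀ u, h * u ∈ Jh → u ∈ Jh) (w : reesAlgebra I) (m : ℕ)
    (hw : (g : A[X]).coeff N * (w : A[X]).coeff m ∈ homogeneousPart Jh (N + m)) :
    (w : A[X]).coeff m ∈ homogeneousPart Jh m := by
  obtain ⟨v, hv, hvc⟩ := hw
  rw [← reesMonomial_mem_iff (coeff_mem_pow w m)]
  refine hreg _ ?_
  have : h * reesMonomial m (coeff_mem_pow w m) = v := by
    refine Subtype.ext ?_
    rw [Subalgebra.coe_mul, hh, hvc, reesMonomial, monomial_mul_monomial]
  rwa [this]

/-- Regularity of `h` makes the top coefficient of `u` the leading coefficient of an element of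
`Jg`. Subtracting that element lowers the degree. -/
theorem IsInitialIdeal.regular (hJ : IsInitialIdeal Jg Jh) (hg : (g : A[X]).natDegree ≤ N)
    (hh : (h : A[X]) = monomial N ((g : A[X]).coeff N))
    (hreg : ∀ u, h * u ∈ Jh → u ∈ Jh) (u : reesAlgebra I) (hu : g * u ∈ Jg) : u ∈ Jg := by
  obtain ⟨n, hn⟩ : ∃ n : ℕ, (u : A[X]).degree < n :=
    ⟨(u : A[X]).natDegree + 1, degree_le_natDegree.trans_lt (by exact_mod_cast Nat.lt_succ_self _)⟩
  induction n generalizing u with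
  | zero =>
    have : u = 0 := Subtype.ext (by
      ext k
      exact (degree_lt_iff_coeff_zero _ _).1 hn k (Nat.zero_le k))
    rw [this]
    exact zero_mem _
  | succ n ih =>
    have hn' := natDegree_le_of_degree_lt_succ hn
    have h1 := hJ.coeff_mem _ hu (N + n) (by
      rw [Subalgebra.coe_mul]
      exact natDegree_mul_le_of_le hg hn')
    rw [Subalgebra.coe_mul, coeff_mul_add_eq_of_natDegree_le hg hn'] at h1
    obtain ⟨v, hv, hv1, hv2⟩ := hJ.exists_coeff_eq n _
      (coeff_mem_homogeneousPart_of_regular hh hreg u n h1)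
    have h2 := ih (u - v) (by rw [mul_sub]; exact sub_mem hu (Jg.mul_mem_left _ hv))
      (by rw [AddSubgroupClass.coe_sub]; exact degree_sub_lt_of_coeff_eq hn' hv1 hv2)
    exact (Submodule.sub_mem_iff_left _ hv).1 h2

/-- No unexpected leading forms arise in `Jg + (g)`: if the top terms of `j` and `g * w` cancel,
regularity of `h` allows `w` to be lowered in degree modulo `Jg`. -/
theorem IsInitialIdeal.sup_span_singleton (hJ : IsInitialIdeal Jg Jh)
    (hg : (g : A[X]).natDegree ≤ N) (hh : (h : A[X]) = monomial N ((g : A[X]).coeff N))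
    (hreg : ∀ u, h * u ∈ Jh → u ∈ Jh) :
    IsInitialIdeal (Jg ⊔ Ideal.span {g}) (Jh ⊔ Ideal.span {h}) where
  isReesHomogeneous := hJ.isReesHomogeneous.sup (isReesHomogeneous_span_singleton hh)
  coeff_mem := by
    intro u hu n hun
    obtain ⟨j, hj, w, rfl⟩ := Ideal.mem_sup_span_singleton_iff.1 hu
    obtain ⟨m, hm⟩ : ∃ m : ℕ, (w : A[X]).degree < m :=
      ⟨(w : A[X]).natDegree + 1,
        degree_le_natDegree.trans_lt (by exact_mod_cast Nat.lt_succ_self _)⟩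
    clear hu
    have hleft := homogeneousPart_mono (le_sup_left : Jh ≤ Jh ⊔ Ideal.span {h})
    induction m generalizing j w with
    | zero =>
      have : w = 0 := Subtype.ext (by
        ext k
        exact (degree_lt_iff_coeff_zero _ _).1 hm k (Nat.zero_le k))
      subst this
      rw [mul_zero, add_zero] at hun ⊢
      exact hleft n (hJ.coeff_mem j hj n hun)
    | succ m ih =>
      have hm' := natDegree_le_of_degree_lt_succ hm
      have hgw : ((g * w : reesAlgebra I) : A[X]).natDegree ≤ N + m := by
        rw [Subalgebra.coe_mul]
        exact natDegree_mul_le_of_le hg hm'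
      have hjeq : (j : A[X]) = ((j + g * w : reesAlgebra I) : A[X]) - (g * w : reesAlgebra I) := by
        simp
      by_cases hmn : N + m ≤ n
      · have hjn : (j : A[X]).natDegree ≤ n := by
          rw [hjeq]
          exact natDegree_sub_le_of_le hun (hgw.trans hmn) |>.trans (by simp)
        rw [Subalgebra.coe_add, coeff_add]
        refine add_mem (hleft n (hJ.coeff_mem j hj n hjn)) ?_
        rcases hmn.eq_or_lt with rfl | hlt
        · rw [Subalgebra.coe_mul, coeff_mul_add_eq_of_natDegree_le hg hm']
          refine ⟨h * reesMonomial m (coeff_mem_pow w m), Ideal.mul_mem_sup_span_singleton _ _ _, ?_⟩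
          rw [Subalgebra.coe_mul, hh, reesMonomial, monomial_mul_monomial]
        · rw [coeff_eq_zero_of_natDegree_lt (hgw.trans_lt hlt)]
          exact zero_mem _
      -- Here the terms in degree `N + m > n` cancel. So the top coefficient of `w` comes from some
      -- `v ∈ Jg`, and `g * v` is moved into `j`.
      · push Not at hmn
        have hjn : (j : A[X]).natDegree ≤ N + m := by
          rw [hjeq]
          exact natDegree_sub_le_of_le (hun.trans hmn.le) hgw |>.trans (by simp)
        have h1 := hJ.coeff_mem j hj (N + m) hjn
        rw [hjeq, coeff_sub, coeff_eq_zero_of_natDegree_lt (hun.trans_lt hmn), zero_sub,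
          Subalgebra.coe_mul, coeff_mul_add_eq_of_natDegree_le hg hm', neg_mem_iff] at h1
        obtain ⟨v, hv, hv1, hv2⟩ := hJ.exists_coeff_eq m _
          (coeff_mem_homogeneousPart_of_regular hh hreg w m h1)
        have h2 : j + g * w = (j + g * v) + g * (w - v) := by ring
        rw [h2] at hun ⊢
        exact ih (j + g * v) (add_mem hj (Jg.mul_mem_left _ hv)) (w - v) hun
          (by rw [AddSubgroupClass.coe_sub]; exact degree_sub_lt_of_coeff_eq hm' hv1 hv2)
  exists_coeff_eq := by
    rintro n c ⟨v, hv, hvc⟩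
    obtain ⟨j, hj, w, rfl⟩ := Ideal.mem_sup_span_singleton_iff.1 hv
    obtain ⟨j', hj', hj1, hj2⟩ := hJ.exists_coeff_eq n _ (hJ.isReesHomogeneous j hj n)
    have hc : c = (j : A[X]).coeff n + ((h * w : reesAlgebra I) : A[X]).coeff n := by
      rw [← coeff_add, ← Subalgebra.coe_add, hvc, coeff_monomial_same]
    rw [Subalgebra.coe_mul, hh, coeff_monomial_mul_eq_ite] at hc
    split_ifs at hc with hn
    · obtain ⟨m, rfl⟩ := Nat.exists_eq_add_of_le hn
      rw [Nat.add_sub_cancel_left] at hc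
      have hm : ((reesMonomial m (coeff_mem_pow w m) : reesAlgebra I) : A[X]).natDegree ≤ m :=
        natDegree_monomial_le _
      refine ⟨j' + g * reesMonomial m (coeff_mem_pow w m),
        Ideal.mem_sup_span_singleton_iff.2 ⟨j', hj', _, rfl⟩, ?_, ?_⟩
      · rw [Subalgebra.coe_add, Subalgebra.coe_mul]
        exact natDegree_add_le_of_degree_le hj1 (natDegree_mul_le_of_le hg hm)
      · rw [Subalgebra.coe_add, coeff_add, Subalgebra.coe_mul,
          coeff_mul_add_eq_of_natDegree_le hg hm, hj2, hc, reesMonomial, coeff_monomial_same]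
    · exact ⟨j', Ideal.mem_sup_left hj', hj1, by rw [hj2, hc, add_zero]⟩

end Step

/-- A sequence in the Rees algebra is regular if its sequence of leading forms is. -/
theorem IsInitialIdeal.regularMod {ι : Type*} {Jg Jh : Ideal (reesAlgebra I)}
    (hJ : IsInitialIdeal Jg Jh) {g h : ι → reesAlgebra I} {N : ι → ℕ} {l : List ι}
    (hg : ∀ i ∈ l, (g i : A[X]).natDegree ≤ N i)
    (hh : ∀ i ∈ l, (h i : A[X]) = monomial (N i) ((g i : A[X]).coeff (N i)))
    (hreg : RegularMod Jh (l.map h)) : RegularMod Jg (l.map g) := by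
  induction l generalizing Jg Jh with
  | nil => trivial
  | cons i l ih =>
    have hgi := hg i (by simp)
    have hhi := hh i (by simp)
    exact ⟨hJ.regular hgi hhi hreg.1, ih (hJ.sup_span_singleton hgi hhi hreg.1)
      (fun j hj => hg j (by simp [hj])) (fun j hj => hh j (by simp [hj])) hreg.2⟩

end ReesGrading

/-! ### Integrality over the reduction and degreewise membership -/

section IntegralOverReduction

theorem Ideal.isMaximal_of_isIntegral_quotient {A R : Type*} [CommRing A] [CommRing R] [Algebra A R]
    (P : Ideal R) [P.IsPrime] (h : ∀ u : R, IsIntegral A (Ideal.Quotient.mk P u))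
    (hmax : (P.comap (algebraMap A R)).IsMaximal) : P.IsMaximal := by
  have hint : (algebraMap A (R ⧸ P)).IsIntegral := fun y => by
    obtain ⟨u, rfl⟩ := Ideal.Quotient.mk_surjective y
    exact h u
  have hcomap : (⊥ : Ideal (R ⧸ P)).comap (algebraMap A (R ⧸ P)) = P.comap (algebraMap A R) := by
    ext a
    rw [Ideal.mem_comap, Ideal.mem_bot, Ideal.mem_comap, ← Ideal.Quotient.eq_zero_iff_mem]
    rfl
  have hbot : (⊥ : Ideal (R ⧸ P)).IsMaximal :=
    Ideal.isMaximal_of_isIntegral_of_isMaximal_comap' _ hint _ (by rwa [hcomap])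
  have hP := Ideal.comap_isMaximal_of_surjective (Ideal.Quotient.mk P)
    Ideal.Quotient.mk_surjective (K := ⊥)
  rwa [← RingHom.ker_eq_comap_bot, Ideal.mk_ker] at hP

open Polynomial

variable {A : Type*} [CommRing A] {I : Ideal A} {q : ℕ → A} {d : ℕ}

/-- An equation of `y ∈ I` over `Q` becomes, once its terms carry the right powers of `t`, a monic
equation of `y t` over `A[Qt]`. The images of elements of `A[Qt]` are integral over `A` as soon as
those of the `q j t` are; transitivity concludes. -/
theorem Ideal.IsIntegralOverIdeal.isIntegral_of_forall (hint : I.IsIntegralOverIdeal (initialSpan q d))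
    {B : Type*} [CommRing B] [Algebra A B] (φ : reesAlgebra I →ₐ[A] B) {X : ℕ → reesAlgebra I}
    (hX : ∀ j < d, (X j : A[X]) = monomial 1 (q j)) (h : ∀ j < d, IsIntegral A (φ (X j)))
    (u : reesAlgebra I) : IsIntegral A (φ u) := by
  let T : ℕ → Ideal A := fun i =>
    { carrier := {c | ∃ v : reesAlgebra I, (v : A[X]) = monomial i c ∧ IsIntegral A (φ v)}
      zero_mem' := ⟨0, by simp, by rw [map_zero]; exact isIntegral_zero⟩
      add_mem' := by
        rintro a b ⟨v, hv, hv'⟩ ⟨w, hw, hw'⟩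
        exact ⟨v + w, by rw [Subalgebra.coe_add, hv, hw, map_add], by
          rw [map_add]; exact hv'.add hw'⟩
      smul_mem' := by
        rintro a b ⟨v, hv, hv'⟩
        exact ⟨a • v, by rw [Subalgebra.coe_smul, hv, smul_monomial], by
          rw [map_smul]; exact hv'.smul a⟩ }
  have hT : ∀ i, initialSpan q d ^ i ≤ T i := by
    intro i
    induction i with
    | zero =>
      rw [pow_zero, Ideal.one_eq_top, top_le_iff, Ideal.eq_top_iff_one]
      exact ⟨1, by simp, by rw [map_one]; exact isIntegral_one⟩
    | succ i ih =>
      rw [pow_succ, Ideal.mul_le]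
      rintro a ha b hb
      obtain ⟨v, hv, hv'⟩ := ih ha
      have hQ : initialSpan q d ≤ T 1 := initialSpan_le fun j hj => ⟨X j, hX j hj, h j hj⟩
      obtain ⟨w, hw, hw'⟩ := hQ hb
      exact ⟨v * w, by rw [Subalgebra.coe_mul, hv, hw, monomial_mul_monomial], by
        rw [map_mul]; exact hv'.mul hw'⟩
  have key : ∀ x ∈ Algebra.adjoin A ((Submodule.map (monomial 1) I : Submodule A A[X]) : Set A[X]),
      ∀ hx : x ∈ reesAlgebra I, IsIntegral A (φ ⟨x, hx⟩) := by
    intro x hx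
    induction hx using Algebra.adjoin_induction with
    | mem x hx =>
      obtain ⟨y, hy, rfl⟩ := hx
      intro hx
      obtain ⟨n, c, hn, hc, hyc⟩ := hint y hy
      choose v hv hv' using fun i => hT i (hc i)
      set z : reesAlgebra I := ⟨monomial 1 y, hx⟩ with hz
      have hrel : z ^ n + ∑ i ∈ Finset.Icc 1 n, v i * z ^ (n - i) = 0 := by
        refine Subtype.ext ?_
        rw [Subalgebra.coe_add, AddSubmonoidClass.coe_finsetSum, Subalgebra.coe_zero,
          ← map_zero (monomial n), ← hyc, map_add, map_sum]
        congr 1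
        · rw [Subalgebra.coe_pow, hz, monomial_pow, one_mul]
        · refine Finset.sum_congr rfl fun i hi => ?_
          rw [Subalgebra.coe_mul, hv, Subalgebra.coe_pow, hz, monomial_pow, one_mul,
            monomial_mul_monomial, Nat.add_sub_cancel' (Finset.mem_Icc.1 hi).2]
      let w : ℕ → integralClosure A B := fun i => ⟨φ (v i), hv' i⟩
      refine isIntegral_trans (A := integralClosure A B) _
        ⟨Polynomial.X ^ n + ∑ i ∈ Finset.Icc 1 n, C (w i) * Polynomial.X ^ (n - i), ?_, ?_⟩
      · refine monic_X_pow_add ?_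
        rw [← mem_degreeLT]
        refine Submodule.sum_mem _ fun i hi => ?_
        rw [mem_degreeLT]
        refine (degree_C_mul_X_pow_le _ _).trans_lt ?_
        have := Finset.mem_Icc.1 hi
        exact_mod_cast (by omega : n - i < n)
      · rw [eval₂_add, eval₂_finsetSum, eval₂_X_pow]
        have h1 := congrArg φ hrel
        rw [map_add, map_sum, map_zero, map_pow] at h1
        rw [← h1]
        congr 1
        refine Finset.sum_congr rfl fun i _ => ?_
        rw [eval₂_mul, eval₂_C, eval₂_X_pow, map_mul, map_pow]
        rfl
    | algebraMap r =>
      intro hx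
      have : (⟨algebraMap A A[X] r, hx⟩ : reesAlgebra I) = algebraMap A (reesAlgebra I) r := rfl
      rw [this, AlgHom.commutes]
      exact isIntegral_algebraMap
    | add x y hx hy ihx ihy =>
      intro hxy
      rw [adjoin_monomial_eq_reesAlgebra] at hx hy
      have : (⟨x + y, hxy⟩ : reesAlgebra I) = ⟨x, hx⟩ + ⟨y, hy⟩ := rfl
      rw [this, map_add]
      exact (ihx hx).add (ihy hy)
    | mul x y hx hy ihx ihy =>
      intro hxy
      rw [adjoin_monomial_eq_reesAlgebra] at hx hy
      have : (⟨x * y, hxy⟩ : reesAlgebra I) = ⟨x, hx⟩ * ⟨y, hy⟩ := rfl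
      rw [this, map_mul]
      exact (ihx hx).mul (ihy hy)
  exact key u ((adjoin_monomial_eq_reesAlgebra I).symm ▸ u.2) u.2

theorem coeff_aeval_of_eq_monomial_one {x : reesAlgebra I} {a : A} (hx : (x : A[X]) = monomial 1 a)
    (f : A[X]) (n : ℕ) : ((aeval x f : reesAlgebra I) : A[X]).coeff n = f.coeff n * a ^ n := by
  have h1 : ((aeval x f : reesAlgebra I) : A[X]) = aeval (x : A[X]) f :=
    (aeval_algHom_apply (reesAlgebra I).val x f).symm
  rw [h1, hx, aeval_eq_sum_range, finsetSum_coeff]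
  simp only [monomial_pow, one_mul, smul_monomial, smul_eq_mul, coeff_monomial]
  by_cases hn : n ≤ f.natDegree
  · rw [Finset.sum_ite_eq' ]
    simp [hn]
  · rw [coeff_eq_zero_of_natDegree_lt (by omega), zero_mul]
    refine Finset.sum_eq_zero fun i hi => if_neg ?_
    have := Finset.mem_range.1 hi
    omega

theorem mul_pow_le_homogeneousPart_map (𝔞 : Ideal A) (n : ℕ) :
    𝔞 * I ^ n ≤ homogeneousPart (𝔞.map (algebraMap A (reesAlgebra I))) n := by
  have h0 : 𝔞 ≤ homogeneousPart (𝔞.map (algebraMap A (reesAlgebra I))) 0 :=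
    fun a ha => ⟨algebraMap A _ a, Ideal.mem_map_of_mem _ ha, rfl⟩
  rw [mul_comm]
  exact (Ideal.mul_mono_right h0).trans (pow_mul_homogeneousPart_le _ n 0)

/-- Both ideals are homogeneous with evident components. In degree zero the exponent `n - 1`
truncates, but the extra summand is contained in `𝔞`. -/
theorem mem_map_sup_initialSpan_iff {X : ℕ → reesAlgebra I}
    (hX : ∀ j < d, (X j : A[X]) = monomial 1 (q j)) {𝔞 : Ideal A} (h𝔞 : initialSpan q d ≤ 𝔞) {i : ℕ}
    (hi : i ≤ d) (u : reesAlgebra I) :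
    u ∈ 𝔞.map (algebraMap A (reesAlgebra I)) ⊔ initialSpan X i ↔
      ∀ n, (u : A[X]).coeff n ∈ 𝔞 * I ^ n ⊔ initialSpan q i * I ^ (n - 1) := by
  have hqi : initialSpan q i ≤ 𝔞 := (initialSpan_mono q hi).trans h𝔞
  constructor
  · let W : ℕ → Ideal A := fun n => 𝔞 * I ^ n ⊔ initialSpan q i * I ^ (n - 1)
    have hW : ∀ m n, I ^ m * W n ≤ W (m + n) := by
      intro m n
      rw [Ideal.mul_sup]
      refine sup_le ?_ ?_
      · rw [mul_left_comm, ← pow_add]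
        exact le_sup_left
      · rcases n with _ | n
        · simp only [zero_tsub, pow_zero, mul_one, add_zero]
          rw [mul_comm]
          exact (Ideal.mul_mono_left hqi).trans le_sup_left
        · rw [mul_left_comm, ← pow_add]
          exact le_sup_right
    suffices hle : 𝔞.map (algebraMap A (reesAlgebra I)) ⊔ initialSpan X i ≤ coeffIdeal I W hW from
      fun hu => hle hu
    refine sup_le (Ideal.map_le_iff_le_comap.2 fun a ha => ?_) (initialSpan_le fun j hj => ?_)
    · intro n
      change (C a).coeff n ∈ _
      rw [coeff_C]
      split_ifs with hn
      · subst hn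
        exact Ideal.mem_sup_left (by simpa using ha)
      · exact zero_mem _
    · intro n
      rw [hX j (hj.trans_le hi), coeff_monomial]
      split_ifs with hn
      · subst hn
        exact Ideal.mem_sup_right (by simpa using mem_initialSpan q hj)
      · exact zero_mem _
  · intro hu
    refine mem_of_forall_coeff_mem fun n => ?_
    refine (?_ : 𝔞 * I ^ n ⊔ initialSpan q i * I ^ (n - 1) ≤ _) (hu n)
    have h1 := (mul_pow_le_homogeneousPart_map 𝔞 n).trans (homogeneousPart_mono
      (le_sup_left : _ ≤ 𝔞.map (algebraMap A (reesAlgebra I)) ⊔ initialSpan X i) n)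
    refine sup_le h1 ?_
    rcases n with _ | n
    · refine le_trans ?_ h1
      simpa using hqi
    · have h2 : initialSpan q i ≤
          homogeneousPart (𝔞.map (algebraMap A (reesAlgebra I)) ⊔ initialSpan X i) 1 :=
        initialSpan_le fun j hj => ⟨X j, Ideal.mem_sup_right (mem_initialSpan X hj),
          hX j (hj.trans_le hi)⟩
      rw [mul_comm, Nat.add_sub_cancel]
      exact (Ideal.mul_mono_right h2).trans (pow_mul_homogeneousPart_le _ n 1)

theorem isReesHomogeneous_map (𝔞 : Ideal A) :
    IsReesHomogeneous (𝔞.map (algebraMap A (reesAlgebra I))) := by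
  have hW : ∀ m n, I ^ m * (𝔞 * I ^ n) ≤ 𝔞 * I ^ (m + n) := fun m n => by
    rw [mul_left_comm, ← pow_add]
  have h1 : 𝔞.map (algebraMap A (reesAlgebra I)) ≤ coeffIdeal I (fun n => 𝔞 * I ^ n) hW := by
    refine Ideal.map_le_iff_le_comap.2 fun a ha n => ?_
    change (C a).coeff n ∈ _
    rw [coeff_C]
    split_ifs with hn
    · subst hn
      simpa using ha
    · exact zero_mem _
  exact fun u hu n => mul_pow_le_homogeneousPart_map 𝔞 n (h1 hu n)

end IntegralOverReduction

/-! ### Cohen–Macaulay quotients `R(I) ⧸ 𝔞 R(I)` -/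

section QuotientOfRees

open Polynomial

variable {A : Type u} [CommRing A] [IsLocalRing A] {I : Ideal A}

/-- Over a local ring, a maximal ideal of the Rees algebra containing the maximal ideal of the base
contains a monic polynomial in each element. -/
theorem exists_monic_aeval_mem [IsNoetherianRing A] (M : Ideal (reesAlgebra I)) [M.IsMaximal]
    (hM : maximalIdeal A ≤ M.comap (algebraMap A (reesAlgebra I))) (x : reesAlgebra I) :
    ∃ f : A[X], f.Monic ∧ aeval x f ∈ M := by
  let _ : Field (A ⧸ maximalIdeal A) := Ideal.Quotient.field _
  let _ : Field (reesAlgebra I ⧸ M) := Ideal.Quotient.field _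
  let _ : Algebra (A ⧸ maximalIdeal A) (reesAlgebra I ⧸ M) :=
    Ideal.Quotient.algebraQuotientOfLEComap hM
  have : IsScalarTower A (A ⧸ maximalIdeal A) (reesAlgebra I ⧸ M) :=
    IsScalarTower.of_algebraMap_eq' rfl
  have hft : Algebra.FiniteType A (reesAlgebra I) :=
    Subalgebra.fg_iff_finiteType _ |>.1 (reesAlgebra.fg (IsNoetherian.noetherian I))
  have hft' : Algebra.FiniteType A (reesAlgebra I ⧸ M) :=
    hft.of_surjective (Ideal.Quotient.mkₐ A M) (Ideal.Quotient.mkₐ_surjective A M)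
  have : Algebra.FiniteType (A ⧸ maximalIdeal A) (reesAlgebra I ⧸ M) :=
    Algebra.FiniteType.of_restrictScalars_finiteType A _ _
  -- Zariski's lemma: the residue field at `M` is finite over that of `A`.
  have hfin := finite_of_finite_type_of_isJacobsonRing (A ⧸ maximalIdeal A) (reesAlgebra I ⧸ M)
  have : Algebra.IsIntegral A (A ⧸ maximalIdeal A) :=
    ⟨fun y => by
      obtain ⟨a, rfl⟩ := Ideal.Quotient.mk_surjective y
      exact isIntegral_algebraMap (R := A) (A := A ⧸ maximalIdeal A) (x := a)⟩
  have hint : IsIntegral A (Ideal.Quotient.mk M x) :=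
    isIntegral_trans (A := A ⧸ maximalIdeal A) _ (IsIntegral.of_finite (A ⧸ maximalIdeal A) _)
  obtain ⟨f, hf, hfx⟩ := hint
  refine ⟨f, hf, ?_⟩
  rw [← Ideal.Quotient.eq_zero_iff_mem, ← hfx, aeval_def, hom_eval₂]
  rfl

/-- Taking `𝔞 = I` gives the associated graded ring and `𝔞 = 𝔪` the fiber cone. -/
theorem ReductionSystem.regularMod
    {q : ℕ → A} {d : ℕ} (h : ReductionSystem I q d) {X : ℕ → reesAlgebra I}
    (hX : ∀ j < d, (X j : A[X]) = monomial 1 (q j)) {𝔞 : Ideal A} (h𝔞 : initialSpan q d ≤ 𝔞)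
    (hVV : ∀ n, initialSpan q d ⊓ 𝔞 * I ^ (n + 1) ≤ initialSpan q d * (𝔞 * I ^ n)) :
    RegularMod (𝔞.map (algebraMap A (reesAlgebra I))) ((List.range d).map X) := by
  rw [regularMod_map_range_iff]
  intro i hi u hu
  rw [mem_map_sup_initialSpan_iff hX h𝔞 hi.le] at hu ⊢
  intro n
  refine mem_of_mul_mem_sup h.regular h.le h𝔞 h.inf_pow_le hVV hi (coeff_mem_pow u n) ?_
  have := hu (n + 1)
  rwa [Subalgebra.coe_mul, hX i hi, coeff_monomial_mul_eq_ite, if_pos (by omega),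
    Nat.add_sub_cancel] at this

/-- At each maximal ideal `M` containing the maximal ideal of `A`, there is a sequence of length `d`
in `M` that is regular on `R(I) ⧸ 𝔞 R(I)` and over which `M` is minimal. -/
theorem ReductionSystem.exists_regularMod_map [IsNoetherianRing A]
    {q : ℕ → A} {d : ℕ} (h : ReductionSystem I q d) {X : ℕ → reesAlgebra I}
    (hX : ∀ j < d, (X j : A[X]) = monomial 1 (q j)) {𝔞 : Ideal A}
    (h𝔞 : initialSpan q d ≤ 𝔞)
    (hVV : ∀ n, initialSpan q d ⊓ 𝔞 * I ^ (n + 1) ≤ initialSpan q d * (𝔞 * I ^ n))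
    (M : Ideal (reesAlgebra I)) [M.IsMaximal] (h𝔞M : 𝔞.map (algebraMap A (reesAlgebra I)) ≤ M) :
    ∃ gs : List (reesAlgebra I), (∀ g ∈ gs, g ∈ M) ∧
      RegularMod (𝔞.map (algebraMap A (reesAlgebra I))) gs ∧
      M ∈ (𝔞.map (algebraMap A (reesAlgebra I)) ⊔ Ideal.ofList gs).minimalPrimes := by
  have hcomap : ∀ P : Ideal (reesAlgebra I), P.IsPrime →
      𝔞.map (algebraMap A (reesAlgebra I)) ≤ P →
      maximalIdeal A ≤ P.comap (algebraMap A (reesAlgebra I)) := by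
    intro P hP hle
    refine h.le_radical.trans ((Ideal.radical_mono h𝔞).trans ?_)
    rw [Ideal.IsPrime.radical_le_iff inferInstance]
    exact Ideal.map_le_iff_le_comap.1 hle
  have hMm := hcomap M inferInstance h𝔞M
  choose f hf hfM using fun j => exists_monic_aeval_mem M hMm (X j)
  have hgs : ∀ g ∈ (List.range d).map fun j => aeval (X j) (f j), g ∈ M := by
    intro g hg
    obtain ⟨j, -, rfl⟩ := List.mem_map.1 hg
    exact hfM j
  have hreg : RegularMod (𝔞.map (algebraMap A (reesAlgebra I)))
      ((List.range d).map fun j => aeval (X j) (f j)) := by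
    -- As `f j` is monic, the leading form of `aeval (X j) (f j)` is `X j ^ natDegree`.
    refine (isReesHomogeneous_map 𝔞).isInitialIdeal.regularMod
      (h := fun j => X j ^ (f j).natDegree) (N := fun j => (f j).natDegree) (fun j hj => ?_)
      (fun j hj => ?_) (regularMod_pow _ (h.regularMod hX h𝔞 hVV))
    · refine natDegree_le_iff_coeff_eq_zero.2 fun k hk => ?_
      rw [coeff_aeval_of_eq_monomial_one (hX j (List.mem_range.1 hj)),
        coeff_eq_zero_of_natDegree_lt hk, zero_mul]
    · rw [coeff_aeval_of_eq_monomial_one (hX j (List.mem_range.1 hj)), Subalgebra.coe_pow,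
        hX j (List.mem_range.1 hj), monomial_pow, one_mul, (hf j).coeff_natDegree, one_mul]
  refine ⟨_, hgs, hreg, ⟨⟨inferInstance, sup_le h𝔞M (Ideal.span_le.2 hgs)⟩, ?_⟩⟩
  rintro P ⟨hP, hle⟩ hPM
  have hPm := (maximalIdeal.isMaximal A).eq_of_le (Ideal.IsPrime.ne_top inferInstance)
    (hcomap P hP (le_sup_left.trans hle))
  -- Modulo `P` each `X j` is a root of `f j`, so `R ⧸ P` is integral over `A`, and `P` lies over
  -- `𝔪`. Hence `P` is maximal and equal to `M`.
  have hint : ∀ u, IsIntegral A (Ideal.Quotient.mk P u) := fun u => by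
    refine h.isIntegral.isIntegral_of_forall (B := reesAlgebra I ⧸ P) (Ideal.Quotient.mkₐ A P) hX
      (fun j hj => ?_) u
    refine ⟨f j, hf j, ?_⟩
    have h1 : aeval (X j) (f j) ∈ P :=
      hle (Ideal.mem_sup_right (Ideal.subset_span (List.mem_map.2 ⟨j, List.mem_range.2 hj, rfl⟩)))
    rw [← aeval_def, aeval_algHom_apply]
    exact Ideal.Quotient.eq_zero_iff_mem.2 h1
  have hPmax := P.isMaximal_of_isIntegral_quotient hint (hPm ▸ maximalIdeal.isMaximal A)
  exact (hPmax.eq_of_le (Ideal.IsPrime.ne_top inferInstance) hPM).ge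

/-- A criterion for a quotient of a ring to be Cohen-Macaulay. -/
theorem isCohenMacaulay_of_surjective {R E : Type*} [CommRing R] [CommRing E] [IsNoetherianRing R]
    {J : Ideal R} (φ : R →+* E) (hφ : Function.Surjective φ) (hker : RingHom.ker φ = J)
    (h : ∀ M : Ideal R, M.IsMaximal → J ≤ M → ∃ xs : List R, LocallyRegularMod M J xs ∧
      M ∈ (J ⊔ Ideal.ofList xs).minimalPrimes) : IsCohenMacaulay E := by
  refine ⟨isNoetherianRing_of_surjective _ _ φ hφ, fun M' _ => ?_⟩
  have hmax : (M'.comap φ).IsMaximal := Ideal.comap_isMaximal_of_surjective φ hφ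
  have hle : J ≤ M'.comap φ := hker ▸ (by
    rw [RingHom.ker_eq_comap_bot]
    exact Ideal.comap_mono bot_le)
  obtain ⟨xs, h1, h2⟩ := h _ hmax hle
  refine isCohenMacaulayLocal_of_locallyRegularMod (M := M'.comap φ) (J := J)
    ((algebraMap E (Localization.AtPrime M')).comp φ) ?_ ?_ ?_ xs h1 h2
  · intro s hs
    exact (IsLocalization.AtPrime.isUnit_to_map_iff _ M' (φ s)).2 hs
  · intro y
    obtain ⟨⟨r, s⟩, hrs⟩ := IsLocalization.surj M'.primeCompl y
    obtain ⟨r, rfl⟩ := hφ r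
    obtain ⟨s', hs'⟩ := hφ s
    refine ⟨r, s', ?_, ?_⟩
    · rw [Ideal.mem_comap, hs']
      exact s.2
    · rw [RingHom.comp_apply, hs', hrs]
      rfl
  · intro r
    rw [RingHom.comp_apply, IsLocalization.map_eq_zero_iff M'.primeCompl]
    constructor
    · rintro ⟨s, hs⟩
      obtain ⟨s', hs'⟩ := hφ s
      refine ⟨s', ?_, ?_⟩
      · rw [Ideal.mem_comap, hs']
        exact s.2
      · rw [← hker, RingHom.mem_ker, map_mul, hs', hs]
    · rintro ⟨s, hs, hsr⟩
      refine ⟨⟨φ s, hs⟩, ?_⟩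
      rw [← map_mul, ← RingHom.mem_ker, hker]
      exact hsr

end QuotientOfRees

/-! ### A regular sequence at the homogeneous maximal ideal of `R(I)` -/

section ParametersOfRees

open Polynomial

variable {A : Type*} [CommRing A] {I : Ideal A}

theorem mul_eq_algebraMap_mul_of_eq_X_mul {x v v' : reesAlgebra I} {b : A}
    (hx : (x : A[X]) = monomial 1 b) (hv : (v' : A[X]) = Polynomial.X * (v : A[X])) :
    x * v = algebraMap A (reesAlgebra I) b * v' := by
  refine Subtype.ext ?_
  change (x : A[X]) * v = C b * v'
  rw [hx, hv, ← C_mul_X_eq_monomial, mul_assoc]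

theorem initialSpan_mul_le {q : ℕ → A} {i : ℕ} {J T : Ideal A}
    (h : ∀ l < i, ∀ a ∈ J, q l * a ∈ T) : initialSpan q i * J ≤ T := by
  rw [Ideal.mul_le]
  intro r hr a ha
  have : initialSpan q i ≤ Submodule.colon T (J : Set A) :=
    initialSpan_le fun l hl => Submodule.mem_colon.2 fun a ha => h l hl a ha
  exact Submodule.mem_colon.1 (this hr) a ha

/-- The elements of the Rees algebra with all coefficients in `J`. -/
def coeffwiseIdeal (I J : Ideal A) : Ideal (reesAlgebra I) :=
  coeffIdeal I (fun _ => J) fun _ _ => Ideal.mul_le_right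

theorem mem_coeffwiseIdeal {J : Ideal A} {u : reesAlgebra I} :
    u ∈ coeffwiseIdeal I J ↔ ∀ n, (u : A[X]).coeff n ∈ J := Iff.rfl

theorem mem_homogeneousPart_coeffwiseIdeal {J : Ideal A} {n : ℕ} {c : A} (hcJ : c ∈ J)
    (hc : c ∈ I ^ n) : c ∈ homogeneousPart (coeffwiseIdeal I J) n := by
  refine ⟨reesMonomial n hc, fun m => ?_, rfl⟩
  rw [reesMonomial, coeff_monomial]
  split_ifs
  · exact hcJ
  · exact zero_mem _

/-- The elements of the Rees algebra whose degree `n` coefficient lies in `I ^ (n + k)`. -/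
def shiftIdeal (I : Ideal A) (k : ℕ) : Ideal (reesAlgebra I) :=
  coeffIdeal I (fun n => I ^ (n + k)) fun m n => by rw [← pow_add, add_assoc]

theorem mem_homogeneousPart_shiftIdeal {k n : ℕ} {c : A} (hc : c ∈ I ^ (n + k)) :
    c ∈ homogeneousPart (shiftIdeal I k) n := by
  refine ⟨reesMonomial n (Ideal.pow_le_pow_right (Nat.le_add_right n k) hc), fun m => ?_, rfl⟩
  rw [reesMonomial, coeff_monomial]
  split_ifs with h
  · exact h ▸ hc
  · exact zero_mem _

theorem exists_eq_X_pow_mul {k : ℕ} {u : reesAlgebra I} (hu : u ∈ shiftIdeal I k) :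
    ∃ v : reesAlgebra I, (v : A[X]) = Polynomial.X ^ k * (u : A[X]) := by
  refine ⟨⟨Polynomial.X ^ k * (u : A[X]), (mem_reesAlgebra_iff _ _).2 fun n => ?_⟩, rfl⟩
  rw [coeff_X_pow_mul']
  split_ifs with h
  · have : (u : A[X]).coeff (n - k) ∈ I ^ (n - k + k) := hu (n - k)
    rwa [Nat.sub_add_cancel h] at this
  · exact zero_mem _

variable (q : ℕ → A) (X : ℕ → reesAlgebra I)

/-- The sequence `q 0, q 1 - q 0 t, q 2 - q 1 t, …` in the Rees algebra, where `X i = q i t`. -/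
noncomputable def reesParameter : ℕ → reesAlgebra I
  | 0 => algebraMap A _ (q 0)
  | l + 1 => algebraMap A _ (q (l + 1)) - X l

/-- The generators `q i, q (i + 1) - q i t, q (i + 2) - q (i + 1) t, …`. -/
noncomputable def partialParameter (i m : ℕ) : reesAlgebra I :=
  if m = 0 then algebraMap A _ (q i) else reesParameter q X (i + m)

/-- The ideal generated by the elements with all coefficients in `(q 0, …, q (i - 1))` and by
`q i, q (i + 1) - q i t, …, q (i + m - 1) - q (i + m - 2) t`. -/
noncomputable def partialIdeal (i m : ℕ) : Ideal (reesAlgebra I) :=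
  coeffwiseIdeal I (initialSpan q i) ⊔ initialSpan (partialParameter q X i) m

variable {q X}

theorem partialIdeal_succ (i m : ℕ) :
    partialIdeal q X i (m + 1) = partialIdeal q X i m ⊔ Ideal.span {partialParameter q X i m} := by
  rw [partialIdeal, partialIdeal, initialSpan_succ, sup_assoc]

theorem partialIdeal_zero (i : ℕ) :
    partialIdeal q X i 0 = coeffwiseIdeal I (initialSpan q i) := by
  rw [partialIdeal, initialSpan_zero, sup_bot_eq]

theorem partialIdeal_mono (i : ℕ) {m n : ℕ} (h : m ≤ n) :
    partialIdeal q X i m ≤ partialIdeal q X i n :=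
  sup_le_sup_left (initialSpan_mono _ h) _

theorem algebraMap_mem_partialIdeal (i m : ℕ) :
    algebraMap A (reesAlgebra I) (q i) ∈ partialIdeal q X i (m + 1) :=
  Ideal.mem_sup_right (mem_initialSpan (partialParameter q X i) m.succ_pos)

theorem reesParameter_mem_partialIdeal (i : ℕ) {l m : ℕ} (h : l < m) :
    reesParameter q X (i + l + 1) ∈ partialIdeal q X i (m + 1) :=
  Ideal.mem_sup_right (mem_initialSpan (partialParameter q X i) (Nat.succ_lt_succ h))

theorem initialSpan_reesParameter (m : ℕ) :
    partialIdeal q X 0 m = initialSpan (reesParameter q X) m := by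
  have h0 : coeffwiseIdeal I (initialSpan q 0) = ⊥ := by
    rw [eq_bot_iff]
    intro u hu
    rw [Ideal.mem_bot]
    refine Subtype.ext (Polynomial.ext fun n => ?_)
    have := mem_coeffwiseIdeal.1 hu n
    rwa [initialSpan_zero, Ideal.mem_bot] at this
  have h1 : partialParameter q X 0 = reesParameter q X := by
    funext m
    rw [partialParameter]
    split_ifs with h
    · subst h
      rfl
    · rw [zero_add]
  rw [partialIdeal, h0, h1, bot_sup_eq]

variable {d : ℕ}

theorem X_mem_coeffwiseIdeal (hX : ∀ j < d, (X j : A[X]) = monomial 1 (q j)) {i l : ℕ} (hl : l < i)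
    (hi : i ≤ d) : X l ∈ coeffwiseIdeal I (initialSpan q i) := by
  intro n
  rw [hX l (hl.trans_le hi), coeff_monomial]
  split_ifs
  · exact mem_initialSpan q hl
  · exact zero_mem _

/-- In degree `n + 1`, a coefficient lies in `(q 0, …, q i) ∩ I^(n+1) = (q 0, …, q i) I^n`, so its
`q i`-part is a multiple of `q i t`. In degree zero it needs `q i` itself. -/
theorem ReductionSystem.coeffwiseIdeal_succ [IsLocalRing A] (h : ReductionSystem I q d)
    (hX : ∀ j < d, (X j : A[X]) = monomial 1 (q j)) {i : ℕ} (hi : i < d) :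
    coeffwiseIdeal I (initialSpan q i) ⊔ Ideal.span {algebraMap A (reesAlgebra I) (q i)} ⊔
      Ideal.span {X i} = coeffwiseIdeal I (initialSpan q (i + 1)) := by
  refine le_antisymm (sup_le (sup_le ?_ ?_) ?_) fun u hu => ?_
  · exact fun u hu n => initialSpan_mono q i.le_succ (hu n)
  · rw [Ideal.span_singleton_le_iff_mem]
    intro n
    change (C (q i)).coeff n ∈ _
    rw [coeff_C]
    split_ifs
    · exact mem_initialSpan q i.lt_succ_self
    · exact zero_mem _
  · rw [Ideal.span_singleton_le_iff_mem]
    exact X_mem_coeffwiseIdeal hX i.lt_succ_self hi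
  · refine mem_of_forall_coeff_mem fun n => ?_
    have hun := hu n
    have huI := coeff_mem_pow u n
    have hqI : initialSpan q i ≤ I := (initialSpan_mono q hi.le).trans h.le
    have hle : coeffwiseIdeal I (initialSpan q i) ≤ coeffwiseIdeal I (initialSpan q i) ⊔
        Ideal.span {algebraMap A (reesAlgebra I) (q i)} ⊔ Ideal.span {X i} :=
      le_sup_left.trans le_sup_left
    rcases n with _ | n
    · rw [initialSpan_succ, Ideal.mem_sup_span_singleton_iff] at hun
      obtain ⟨j, hj, w, hw⟩ := hun
      rw [hw]
      refine add_mem (homogeneousPart_mono hle _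
        (mem_homogeneousPart_coeffwiseIdeal hj (by simp))) ?_
      refine ⟨algebraMap A _ (q i) * algebraMap A _ w, Ideal.mem_sup_left (Ideal.mem_sup_right
        (Ideal.mul_mem_right _ _ (Ideal.mem_span_singleton_self _))), ?_⟩
      rw [← map_mul]
      rfl
    · have h1 : (u : A[X]).coeff (n + 1) ∈ initialSpan q (i + 1) * I ^ n :=
        initialSpan_inf_le h.regular (L := fun n => I ^ n) (by simp) (fun j hj n x hx => by
          rw [pow_succ']
          exact Ideal.mul_mem_mul (h.le (mem_initialSpan q hj)) hx) h.inf_pow_le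
          (Nat.succ_le_of_lt hi) n (Ideal.mem_inf.2 ⟨hun, huI⟩)
      obtain ⟨y, hy, w, hw, hyw⟩ := mem_initialSpan_succ_mul.1 h1
      rw [hyw]
      refine add_mem (homogeneousPart_mono hle _ (mem_homogeneousPart_coeffwiseIdeal
        (Ideal.mul_le_left hy) ?_)) ?_
      · rw [pow_succ']
        exact Ideal.mul_mono_left hqI hy
      · refine ⟨X i * reesMonomial n hw, Ideal.mul_mem_sup_span_singleton _ _ _, ?_⟩
        rw [Subalgebra.coe_mul, hX i hi, reesMonomial, monomial_mul_monomial, add_comm 1]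

/-- Modulo `X i = q i t`, the generator `q (i+1) - q i t` becomes `q (i+1)`. This recursion trades a
generator for an increase of `i` and drives the inductions below. -/
theorem ReductionSystem.partialIdeal_sup_span [IsLocalRing A] (h : ReductionSystem I q d)
    (hX : ∀ j < d, (X j : A[X]) = monomial 1 (q j)) {i m : ℕ} (hi : i < d) :
    partialIdeal q X i (m + 1) ⊔ Ideal.span {X i} = partialIdeal q X (i + 1) m := by
  induction m with
  | zero =>
    rw [partialIdeal_succ, partialIdeal_zero, partialIdeal_zero, ← h.coeffwiseIdeal_succ hX hi]
    rfl
  | succ m ih =>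
    rw [partialIdeal_succ, sup_right_comm, ih, partialIdeal_succ (i + 1)]
    rcases m with _ | m
    · have hXi : X i ∈ partialIdeal q X (i + 1) 0 := by
        rw [partialIdeal_zero]
        exact X_mem_coeffwiseIdeal hX i.lt_succ_self hi
      have hpar : partialParameter q X i (0 + 1) =
          partialParameter q X (i + 1) 0 - X i := rfl
      refine le_antisymm (sup_le le_sup_left ?_) (sup_le le_sup_left ?_)
      · rw [Ideal.span_singleton_le_iff_mem, hpar]
        exact sub_mem (Ideal.mem_sup_right (Ideal.mem_span_singleton_self _))
          (Ideal.mem_sup_left hXi)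
      · rw [Ideal.span_singleton_le_iff_mem]
        have := add_mem (Ideal.mem_sup_right (Ideal.mem_span_singleton_self
          (partialParameter q X i (0 + 1)))) (Ideal.mem_sup_left hXi)
        rwa [hpar, sub_add_cancel] at this
    · congr 3
      rw [partialParameter, partialParameter, if_neg (by omega), if_neg (by omega)]
      congr 1
      omega

/-- Products of `X i = q i t` with elements of `I R + (X 0, …, X (i + m - 1))`. -/
theorem mul_mem_partialIdeal (hX : ∀ j < d, (X j : A[X]) = monomial 1 (q j)) {i m : ℕ}
    (hi : i + m < d) {v : reesAlgebra I}
    (hv : v ∈ I.map (algebraMap A (reesAlgebra I)) ⊔ initialSpan X (i + m)) :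
    X i * v ∈ partialIdeal q X i (m + 1) := by
  suffices hle : I.map (algebraMap A (reesAlgebra I)) ⊔ initialSpan X (i + m) ≤
      (partialIdeal q X i (m + 1)).colon {X i} by
    have := Submodule.mem_colon_singleton.1 (hle hv)
    rwa [smul_eq_mul, mul_comm] at this
  have hXi := hX i (by omega)
  refine sup_le (Ideal.map_le_iff_le_comap.2 fun a ha => ?_) (initialSpan_le fun l hl => ?_)
  · rw [Ideal.mem_comap, Submodule.mem_colon_singleton, smul_eq_mul, mul_comm,
      mul_eq_algebraMap_mul_of_eq_X_mul (v' := reesMonomial 1 (by simpa using ha)) hXi]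
    · exact Ideal.mul_mem_right _ _ (algebraMap_mem_partialIdeal i m)
    · change monomial 1 a = Polynomial.X * C a
      rw [X_mul_C, C_mul_X_eq_monomial]
  · rw [Submodule.mem_colon_singleton, smul_eq_mul]
    by_cases hli : l < i
    · exact Ideal.mul_mem_right _ _ (Ideal.mem_sup_left
        (X_mem_coeffwiseIdeal hX hli (by omega)))
    · obtain ⟨s, rfl⟩ := Nat.exists_eq_add_of_le (not_lt.1 hli)
      have h1 := reesParameter_mem_partialIdeal (q := q) (X := X) i (show s < m by omega)
      -- Obtained from `X i * q (i+s+1) = q i * X (i+s+1)` by replacing `q (i+s+1)` with `X (i+s)`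
      -- plus a parameter.
      have h2 : X (i + s) * X i = algebraMap A _ (q i) * X (i + s + 1) -
          reesParameter q X (i + s + 1) * X i := by
        have h3 := mul_eq_algebraMap_mul_of_eq_X_mul hXi
          (v := algebraMap A _ (q (i + s + 1))) (v' := X (i + s + 1)) (by
            rw [hX _ (by omega)]
            change _ = Polynomial.X * C _
            rw [X_mul_C, C_mul_X_eq_monomial])
        rw [← h3, reesParameter]
        ring
      rw [h2]
      exact sub_mem (Ideal.mul_mem_right _ _ (algebraMap_mem_partialIdeal i m))
        (Ideal.mul_mem_right _ _ h1)

theorem ReductionSystem.mem_of_mul_mem_map_sup [IsLocalRing A] (h : ReductionSystem I q d)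
    (hX : ∀ j < d, (X j : A[X]) = monomial 1 (q j)) {i : ℕ} (hi : i < d) {v : reesAlgebra I}
    (hv : X i * v ∈ I.map (algebraMap A (reesAlgebra I)) ⊔ initialSpan X i) :
    v ∈ I.map (algebraMap A (reesAlgebra I)) ⊔ initialSpan X i :=
  regularMod_map_range_iff.1 (h.regularMod hX h.le
    (fun n => by simpa only [← pow_succ'] using h.inf_pow_le (n + 1))) i hi v hv

/-- Comparing coefficients in degree `n + 1` and cancelling `q i` gives `u_n ≡ w_(n+1)` modulo `(q
0, …, q (i-1))`, where `w_(n+1) ∈ I^(n+1)`. The difference lies in `I^n`, where the intersection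
condition applies. -/
theorem ReductionSystem.mem_of_mul_mem_partialIdeal_one [IsLocalRing A] (h : ReductionSystem I q d)
    (hX : ∀ j < d, (X j : A[X]) = monomial 1 (q j)) {i : ℕ} (hi : i < d) {u : reesAlgebra I}
    (hu : X i * u ∈ partialIdeal q X i 1) :
    u ∈ I.map (algebraMap A (reesAlgebra I)) ⊔ initialSpan X i := by
  rw [mem_map_sup_initialSpan_iff hX h.le hi.le]
  rw [partialIdeal_succ, partialIdeal_zero, Ideal.mem_sup_span_singleton_iff] at hu
  obtain ⟨k, hk, w, hw⟩ := hu
  have hw' : (X i : A[X]) * u = k + C (q i) * w := congrArg Subtype.val hw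
  intro n
  have h1 := congrArg (fun p : A[X] => p.coeff (n + 1)) hw'
  simp only [hX i hi, coeff_monomial_mul_eq_ite, if_pos (Nat.le_add_left 1 n), Nat.add_sub_cancel,
    coeff_add, coeff_C_mul] at h1
  have h2 : (u : A[X]).coeff n - (w : A[X]).coeff (n + 1) ∈ initialSpan q i := by
    refine h.regular i hi _ ?_
    rw [mul_sub, h1, add_sub_cancel_right]
    exact hk (n + 1)
  have hw1 := coeff_mem_pow w (n + 1)
  have h3 : (u : A[X]).coeff n - (w : A[X]).coeff (n + 1) ∈ I ^ n :=
    sub_mem (coeff_mem_pow u n) (Ideal.pow_le_pow_right n.le_succ hw1)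
  rw [← sub_add_cancel ((u : A[X]).coeff n) ((w : A[X]).coeff (n + 1))]
  refine add_mem (Ideal.mem_sup_right ?_) (Ideal.mem_sup_left (by rwa [← pow_succ']))
  rcases n with _ | n
  · simpa using h2
  · exact initialSpan_inf_le h.regular (L := fun n => I ^ n) (by simp) (fun j hj n x hx => by
      rw [pow_succ']
      exact Ideal.mul_mem_mul (h.le (mem_initialSpan q hj)) hx) h.inf_pow_le hi.le n
      (Ideal.mem_inf.2 ⟨h2, h3⟩)

/-- The two assertions support each other. Let `z = q (i+m+1) - X (i+m)`. Regularity for `i + 1`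
reduces `z u ∈ partialIdeal q X i (m + 1)` to the case `u = X i * v`. The colon bound then puts `z
v`, hence `X (i+m) * v`, into `IR + (X 0, …, X (i+m-1))`; regularity of the `X j` on `R/IR` gives
the same for `v`, and `mul_mem_partialIdeal` returns `X i * v` to the ideal. -/
theorem ReductionSystem.partialIdeal_regular_and [IsLocalRing A] (h : ReductionSystem I q d)
    (hX : ∀ j < d, (X j : A[X]) = monomial 1 (q j)) (m : ℕ) {i : ℕ} (hi : i + m < d) :
    (∀ u, reesParameter q X (i + m) * u ∈ partialIdeal q X i m → u ∈ partialIdeal q X i m) ∧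
    ∀ u, X i * u ∈ partialIdeal q X i (m + 1) →
      u ∈ I.map (algebraMap A (reesAlgebra I)) ⊔ initialSpan X (i + m) := by
  have hqmem : ∀ j < d, ∀ k, algebraMap A (reesAlgebra I) (q j) ∈
      I.map (algebraMap A (reesAlgebra I)) ⊔ initialSpan X k := fun j hj k =>
    Ideal.mem_sup_left (Ideal.mem_map_of_mem _ (h.le (mem_initialSpan q hj)))
  induction m generalizing i with
  | zero =>
    refine ⟨fun u hu => ?_, fun u hu => h.mem_of_mul_mem_partialIdeal_one hX hi hu⟩
    rw [partialIdeal_zero] at hu ⊢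
    have h1 : algebraMap A (reesAlgebra I) (q i) * u ∈ coeffwiseIdeal I (initialSpan q i) := by
      rcases i with _ | i
      · exact hu
      · have h2 := Ideal.mul_mem_right u _
          (X_mem_coeffwiseIdeal (q := q) hX i.lt_succ_self (by omega))
        have h3 := add_mem hu h2
        rwa [add_zero, reesParameter, sub_mul, sub_add_cancel] at h3
    intro n
    refine h.regular i (by omega) _ ?_
    have h2 : (C (q i) * (u : A[X])).coeff n ∈ initialSpan q i := h1 n
    rwa [coeff_C_mul] at h2
  | succ m ih =>
    obtain ⟨hreg, -⟩ := ih (i := i + 1) (by omega)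
    obtain ⟨-, hmem⟩ := ih (i := i) (by omega)
    rw [show i + 1 + m = i + (m + 1) by omega] at hreg
    rw [← h.partialIdeal_sup_span hX (by omega : i < d)] at hreg
    have hsplit : ∀ u, reesParameter q X (i + (m + 1)) * u ∈
        partialIdeal q X i (m + 1) ⊔ Ideal.span {X i} →
        ∃ δ ∈ partialIdeal q X i (m + 1), ∃ v, u = δ + X i * v :=
      fun u hu => Ideal.mem_sup_span_singleton_iff.1 (hreg u hu)
    refine ⟨fun u hu => ?_, fun u hu => ?_⟩
    · obtain ⟨δ, hδ, v, rfl⟩ := hsplit u (Ideal.mem_sup_left hu)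
      refine add_mem hδ (mul_mem_partialIdeal hX (by omega) ?_)
      refine h.mem_of_mul_mem_map_sup hX (by omega) ?_
      have h1 := hmem (reesParameter q X (i + (m + 1)) * v) (by
        have := sub_mem hu (Ideal.mul_mem_left _ (reesParameter q X (i + (m + 1))) hδ)
        convert! this using 1
        ring)
      have h2 := sub_mem (Ideal.mul_mem_right v _ (hqmem (i + (m + 1)) hi (i + m))) h1
      convert! h2 using 1
      rw [← add_assoc, reesParameter]
      ring
    · rw [partialIdeal_succ, Ideal.mem_sup_span_singleton_iff] at hu
      obtain ⟨δ, hδ, w, hw⟩ := hu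
      have hpar : partialParameter q X i (m + 1) = reesParameter q X (i + (m + 1)) := rfl
      rw [hpar] at hw
      obtain ⟨δ', hδ', v, rfl⟩ := hsplit w (by
        have h1 : reesParameter q X (i + (m + 1)) * w = X i * u - δ := by rw [hw]; ring
        rw [h1]
        exact sub_mem (Ideal.mem_sup_right (Ideal.mul_mem_right _ _
          (Ideal.mem_span_singleton_self _))) (Ideal.mem_sup_left hδ))
      have h1 := hmem (u - reesParameter q X (i + (m + 1)) * v) (by
        have h2 : X i * (u - reesParameter q X (i + (m + 1)) * v) =
            δ + reesParameter q X (i + (m + 1)) * δ' := by linear_combination hw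
        rw [h2]
        exact add_mem hδ (Ideal.mul_mem_left _ _ hδ'))
      rw [← sub_add_cancel u (reesParameter q X (i + (m + 1)) * v)]
      refine add_mem (sup_le_sup_left (initialSpan_mono X (by omega)) _ h1)
        (Ideal.mul_mem_right _ _ ?_)
      rw [← add_assoc, reesParameter]
      exact sub_mem (hqmem _ (by omega) _)
        (Ideal.mem_sup_right (mem_initialSpan X (by omega)))

/-- Each index step is `X (l+1) * y = q (l+1) * (t y) ≡ X l * (t y)` modulo the parameters. -/
theorem X_mul_sub_mem_partialIdeal (hX : ∀ j < d, (X j : A[X]) = monomial 1 (q j)) {i k : ℕ}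
    (hi : i + k < d) {y y' : reesAlgebra I} (hy : y ∈ shiftIdeal I k)
    (hy' : (y' : A[X]) = Polynomial.X ^ k * (y : A[X])) :
    X (i + k) * y - X i * y' ∈ partialIdeal q X i (k + 1) := by
  induction k generalizing y with
  | zero =>
    have : y' = y := Subtype.ext (by simpa using hy')
    rw [this, add_zero, sub_self]
    exact zero_mem _
  | succ k ih =>
    obtain ⟨w, hw⟩ := exists_eq_X_pow_mul (k := 1) (u := y) fun n =>
      Ideal.pow_le_pow_right (by omega) (hy n)
    rw [pow_one] at hw
    have hwk : w ∈ shiftIdeal I k := by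
      intro n
      rw [hw]
      rcases n with _ | n
      · simp
      · rw [coeff_X_mul]
        exact Ideal.pow_le_pow_right (by omega) (hy n)
    have h1 := ih (by omega) hwk (by rw [hy', hw, pow_succ, mul_assoc])
    have h2 : X (i + (k + 1)) * y - X i * y' =
        reesParameter q X (i + k + 1) * w + (X (i + k) * w - X i * y') := by
      rw [mul_eq_algebraMap_mul_of_eq_X_mul (hX (i + (k + 1)) hi) hw, reesParameter, ← add_assoc]
      ring
    rw [h2]
    exact add_mem (Ideal.mul_mem_right _ _ (reesParameter_mem_partialIdeal i k.lt_succ_self))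
      (partialIdeal_mono i (Nat.le_succ _) h1)

/-- Modulo the parameters, `q (l+1) a t^n ≡ q l a t^(n+1)`. After `s` steps this reaches a multiple
of `q i`, provided that `a` can carry `s` more powers of `t`. -/
theorem algebraMap_mul_reesMonomial_mem_partialIdeal
    (hX : ∀ j < d, (X j : A[X]) = monomial 1 (q j)) {i s : ℕ} (hi : i + s < d) {n : ℕ} {a : A}
    (hn : a ∈ I ^ n) (ha : a ∈ I ^ (n + s)) :
    algebraMap A _ (q (i + s)) * reesMonomial n hn ∈ partialIdeal q X i (s + 1) := by
  induction s generalizing n with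
  | zero => exact Ideal.mul_mem_right _ _ (algebraMap_mem_partialIdeal i 0)
  | succ s ih =>
    have hn' : a ∈ I ^ (n + 1) := Ideal.pow_le_pow_right (by omega) ha
    have h1 := ih (by omega) hn' (by rwa [add_assoc, add_comm 1 s])
    have h2 := mul_eq_algebraMap_mul_of_eq_X_mul (hX (i + s) (by omega)) (v := reesMonomial n hn)
      (v' := reesMonomial (n + 1) hn') (X_mul_monomial n a).symm
    have h3 : algebraMap A _ (q (i + (s + 1))) * reesMonomial n hn =
        reesParameter q X (i + s + 1) * reesMonomial n hn +
          algebraMap A _ (q (i + s)) * reesMonomial (n + 1) hn' := by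
      rw [← h2, reesParameter, ← add_assoc]
      ring
    rw [h3]
    exact add_mem (Ideal.mul_mem_right _ _ (reesParameter_mem_partialIdeal i s.lt_succ_self))
      (partialIdeal_mono i (Nat.le_succ _) h1)

/-- Intersecting with `I^n` matters only for `k = 0`, where `i = d` and the exponent falls below
`n`. -/
theorem mul_pow_inf_le_homogeneousPart
    (hX : ∀ j < d, (X j : A[X]) = monomial 1 (q j)) {i k : ℕ} (hi : i + k = d) (n : ℕ) :
    initialSpan q d * I ^ (n + k - 1) ⊓ I ^ n ≤ homogeneousPart (partialIdeal q X i k) n := by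
  have hle : homogeneousPart (coeffwiseIdeal I (initialSpan q i)) n ≤
      homogeneousPart (partialIdeal q X i k) n := homogeneousPart_mono le_sup_left n
  rcases k with _ | k
  · intro c hc
    obtain ⟨h1, h2⟩ := Ideal.mem_inf.1 hc
    refine hle (mem_homogeneousPart_coeffwiseIdeal ?_ h2)
    rw [show i = d by omega]
    exact Ideal.mul_le_left h1
  · refine inf_le_left.trans (initialSpan_mul_le fun l hl a ha => ?_)
    have hn : a ∈ I ^ n := Ideal.pow_le_pow_right (by omega) ha
    by_cases hli : l < i
    · exact hle (mem_homogeneousPart_coeffwiseIdeal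
        (Ideal.mul_mem_right _ _ (mem_initialSpan q hli)) (Ideal.mul_mem_left _ _ hn))
    · obtain ⟨s, rfl⟩ := Nat.exists_eq_add_of_le (not_lt.1 hli)
      have h1 := algebraMap_mul_reesMonomial_mem_partialIdeal hX hl hn
        (Ideal.pow_le_pow_right (by omega) ha)
      exact ⟨_, partialIdeal_mono i (by omega) h1, C_mul_monomial⟩

/-- Bounds the colon by `X (d-1)`. For `k = d` the surplus `I^(n+d)` is absorbed by `Q I^(n+d-1)`
once `d` is at least three. -/
theorem ReductionSystem.mem_partialIdeal_sup_shiftIdeal [IsLocalRing A] (h : ReductionSystem I q d)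
    (hX : ∀ j < d, (X j : A[X]) = monomial 1 (q j)) {k i : ℕ} (hi : i + k = d)
    {u : reesAlgebra I} (hu : X (d - 1) * u ∈ partialIdeal q X i k) :
    u ∈ partialIdeal q X i k ⊔ shiftIdeal I k := by
  induction k generalizing i u with
  | zero => exact Ideal.mem_sup_right fun n => coeff_mem_pow u n
  | succ k ih =>
    have hd : d - 1 = i + k := by omega
    have hsup := h.partialIdeal_sup_span hX (m := k) (by omega : i < d)
    obtain ⟨-, hmem⟩ := h.partialIdeal_regular_and hX k (i := i) (by omega)
    -- the relation obtained from a decomposition `u = δ + X i * κ + y`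
    have key : ∀ y ∈ shiftIdeal I k, u - y ∈ partialIdeal q X (i + 1) k →
        ∃ δ ∈ partialIdeal q X i (k + 1), ∃ κ y' : reesAlgebra I, u = δ + X i * κ + y ∧
          (y' : A[X]) = Polynomial.X ^ k * (y : A[X]) ∧
          y' + X (i + k) * κ ∈ I.map (algebraMap A (reesAlgebra I)) ⊔ initialSpan X (i + k) := by
      intro y hy huy
      rw [← hsup] at huy
      obtain ⟨δ, hδ, κ, hκ⟩ := Ideal.mem_sup_span_singleton_iff.1 huy
      obtain ⟨y', hy'⟩ := exists_eq_X_pow_mul hy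
      refine ⟨δ, hδ, κ, y', by rw [← hκ]; ring, hy', hmem _ ?_⟩
      have h1 := X_mul_sub_mem_partialIdeal hX (i := i) (by omega) hy hy'
      rw [hd] at hu
      have h2 : X i * (y' + X (i + k) * κ) =
          X (i + k) * u - X (i + k) * δ - (X (i + k) * y - X i * y') := by
        linear_combination (-X (i + k)) * hκ
      rw [h2]
      exact sub_mem (sub_mem hu (Ideal.mul_mem_left _ _ hδ)) h1
    -- Two passes through `key`. The first shows `t^k y ∈ IR + (X 0, …, X (d-1))`, which improves
    -- the coefficients of `y` from `I^(n+k)` to `I^(n+k+1)` modulo `partialIdeal q X (i + 1) k`.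
    -- With the improved remainder `w`, the second gives `κ ∈ IR + (X 0, …, X (i+k-1))`, so that `X
    -- i * κ` is in the ideal.
    obtain ⟨δ₁, hδ₁, y, hy, hδy⟩ := Submodule.mem_sup.1 (ih (i := i + 1) (by omega)
      (hsup ▸ Ideal.mem_sup_left hu))
    obtain ⟨-, -, κ, y', -, hy', hy'κ⟩ := key y hy (by
      rw [← hδy, add_sub_cancel_right]
      exact hδ₁)
    have hy'mem : y' ∈ I.map (algebraMap A (reesAlgebra I)) ⊔ initialSpan X d := by
      have hle := sup_le_sup_left (initialSpan_mono X (by omega : i + k ≤ d))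
        (I.map (algebraMap A (reesAlgebra I)))
      refine (Submodule.add_mem_iff_left _ ?_).1 (hle hy'κ)
      exact Ideal.mul_mem_right _ _ (Ideal.mem_sup_right (mem_initialSpan X (by omega)))
    rw [mem_map_sup_initialSpan_iff hX h.le le_rfl] at hy'mem
    have hymem : y ∈ partialIdeal q X (i + 1) k ⊔ shiftIdeal I (k + 1) := by
      refine mem_of_forall_coeff_mem fun n => ?_
      have h1 := hy'mem (n + k)
      rw [hy', coeff_X_pow_mul] at h1
      obtain ⟨a, ha, c, hc, hac⟩ := Submodule.mem_sup.1 h1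
      have ha' : a ∈ I ^ (n + (k + 1)) := by rwa [← pow_succ', add_assoc] at ha
      rw [← hac]
      refine add_mem (homogeneousPart_mono le_sup_right n (mem_homogeneousPart_shiftIdeal ha'))
        (homogeneousPart_mono le_sup_left n (mul_pow_inf_le_homogeneousPart hX
          (by omega) n (Ideal.mem_inf.2 ⟨hc, ?_⟩)))
      rw [eq_sub_of_add_eq' hac]
      exact sub_mem (coeff_mem_pow y n) (Ideal.pow_le_pow_right (by omega) ha')
    obtain ⟨δ₂, hδ₂, w, hw, rfl⟩ := Submodule.mem_sup.1 hymem
    obtain ⟨δ, hδ, κ, w', hu', hw', hw'κ⟩ := key w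
      (fun n => Ideal.pow_le_pow_right (by omega) (hw n)) (by
        rw [← hδy, ← add_assoc, add_sub_cancel_right]
        exact add_mem hδ₁ hδ₂)
    have hw'mem : w' ∈ I.map (algebraMap A (reesAlgebra I)) := by
      refine mem_of_forall_coeff_mem fun n => mul_pow_le_homogeneousPart_map I n ?_
      rw [hw', coeff_X_pow_mul', ← pow_succ']
      split_ifs with hn
      · exact Ideal.pow_le_pow_right (by omega) (hw (n - k))
      · exact zero_mem _
    have hκ := h.mem_of_mul_mem_map_sup hX (by omega)
      ((Submodule.add_mem_iff_right _ (Ideal.mem_sup_left hw'mem)).1 hw'κ)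
    rw [hu']
    exact Submodule.add_mem_sup (add_mem hδ (mul_mem_partialIdeal hX (by omega) hκ)) hw

/-- If `d ≥ 3`, then `q 0, q 1 - q 0 t, …, q (d - 1) - q (d - 2) t, q (d - 1) t` is a regular
sequence in the Rees algebra. -/
theorem ReductionSystem.regularMod_reesParameter [IsLocalRing A] (h : ReductionSystem I q d)
    (hX : ∀ j < d, (X j : A[X]) = monomial 1 (q j)) (hd : 3 ≤ d) :
    RegularMod ⊥ ((List.range d).map (reesParameter q X) ++ [X (d - 1)]) := by
  rw [regularMod_append, regularMod_map_range_iff, ofList_map_range]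
  simp only [bot_sup_eq, RegularMod, and_true, ← initialSpan_reesParameter]
  refine ⟨fun i hi u hu => ?_, fun u hu => ?_⟩
  · exact (h.partialIdeal_regular_and hX i (i := 0) (by omega)).1 u (by rwa [zero_add])
  · refine (?_ : _ ⊔ _ ≤ partialIdeal q X 0 d) (h.mem_partialIdeal_sup_shiftIdeal hX (zero_add d) hu)
    refine sup_le le_rfl fun v hv => ?_
    refine mem_of_forall_coeff_mem fun n => mul_pow_inf_le_homogeneousPart hX (zero_add d) n
      (Ideal.mem_inf.2 ⟨?_, coeff_mem_pow v n⟩)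
    -- The bound `d ≥ 3` enters here, to split off a factor `I ^ 3`.
    refine (?_ : I ^ (n + d) ≤ _) (hv n)
    calc I ^ (n + d) = I ^ 3 * I ^ (n + d - 3) := by rw [← pow_add]; congr 1; omega
      _ ≤ initialSpan q d * I ^ 2 * I ^ (n + d - 3) := Ideal.mul_mono_left h.pow_three_le
      _ = initialSpan q d * I ^ (n + d - 1) := by rw [mul_assoc, ← pow_add]; congr 2; omega

end ParametersOfRees

/-! ### The three kinds of maximal ideals of the Rees algebra -/

section MaximalIdealsOfRees

open Polynomial

section Generic

variable {A : Type*} [CommRing A] {I : Ideal A}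

/-- After inverting `a`, the element `a t` generates the Rees algebra; the power of `a` clears
denominators. -/
theorem exists_algebraMap_pow_mul_eq_aeval {a : A} {x : reesAlgebra I}
    (hx : (x : A[X]) = monomial 1 a) (u : reesAlgebra I) :
    ∃ (N : ℕ) (g : A[X]), algebraMap A (reesAlgebra I) (a ^ N) * u = aeval x g ∧
      (∀ n, g.coeff n = (u : A[X]).coeff n * a ^ (N - n)) := by
  refine ⟨(u : A[X]).natDegree, ∑ n ∈ Finset.range ((u : A[X]).natDegree + 1),
    monomial n ((u : A[X]).coeff n * a ^ ((u : A[X]).natDegree - n)), ?_⟩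
  rw [and_comm]
  refine (and_iff_left_of_imp fun hg => ?_).2 fun n => ?_
  · refine Subtype.ext (Polynomial.ext fun n => ?_)
    rw [coeff_aeval_of_eq_monomial_one hx, hg]
    change (C (a ^ (u : A[X]).natDegree) * (u : A[X])).coeff n = _
    rw [coeff_C_mul]
    by_cases hn : n ≤ (u : A[X]).natDegree
    · rw [mul_assoc, ← pow_add, Nat.sub_add_cancel hn, mul_comm]
    · rw [coeff_eq_zero_of_natDegree_lt (by omega), mul_zero, zero_mul, zero_mul]
  · rw [finsetSum_coeff]
    simp only [coeff_monomial]
    by_cases hn : n ≤ (u : A[X]).natDegree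
    · rw [Finset.sum_ite_eq']
      simp [hn]
    · rw [coeff_eq_zero_of_natDegree_lt (by omega), zero_mul]
      refine Finset.sum_eq_zero fun i hi => if_neg ?_
      have := Finset.mem_range.1 hi
      omega

theorem exists_pow_mul_mem_map {J : Ideal A} {a : A} (ha : a ∈ I) {u : reesAlgebra I}
    (hu : u ∈ coeffwiseIdeal I J) : ∃ N, algebraMap A (reesAlgebra I) (a ^ N) * u ∈
      J.map (algebraMap A (reesAlgebra I)) := by
  refine ⟨(u : A[X]).natDegree, mem_of_forall_coeff_mem fun n =>
    mul_pow_le_homogeneousPart_map J n ?_⟩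
  change (C (a ^ (u : A[X]).natDegree) * (u : A[X])).coeff n ∈ _
  rw [coeff_C_mul, mul_comm (a ^ _)]
  by_cases hn : n ≤ (u : A[X]).natDegree
  · exact Ideal.mul_mem_mul (hu n) (Ideal.pow_le_pow_right hn (Ideal.pow_mem_pow ha _))
  · rw [coeff_eq_zero_of_natDegree_lt (by omega), zero_mul]
    exact zero_mem _

theorem coeffwiseIdeal_le_of_notMem {J : Ideal A} {a : A} (ha : a ∈ I) {P : Ideal (reesAlgebra I)}
    [P.IsPrime] (haP : algebraMap A (reesAlgebra I) a ∉ P)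
    (hJ : J.map (algebraMap A (reesAlgebra I)) ≤ P) : coeffwiseIdeal I J ≤ P := by
  intro u hu
  obtain ⟨N, hN⟩ := exists_pow_mul_mem_map ha hu
  rw [map_pow] at hN
  exact (Ideal.IsPrime.mem_or_mem ‹_› (hJ hN)).resolve_left
    fun h => haP (Ideal.IsPrime.mem_of_pow_mem ‹_› _ h)

theorem map_le_coeffwiseIdeal (J : Ideal A) :
    J.map (algebraMap A (reesAlgebra I)) ≤ coeffwiseIdeal I J := by
  refine Ideal.map_le_iff_le_comap.2 fun a ha n => ?_
  change (C a).coeff n ∈ _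
  rw [coeff_C]
  split_ifs
  · exact ha
  · exact zero_mem _

/-- A regular sequence of `A` stays regular locally at the primes of the Rees algebra of `I` that do
not contain `I`. -/
theorem RegularMod.locallyRegularMod_map {M : Ideal (reesAlgebra I)} [M.IsPrime] {a : A}
    (ha : a ∈ I) (haM : algebraMap A (reesAlgebra I) a ∉ M) {J : Ideal A} {xs : List A}
    (h : RegularMod J xs) : LocallyRegularMod M (J.map (algebraMap A (reesAlgebra I)))
      (xs.map (algebraMap A (reesAlgebra I))) := by
  induction xs generalizing J with
  | nil => trivial
  | cons x xs ih =>
    refine ⟨fun u hu => ?_, ?_⟩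
    · have h1 : u ∈ coeffwiseIdeal I J := fun n => h.1 _ <| by
        have h2 : (C x * (u : A[X])).coeff n ∈ J := map_le_coeffwiseIdeal J hu n
        rwa [coeff_C_mul] at h2
      obtain ⟨N, hN⟩ := exists_pow_mul_mem_map ha h1
      refine ⟨_, fun hM => haM ?_, hN⟩
      rw [map_pow] at hM
      exact Ideal.IsPrime.mem_of_pow_mem ‹_› _ hM
    · have := ih h.2
      rwa [Ideal.map_sup, Ideal.map_span, Set.image_singleton] at this

/-- An element with a coefficient outside `p` is regular modulo `J R(I)`, up to elements of `A`
outside `p` and powers of an element of `I`. -/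
theorem exists_mul_mem_map_of_mul_mem {J p : Ideal A} [p.IsPrime] {a : A} (ha : a ∈ I) {f : reesAlgebra I}
    (hf : f ∉ coeffwiseIdeal I p) {u : reesAlgebra I}
    (hu : f * u ∈ J.map (algebraMap A (reesAlgebra I))) :
    ∃ r ∉ p, ∃ N, algebraMap A (reesAlgebra I) (a ^ N) * (algebraMap A (reesAlgebra I) r * u) ∈
      J.map (algebraMap A (reesAlgebra I)) := by
  have hmul : ∀ {r s : A}, r ∉ p → s ∉ p → r * s ∉ p := fun hr hs h =>
    (Ideal.IsPrime.mem_or_mem ‹_› h).elim hr hs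
  have hone : (1 : A) ∉ p := fun h => Ideal.IsPrime.ne_top ‹_› ((Ideal.eq_top_iff_one p).2 h)
  -- the contraction of `J` localized at `p`
  let 𝔓 : Ideal A :=
    { carrier := {c | ∃ r ∉ p, r * c ∈ J}
      zero_mem' := ⟨1, hone, by simp⟩
      add_mem' := by
        rintro c c' ⟨r, hr, hc⟩ ⟨r', hr', hc'⟩
        refine ⟨r * r', hmul hr hr', ?_⟩
        have := add_mem (J.mul_mem_left r' hc) (J.mul_mem_left r hc')
        convert! this using 1
        ring
      smul_mem' := by
        rintro b c ⟨r, hr, hc⟩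
        refine ⟨r, hr, ?_⟩
        rw [smul_eq_mul, mul_left_comm]
        exact J.mul_mem_left _ hc }
  have hJ𝔓 : J ≤ 𝔓 := fun j hj => ⟨1, hone, by simpa⟩
  -- McCoy's theorem: a zerodivisor would be killed by a nonzero constant, but a coefficient of `f`
  -- outside `p` is a nonzerodivisor modulo `𝔓`.
  have hnzd : (f : A[X]).map (Ideal.Quotient.mk 𝔓) ∈ nonZeroDivisors (A ⧸ 𝔓)[X] := by
    by_contra hcon
    obtain ⟨c, hc, hcf⟩ := Polynomial.notMem_nonZeroDivisors_iff.1 hcon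
    obtain ⟨c, rfl⟩ := Ideal.Quotient.mk_surjective c
    refine hf fun n => ?_
    by_contra hfn
    have h1 := congrArg (fun p : (A ⧸ 𝔓)[X] => p.coeff n) hcf
    simp only [coeff_smul, coeff_map, smul_eq_mul, coeff_zero] at h1
    rw [← map_mul, Ideal.Quotient.eq_zero_iff_mem] at h1
    obtain ⟨r, hr, hrc⟩ := h1
    refine hc (Ideal.Quotient.eq_zero_iff_mem.2 ⟨r * (f : A[X]).coeff n, hmul hr hfn, ?_⟩)
    convert! hrc using 1
    ring
  have hu0 : (u : A[X]).map (Ideal.Quotient.mk 𝔓) = 0 := by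
    refine (mul_left_mem_nonZeroDivisors_eq_zero_iff hnzd).1 ?_
    rw [← Polynomial.map_mul]
    ext n
    rw [coeff_map, coeff_zero, Ideal.Quotient.eq_zero_iff_mem]
    exact hJ𝔓 (map_le_coeffwiseIdeal J hu n)
  have hun : ∀ n, ∃ r ∉ p, r * (u : A[X]).coeff n ∈ J := fun n => by
    have h1 := congrArg (fun p : (A ⧸ 𝔓)[X] => p.coeff n) hu0
    simp only [coeff_map, coeff_zero] at h1
    exact Ideal.Quotient.eq_zero_iff_mem.1 h1
  choose r hr hru using hun
  let s := ∏ n ∈ (u : A[X]).support, r n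
  have hs : s ∉ p := by
    intro h
    obtain ⟨n, -, hn⟩ := (Ideal.IsPrime.prod_mem_iff).1 h
    exact hr n hn
  have hsu : algebraMap A (reesAlgebra I) s * u ∈ coeffwiseIdeal I J := by
    intro n
    change (C s * (u : A[X])).coeff n ∈ J
    rw [coeff_C_mul]
    by_cases hn : n ∈ (u : A[X]).support
    · change (∏ n ∈ (u : A[X]).support, r n) * _ ∈ J
      rw [← Finset.prod_erase_mul _ r hn, mul_assoc]
      exact J.mul_mem_left _ (hru n)
    · rw [notMem_support_iff.1 hn, mul_zero]
      exact zero_mem _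
  exact ⟨s, hs, exists_pow_mul_mem_map ha hsu⟩

/-- If `R ⧸ P` is algebraic over `A ⧸ (P ∩ A)`, then no prime strictly containing `P` has the same
contraction to `A`. -/
theorem Ideal.le_of_comap_le_of_isAlgebraic {A R : Type*} [CommRing A] [CommRing R] [Algebra A R]
    {P M : Ideal R} [P.IsPrime] (hPM : P ≤ M)
    (hcomap : M.comap (algebraMap A R) ≤ P.comap (algebraMap A R)) (x : R)
    (hx : ∃ g : A[X], aeval x g ∈ P ∧ ∃ n, algebraMap A R (g.coeff n) ∉ P)
    (hu : ∀ u : R, ∃ b, algebraMap A R b ∉ P ∧ ∃ g : A[X], algebraMap A R b * u = aeval x g) :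
    M ≤ P := by
  let p := P.comap (algebraMap A R)
  let _ : Algebra (A ⧸ p) (R ⧸ P) := Ideal.Quotient.algebraQuotientOfLEComap le_rfl
  have htower : IsScalarTower A (A ⧸ p) (R ⧸ P) := IsScalarTower.of_algebraMap_eq' rfl
  have haeval : ∀ g : A[X], aeval (Ideal.Quotient.mk P x) (g.map (Ideal.Quotient.mk p)) =
      Ideal.Quotient.mk P (aeval x g) := by
    intro g
    have h1 := aeval_map_algebraMap (A ⧸ p) (Ideal.Quotient.mk P x) g
    exact h1.trans (aeval_algHom_apply (Ideal.Quotient.mkₐ A P) x g)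
  have hx' : IsAlgebraic (A ⧸ p) (Ideal.Quotient.mk P x) := by
    obtain ⟨g, hg, n, hn⟩ := hx
    refine ⟨g.map (Ideal.Quotient.mk p), fun h0 => hn ?_, ?_⟩
    · have h1 := congrArg (fun f : (A ⧸ p)[X] => f.coeff n) h0
      simp only [coeff_map, coeff_zero] at h1
      exact Ideal.mem_comap.1 (Ideal.Quotient.eq_zero_iff_mem.1 h1)
    · rw [haeval, Ideal.Quotient.eq_zero_iff_mem]
      exact hg
  have halg : ∀ u : R, IsAlgebraic (A ⧸ p) (Ideal.Quotient.mk P u) := by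
    intro u
    obtain ⟨b, hb, g, hg⟩ := hu u
    have h1 : IsAlgebraic (A ⧸ p) (Ideal.Quotient.mk P (aeval x g)) := by
      rw [← haeval]
      have hle : Algebra.adjoin (A ⧸ p) {Ideal.Quotient.mk P x} ≤
          Subalgebra.algebraicClosure (A ⧸ p) (R ⧸ P) :=
        Algebra.adjoin_le (Set.singleton_subset_iff.2 hx')
      exact hle (aeval_mem_adjoin_singleton _ _)
    rw [← hg, map_mul] at h1
    refine IsAlgebraic.of_mul (mem_nonZeroDivisors_of_ne_zero fun h => hb ?_)
      (isAlgebraic_algebraMap (R := A ⧸ p) (A := R ⧸ P) (Ideal.Quotient.mk p b)) h1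
    exact Ideal.Quotient.eq_zero_iff_mem.1 h
  by_contra hcon
  obtain ⟨m, hm, hmP⟩ := SetLike.not_le_iff_exists.1 hcon
  -- A nonzero ideal of an algebraic extension domain meets the base nontrivially.
  refine Ideal.comap_ne_bot_of_algebraic_mem (R := A ⧸ p) (I := M.map (Ideal.Quotient.mk P))
    (x := Ideal.Quotient.mk P m) (by rwa [Ne, Ideal.Quotient.eq_zero_iff_mem])
    (Ideal.mem_map_of_mem _ hm) (halg m) ?_
  rw [eq_bot_iff]
  intro c hc
  obtain ⟨c, rfl⟩ := Ideal.Quotient.mk_surjective c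
  rw [Ideal.mem_bot, Ideal.Quotient.eq_zero_iff_mem]
  refine hcomap ?_
  rw [Ideal.mem_comap] at hc ⊢
  exact (Ideal.mem_quotient_iff_mem hPM).1 hc

/-- A chain of primes of the Rees algebra lying over `p`, with `I` not contained in `p`, has at most
one step above the ideal of elements with all coefficients in `p`. -/
theorem le_of_comap_le_of_mem {P M : Ideal (reesAlgebra I)} [P.IsPrime] {a : A} (ha : a ∈ I)
    (haP : algebraMap A (reesAlgebra I) a ∉ P)
    (hcomap : M.comap (algebraMap A (reesAlgebra I)) ≤ P.comap (algebraMap A (reesAlgebra I)))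
    (hPM : P ≤ M) {f : reesAlgebra I} (hf : f ∈ P)
    (hfp : f ∉ coeffwiseIdeal I (P.comap (algebraMap A (reesAlgebra I)))) : M ≤ P := by
  let x : reesAlgebra I := reesMonomial 1 (a := a) (by simpa using ha)
  have hap : ∀ n, algebraMap A (reesAlgebra I) (a ^ n) ∉ P := fun n h => by
    rw [map_pow] at h
    exact haP (Ideal.IsPrime.mem_of_pow_mem ‹_› n h)
  refine Ideal.le_of_comap_le_of_isAlgebraic hPM hcomap x ?_ fun u => ?_
  · obtain ⟨N, g, hg, hgn⟩ := exists_algebraMap_pow_mul_eq_aeval (x := x) rfl f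
    refine ⟨g, hg ▸ P.mul_mem_left _ hf, ?_⟩
    by_contra! hcon
    refine hfp fun n => ?_
    have h1 := hcon n
    rw [hgn, map_mul] at h1
    exact (Ideal.IsPrime.mem_or_mem ‹_› h1).resolve_right (hap _)
  · obtain ⟨N, g, hg, -⟩ := exists_algebraMap_pow_mul_eq_aeval (x := x) rfl u
    exact ⟨_, hap N, g, hg⟩

end Generic

variable {A : Type u} [CommRing A] [IsLocalRing A] {I : Ideal A}

/-- Locally at `M` the Rees algebra is a localization of `A[t]`. A regular sequence of `A` over
which `p = M ∩ A` is minimal stays regular, and it is either sufficient or needs one more element.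
-/
theorem exists_locallyRegularMod_of_not_le [IsNoetherianRing A] (hA : IsGorensteinLocal A) (M : Ideal (reesAlgebra I))
    [M.IsPrime] (hM : ¬ I ≤ M.comap (algebraMap A (reesAlgebra I))) :
    ∃ xs : List (reesAlgebra I), LocallyRegularMod M ⊥ xs ∧
      M ∈ (⊥ ⊔ Ideal.ofList xs).minimalPrimes := by
  obtain ⟨a, ha, haM⟩ := SetLike.not_le_iff_exists.1 hM
  rw [Ideal.mem_comap] at haM
  obtain ⟨n, hn⟩ := hA.finite_injectiveDimension
  obtain ⟨xs, hxs, hreg, hmin⟩ := (show SelfInjectiveDimensionLE (⊥ : Ideal A) n from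
    hasInjectiveDimensionLE_of_ringEquiv (RingEquiv.quotientBot A).symm
      hn).exists_regularMod_minimalPrimes
    (inferInstance : (M.comap (algebraMap A (reesAlgebra I))).IsPrime) bot_le
  set p := M.comap (algebraMap A (reesAlgebra I)) with hp
  rw [bot_sup_eq] at hmin
  have hlist : Ideal.ofList (xs.map (algebraMap A (reesAlgebra I))) =
      (Ideal.ofList xs).map (algebraMap A (reesAlgebra I)) := by
    rw [Ideal.map_ofList]
  have hlreg := hreg.locallyRegularMod_map ha haM
  rw [Ideal.map_bot] at hlreg
  have hxsM : (Ideal.ofList xs).map (algebraMap A (reesAlgebra I)) ≤ M :=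
    Ideal.map_le_iff_le_comap.2 hmin.1.2
  have hP : ∀ P : Ideal (reesAlgebra I), P.IsPrime →
      (Ideal.ofList xs).map (algebraMap A (reesAlgebra I)) ≤ P → P ≤ M →
      P.comap (algebraMap A (reesAlgebra I)) = p ∧ coeffwiseIdeal I p ≤ P := by
    intro P hP hle hPM
    have h1 : P.comap (algebraMap A (reesAlgebra I)) = p :=
      le_antisymm (Ideal.comap_mono hPM)
        (hmin.2 ⟨inferInstance, Ideal.map_le_iff_le_comap.1 hle⟩ (Ideal.comap_mono hPM))
    exact ⟨h1, coeffwiseIdeal_le_of_notMem ha (fun h => haM (hPM h))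
      (Ideal.map_le_iff_le_comap.2 h1.ge)⟩
  by_cases hMp : M ≤ coeffwiseIdeal I p
  · refine ⟨_, hlreg, ?_⟩
    rw [bot_sup_eq, hlist]
    exact ⟨⟨inferInstance, hxsM⟩, fun P hP' hPM => hMp.trans (hP P hP'.1 hP'.2 hPM).2⟩
  obtain ⟨f, hfM, hfp⟩ := SetLike.not_le_iff_exists.1 hMp
  refine ⟨xs.map (algebraMap A (reesAlgebra I)) ++ [f], locallyRegularMod_append.2 ⟨hlreg, ?_⟩, ?_⟩
  · rw [bot_sup_eq, hlist]
    refine ⟨fun u hu => ?_, trivial⟩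
    obtain ⟨r, hr, N, hN⟩ := exists_mul_mem_map_of_mul_mem ha hfp hu
    refine ⟨algebraMap A _ (a ^ N) * algebraMap A _ r, fun h => ?_, by rwa [mul_assoc]⟩
    rcases Ideal.IsPrime.mem_or_mem ‹_› h with h | h
    · rw [map_pow] at h
      exact haM (Ideal.IsPrime.mem_of_pow_mem ‹_› _ h)
    · exact hr h
  · rw [bot_sup_eq, Ideal.ofList_append, hlist, Ideal.ofList_singleton]
    refine ⟨⟨inferInstance, sup_le hxsM ((Ideal.span_singleton_le_iff_mem _).2 hfM)⟩,
      fun P hP' hPM => ?_⟩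
    have hP1 := hP'.1
    obtain ⟨h1, h2⟩ := hP P hP'.1 (le_sup_left.trans hP'.2) hPM
    exact le_of_comap_le_of_mem ha (fun h => haM (hPM h)) h1.ge hPM
      (hP'.2 (Ideal.mem_sup_right (Ideal.mem_span_singleton_self f))) (by rwa [h1])

variable {q : ℕ → A} {d : ℕ} {X : ℕ → reesAlgebra I}

/-- From `a (q j t) = q j (a t)` for `a ∈ I`, inverting `X j` makes `q j` generate `IR`. So `q j`
followed by a regular sequence on `R/IR` is locally regular. -/
theorem ReductionSystem.exists_locallyRegularMod_of_notMem [IsNoetherianRing A] (h : ReductionSystem I q d)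
    (hX : ∀ j < d, (X j : A[X]) = monomial 1 (q j)) (M : Ideal (reesAlgebra I)) [M.IsMaximal]
    (hM : I.map (algebraMap A (reesAlgebra I)) ≤ M) {j : ℕ} (hj : j < d) (hXM : X j ∉ M) :
    ∃ xs : List (reesAlgebra I), LocallyRegularMod M ⊥ xs ∧
      M ∈ (⊥ ⊔ Ideal.ofList xs).minimalPrimes := by
  have hMp : M.IsPrime := inferInstance
  obtain ⟨gs, hgs, hreg, hmin⟩ := h.exists_regularMod_map hX h.le
    (fun n => by simpa only [← pow_succ'] using h.inf_pow_le (n + 1)) M hM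
  have hqI := h.le (mem_initialSpan q hj)
  have hle : ⊥ ⊔ Ideal.span {algebraMap A (reesAlgebra I) (q j)} ≤
      I.map (algebraMap A (reesAlgebra I)) := by
    rw [bot_sup_eq, Ideal.span_singleton_le_iff_mem]
    exact Ideal.mem_map_of_mem _ hqI
  have hmul : ∀ u ∈ I.map (algebraMap A (reesAlgebra I)),
      X j * u ∈ ⊥ ⊔ Ideal.span {algebraMap A (reesAlgebra I) (q j)} := by
    intro u hu
    suffices hle : I.map (algebraMap A (reesAlgebra I)) ≤
        (Ideal.span {algebraMap A (reesAlgebra I) (q j)}).colon {X j} by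
      have := Submodule.mem_colon_singleton.1 (hle hu)
      rwa [smul_eq_mul, mul_comm, ← bot_sup_eq (Ideal.span _)] at this
    refine Ideal.map_le_iff_le_comap.2 fun a ha => ?_
    rw [Ideal.mem_comap, Submodule.mem_colon_singleton, smul_eq_mul, mul_comm,
      mul_eq_algebraMap_mul_of_eq_X_mul (v' := reesMonomial 1 (by simpa using ha)) (hX j hj)]
    · exact Ideal.mul_mem_right _ _ (Ideal.mem_span_singleton_self _)
    · change monomial 1 a = Polynomial.X * C a
      rw [X_mul_C, C_mul_X_eq_monomial]
  refine ⟨algebraMap A _ (q j) :: gs, ⟨fun u hu => ⟨1, fun h1 => ?_, ?_⟩, ?_⟩, ?_⟩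
  · exact hMp.ne_top ((Ideal.eq_top_iff_one _).2 h1)
  · rw [one_mul, Ideal.mem_bot]
    refine Subtype.ext (Polynomial.ext fun n => h.nonzerodivisor j hj _ ?_)
    have h1 : C (q j) * (u : A[X]) = 0 := congrArg Subtype.val ((Ideal.mem_bot).1 hu)
    rw [← coeff_C_mul, h1, coeff_zero]
  · exact (hreg.locally hMp.ne_top).of_mul_le hXM hle hmul
  · rw [Ideal.sup_ofList_cons]
    refine ⟨⟨hMp, sup_le (hle.trans hM) (Ideal.span_le.2 hgs)⟩, fun P hP hPM => hmin.2 ⟨hP.1, ?_⟩ hPM⟩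
    refine sup_le (fun u hu => ?_) (le_sup_right.trans hP.2)
    exact (hP.1.mem_or_mem (hP.2 (Ideal.mem_sup_left (hmul u hu)))).resolve_left
      fun hXP => hXM (hPM hXP)

/-- For minimality, a prime containing the sequence must contain every `q j` and `X j`, hence `𝔪`,
and then every `y t` with `y ∈ I`, because `(y t)³` lies in the ideal of the `X j`. -/
theorem ReductionSystem.exists_locallyRegularMod_of_forall_mem (h : ReductionSystem I q d)
    (hX : ∀ j < d, (X j : A[X]) = monomial 1 (q j)) (hd : 3 ≤ d) (M : Ideal (reesAlgebra I))
    [M.IsMaximal] (hM : I.map (algebraMap A (reesAlgebra I)) ≤ M) (hXM : ∀ j < d, X j ∈ M) :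
    ∃ xs : List (reesAlgebra I), LocallyRegularMod M ⊥ xs ∧
      M ∈ (⊥ ⊔ Ideal.ofList xs).minimalPrimes := by
  have hMp : M.IsPrime := inferInstance
  refine ⟨_, (h.regularMod_reesParameter hX hd).locally hMp.ne_top, ⟨hMp, ?_⟩, ?_⟩
  · rw [bot_sup_eq, Ideal.ofList, Ideal.span_le]
    intro z hz
    have hqM : ∀ j < d, algebraMap A _ (q j) ∈ M := fun j hj =>
      hM (Ideal.mem_map_of_mem _ (h.le (mem_initialSpan q hj)))
    rcases List.mem_append.1 hz with hz | hz
    · obtain ⟨j, hj, rfl⟩ := List.mem_map.1 hz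
      have hj := List.mem_range.1 hj
      rcases j with _ | j
      · exact hqM 0 hj
      · exact sub_mem (hqM _ hj) (hXM j (by omega))
    · rw [List.mem_singleton.1 hz]
      exact hXM _ (by omega)
  · rintro P ⟨hP, hle⟩ hPM
    rw [bot_sup_eq, Ideal.ofList, Ideal.span_le] at hle
    have hz : ∀ j < d, reesParameter q X j ∈ P := fun j hj =>
      hle (List.mem_append_left _ (List.mem_map.2 ⟨j, List.mem_range.2 hj, rfl⟩))
    -- `P` contains `X j * q (j+1) = q j * X (j+1)`, hence one of the factors on the left; the
    -- parameter `q (j+1) - X j` brings in the other.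
    have hstep : ∀ j, j + 1 < d → algebraMap A _ (q j) ∈ P →
        X j ∈ P ∧ algebraMap A _ (q (j + 1)) ∈ P := by
      intro j hj hqj
      have h1 := mul_eq_algebraMap_mul_of_eq_X_mul (hX j (by omega))
        (v := algebraMap A _ (q (j + 1))) (v' := X (j + 1)) (by
          rw [hX _ hj]
          change _ = Polynomial.X * C _
          rw [X_mul_C, C_mul_X_eq_monomial])
      have h2 : X j * algebraMap A _ (q (j + 1)) ∈ P := h1 ▸ P.mul_mem_right _ hqj
      have h3 : algebraMap A _ (q (j + 1)) - X j ∈ P := hz (j + 1) hj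
      rcases hP.mem_or_mem h2 with h4 | h4
      · exact ⟨h4, (Submodule.sub_mem_iff_left _ h4).1 h3⟩
      · exact ⟨(Submodule.sub_mem_iff_right _ h4).1 h3, h4⟩
    have hqP : ∀ j < d, algebraMap A _ (q j) ∈ P := by
      intro j hj
      induction j with
      | zero => exact hz 0 hj
      | succ j ih => exact (hstep j hj (ih (by omega))).2
    have hXP : ∀ j < d, X j ∈ P := by
      intro j hj
      by_cases hjd : j + 1 < d
      · exact (hstep j hjd (hqP j hj)).1
      · rw [show j = d - 1 by omega]
        exact hle (List.mem_append_right _ (by simp))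
    have hmP : maximalIdeal A ≤ P.comap (algebraMap A (reesAlgebra I)) := by
      refine h.le_radical.trans ?_
      rw [Ideal.IsPrime.radical_le_iff inferInstance]
      exact initialSpan_le fun j hj => hqP j hj
    have hI1 : I ≤ homogeneousPart P 1 := by
      intro y hy
      have hQ1 : initialSpan q d ≤ homogeneousPart P 1 :=
        initialSpan_le fun j hj => ⟨X j, hXP j hj, hX j hj⟩
      have h3 : I ^ 3 ≤ homogeneousPart P 3 := by
        refine h.pow_three_le.trans ?_
        rw [mul_comm]
        exact (Ideal.mul_mono_right hQ1).trans (pow_mul_homogeneousPart_le P 2 1)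
      have hy1 : y ∈ I ^ 1 := by simpa using hy
      rw [← reesMonomial_mem_iff hy1]
      refine hP.mem_of_pow_mem 3 ?_
      have h4 := (reesMonomial_mem_iff (Ideal.pow_mem_pow hy 3)).2 (h3 (Ideal.pow_mem_pow hy 3))
      have h5 : reesMonomial 1 hy1 ^ 3 = reesMonomial 3 (Ideal.pow_mem_pow hy 3) := by
        refine Subtype.ext ?_
        rw [Subalgebra.coe_pow, reesMonomial, reesMonomial, monomial_pow]
      rwa [h5]
    have hpos : ∀ n, I ^ (n + 1) ≤ homogeneousPart P (n + 1) := fun n => by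
      rw [pow_succ]
      exact (Ideal.mul_mono_right hI1).trans (pow_mul_homogeneousPart_le P n 1)
    intro u hu
    have h0 : u - algebraMap A _ ((u : A[X]).coeff 0) ∈ P := by
      refine mem_of_forall_coeff_mem fun n => ?_
      change ((u : A[X]) - C ((u : A[X]).coeff 0)).coeff n ∈ _
      rcases n with _ | n
      · rw [coeff_sub, coeff_C_zero, sub_self]
        exact zero_mem _
      · rw [coeff_sub, coeff_C_succ, sub_zero]
        exact hpos n (coeff_mem_pow u (n + 1))
    suffices hu0 : (u : A[X]).coeff 0 ∈ maximalIdeal A from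
      (Submodule.sub_mem_iff_left _ (Ideal.mem_comap.1 (hmP hu0))).1 h0
    by_contra hu0
    have hunit : IsUnit ((u : A[X]).coeff 0) := by
      by_contra hu1
      exact hu0 hu1
    exact hMp.ne_top (Ideal.eq_top_of_isUnit_mem _
      ((Submodule.sub_mem_iff_right _ hu).1 (hPM h0)) (hunit.map _))

theorem ReductionSystem.isCohenMacaulay_reesAlgebra [IsNoetherianRing A] (hA : IsGorensteinLocal A)
    (h : ReductionSystem I q d) (hX : ∀ j < d, (X j : A[X]) = monomial 1 (q j)) (hd : 3 ≤ d) :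
    IsCohenMacaulay (reesAlgebra I) := by
  refine isCohenMacaulay_of_surjective (RingHom.id _) Function.surjective_id (J := ⊥)
    ((RingHom.injective_iff_ker_eq_bot _).1 Function.injective_id) fun M hM _ => ?_
  by_cases hIM : I.map (algebraMap A (reesAlgebra I)) ≤ M
  · by_cases hXM : ∀ j < d, X j ∈ M
    · exact h.exists_locallyRegularMod_of_forall_mem hX hd M hIM hXM
    · push Not at hXM
      obtain ⟨j, hj, hjM⟩ := hXM
      exact h.exists_locallyRegularMod_of_notMem hX M hIM hj hjM
  · rw [Ideal.map_le_iff_le_comap] at hIM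
    exact exists_locallyRegularMod_of_not_le hA M hIM

end MaximalIdealsOfRees

/-! ### The associated graded ring as `R(I) ⧸ I R(I)` -/

section AssociatedGraded

open Polynomial

variable {A : Type*} [CommRing A] (I : Ideal A)

/-- The inclusion of the Rees algebra in the extended Rees algebra. -/
noncomputable def reesToExtendedRees : reesAlgebra I →ₐ[A] extendedReesAlgebra I :=
  (toLaurentAlg.comp (reesAlgebra I).val).codRestrict _ fun u => by
    have h : (reesAlgebra I).map toLaurentAlg ≤ extendedReesAlgebra I := by
      rw [← adjoin_monomial_eq_reesAlgebra, AlgHom.map_adjoin]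
      refine Algebra.adjoin_le ?_
      rintro _ ⟨_, ⟨a, ha, rfl⟩, rfl⟩
      refine Algebra.subset_adjoin (Or.inl ⟨a, ha, ?_⟩)
      rw [toLaurentAlg_apply, ← C_mul_X_pow_eq_monomial, toLaurent_C_mul_X_pow]
      rfl
    exact h ⟨_, u.2, rfl⟩

theorem coe_reesToExtendedRees (u : reesAlgebra I) :
    (reesToExtendedRees I u : LaurentPolynomial A) = toLaurent (u : A[X]) := rfl

/-- The truncated exponent `n - k` encodes that `I` to a negative power is the unit ideal. -/
theorem exists_T_mul_eq_toLaurent {e : LaurentPolynomial A} (he : e ∈ extendedReesAlgebra I) :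
    ∃ (k : ℕ) (p : A[X]), LaurentPolynomial.T k * e = toLaurent p ∧
      ∀ n, p.coeff n ∈ I ^ (n - k) := by
  induction he using Algebra.adjoin_induction with
  | mem e he =>
    rcases he with ⟨a, ha, rfl⟩ | rfl
    · refine ⟨0, monomial 1 a, ?_, fun n => ?_⟩
      · rw [← C_mul_X_pow_eq_monomial, toLaurent_C_mul_X_pow]
        simp
      · rw [coeff_monomial]
        split_ifs with hn
        · subst hn
          simpa using ha
        · exact zero_mem _
    · refine ⟨1, 1, ?_, fun n => ?_⟩
      · rw [← LaurentPolynomial.T_add]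
        simp
      · rw [coeff_one]
        split_ifs with hn
        · subst hn
          simp
        · exact zero_mem _
  | algebraMap r =>
    refine ⟨0, C r, by simp, fun n => ?_⟩
    rw [coeff_C]
    split_ifs with hn
    · subst hn
      simp
    · exact zero_mem _
  | add x y hx hy ihx ihy =>
    obtain ⟨k, p, hp, hp'⟩ := ihx
    obtain ⟨l, r, hr, hr'⟩ := ihy
    refine ⟨k + l, X ^ l * p + X ^ k * r, ?_, fun n => ?_⟩
    · rw [map_add, map_mul, map_mul, ← hp, ← hr, toLaurent_X_pow, toLaurent_X_pow, Nat.cast_add,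
        LaurentPolynomial.T_add]
      ring
    · rw [coeff_add, coeff_X_pow_mul', coeff_X_pow_mul']
      refine add_mem ?_ ?_
      · split_ifs with hn
        · exact Ideal.pow_le_pow_right (by omega) (hp' _)
        · exact zero_mem _
      · split_ifs with hn
        · exact Ideal.pow_le_pow_right (by omega) (hr' _)
        · exact zero_mem _
  | mul x y hx hy ihx ihy =>
    obtain ⟨k, p, hp, hp'⟩ := ihx
    obtain ⟨l, r, hr, hr'⟩ := ihy
    refine ⟨k + l, p * r, ?_, fun n => ?_⟩
    · rw [map_mul, ← hp, ← hr, Nat.cast_add, LaurentPolynomial.T_add]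
      ring
    · rw [coeff_mul]
      refine Ideal.sum_mem _ fun i hi => ?_
      have := Finset.HasAntidiagonal.mem_antidiagonal.1 hi
      have h1 := Ideal.mul_mem_mul (hp' i.1) (hr' i.2)
      rw [← pow_add] at h1
      exact Ideal.pow_le_pow_right (by omega) h1

/-- The natural map from the Rees algebra to the associated graded ring. -/
noncomputable def reesToAssociatedGraded : reesAlgebra I →ₐ[A] AssociatedGradedRing I :=
  (Ideal.Quotient.mkₐ A _).comp (reesToExtendedRees I)

theorem reesToAssociatedGraded_surjective : Function.Surjective (reesToAssociatedGraded I) := by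
  have key : ∀ e, ∀ he : e ∈ extendedReesAlgebra I,
      (Ideal.Quotient.mk (Ideal.span {extendedReesAlgebra.Tinv I})) ⟨e, he⟩ ∈
        (reesToAssociatedGraded I).range := by
    intro e he
    have he' := he
    induction he' using Algebra.adjoin_induction with
    | mem e h =>
      rcases h with ⟨a, ha, rfl⟩ | rfl
      · refine ⟨reesMonomial 1 (by simpa using ha), ?_⟩
        refine congrArg (Ideal.Quotient.mk (Ideal.span {extendedReesAlgebra.Tinv I}))
          (Subtype.ext ?_)
        refine (coe_reesToExtendedRees I _).trans ?_
        change toLaurent (monomial 1 a) = LaurentPolynomial.C a * LaurentPolynomial.T 1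
        rw [← C_mul_X_pow_eq_monomial, toLaurent_C_mul_X_pow]
        rfl
      · have : (Ideal.Quotient.mk (Ideal.span {extendedReesAlgebra.Tinv I}))
            ⟨LaurentPolynomial.T (-1), he⟩ = 0 :=
          Ideal.Quotient.eq_zero_iff_mem.2 (Ideal.mem_span_singleton_self _)
        rw [this]
        exact zero_mem _
    | algebraMap r => exact (reesToAssociatedGraded I).range.algebraMap_mem r
    | add x y hx hy ihx ihy => exact add_mem (ihx hx) (ihy hy)
    | mul x y hx hy ihx ihy => exact mul_mem (ihx hx) (ihy hy)
  intro y
  obtain ⟨⟨e, he⟩, rfl⟩ := Ideal.Quotient.mk_surjective y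
  exact key e he

/-- If `u = e T⁻¹` with `e` in the extended Rees algebra, the degree `n` coefficient of `u` is that
of `e` in degree `n + 1`, so it lies in `I^(n+1) = I · I^n`. -/
theorem ker_reesToAssociatedGraded :
    RingHom.ker (reesToAssociatedGraded I : reesAlgebra I →+* AssociatedGradedRing I) =
      I.map (algebraMap A (reesAlgebra I)) := by
  refine le_antisymm (fun u hu => ?_) (Ideal.map_le_iff_le_comap.2 fun a ha => ?_)
  · have h1 : reesToExtendedRees I u ∈ Ideal.span {extendedReesAlgebra.Tinv I} :=
      Ideal.Quotient.eq_zero_iff_mem.1 hu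
    obtain ⟨e, he⟩ := Ideal.mem_span_singleton'.1 h1
    obtain ⟨k, p, hp, hp'⟩ := exists_T_mul_eq_toLaurent I e.2
    have h2 : (e : LaurentPolynomial A) * LaurentPolynomial.T (-1) = toLaurent (u : A[X]) :=
      congrArg Subtype.val he
    have h3 : toLaurent (X ^ (k + 1) * (u : A[X])) = toLaurent p := by
      rw [map_mul, toLaurent_X_pow, ← h2, ← hp, Nat.cast_add, LaurentPolynomial.T_add]
      have h4 : (LaurentPolynomial.T ((1 : ℕ) : ℤ) : LaurentPolynomial A) *
          LaurentPolynomial.T (-1) = 1 := by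
        rw [← LaurentPolynomial.T_add]
        simp
      linear_combination (LaurentPolynomial.T (k : ℤ) * (e : LaurentPolynomial A)) * h4
    have h5 := toLaurent_injective h3
    refine mem_of_forall_coeff_mem fun n => mul_pow_le_homogeneousPart_map I n ?_
    have h6 := hp' (n + (k + 1))
    rw [← h5, coeff_X_pow_mul] at h6
    rw [← pow_succ']
    exact Ideal.pow_le_pow_right (by omega) h6
  · have hmem : LaurentPolynomial.C a * LaurentPolynomial.T 1 ∈ extendedReesAlgebra I :=
      Algebra.subset_adjoin (Or.inl ⟨a, ha, rfl⟩)
    refine Ideal.Quotient.eq_zero_iff_mem.2 (Ideal.mem_span_singleton'.2 ⟨⟨_, hmem⟩, ?_⟩)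
    refine Subtype.ext ?_
    change LaurentPolynomial.C a * LaurentPolynomial.T 1 * LaurentPolynomial.T (-1) =
      toLaurent (C a)
    rw [mul_assoc, ← LaurentPolynomial.T_add]
    simp

end AssociatedGraded

/-! ### Conclusion -/

section Main

open Polynomial

variable {A : Type u} [CommRing A] [IsLocalRing A] {I : Ideal A}
  {q : ℕ → A} {d : ℕ}

theorem ReductionSystem.exists_coe_eq_monomial (h : ReductionSystem I q d) :
    ∃ X : ℕ → reesAlgebra I, ∀ j < d, (X j : A[X]) = monomial 1 (q j) := by
  refine ⟨fun j => if hj : j < d then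
    reesMonomial 1 (a := q j) (by simpa using h.le (mem_initialSpan q hj)) else 0, fun j hj => ?_⟩
  simp only [dif_pos hj]
  rfl

theorem ReductionSystem.isCohenMacaulay_associatedGradedRing [IsNoetherianRing A]
    (h : ReductionSystem I q d) :
    IsCohenMacaulay (AssociatedGradedRing I) := by
  obtain ⟨X, hX⟩ := h.exists_coe_eq_monomial
  refine isCohenMacaulay_of_surjective
    (reesToAssociatedGraded I : reesAlgebra I →+* AssociatedGradedRing I)
    (reesToAssociatedGraded_surjective I) (ker_reesToAssociatedGraded I) fun M hM hle => ?_
  obtain ⟨gs, -, h1, h2⟩ := h.exists_regularMod_map hX h.le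
    (fun n => by simpa only [← pow_succ'] using h.inf_pow_le (n + 1)) M hle
  exact ⟨gs, h1.locally hM.ne_top, h2⟩

theorem ReductionSystem.isCohenMacaulay_fiberCone [IsNoetherianRing A] (h : ReductionSystem I q d) :
    IsCohenMacaulay (FiberCone I) := by
  obtain ⟨X, hX⟩ := h.exists_coe_eq_monomial
  refine isCohenMacaulay_of_surjective (Ideal.Quotient.mk _) Ideal.Quotient.mk_surjective
    Ideal.mk_ker fun M hM hle => ?_
  obtain ⟨gs, -, h1, h2⟩ := h.exists_regularMod_map hX (h.le.trans h.le_maximalIdeal)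
    h.inf_maximalIdeal_mul_pow_le M hle
  exact ⟨gs, h1.locally hM.ne_top, h2⟩

end Main

theorem theorem3p1 {A : Type u} [CommRing A] [IsLocalRing A]
    (hA : IsGorensteinLocal A) (hdim : 0 < ringKrullDim A)
    (Q I : Ideal A) (hQ : IsParameterIdeal Q)
    (hI : I = Submodule.colon Q ((maximalIdeal A ^ 2 : Ideal A) : Set A))
    (hv : haveI := hQ.isLocalRing_quotient; 1 < embDim (A ⧸ Q))
    (hint : I.IsIntegralOverIdeal Q) :
    I ^ 3 = Q * I ^ 2 ∧
    IsCohenMacaulay (AssociatedGradedRing I) ∧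
    IsCohenMacaulay (FiberCone I) ∧
    (3 ≤ ringKrullDim A → IsCohenMacaulay (reesAlgebra I)) := by
  have := hA.isNoetherianRing
  obtain ⟨d, q, hd, hQq, h⟩ := exists_reductionSystem hA hdim Q I hQ hI hv hint
  obtain ⟨X, hX⟩ := h.exists_coe_eq_monomial
  refine ⟨le_antisymm (hQq ▸ h.pow_three_le) ?_, h.isCohenMacaulay_associatedGradedRing,
    h.isCohenMacaulay_fiberCone, fun h3 => h.isCohenMacaulay_reesAlgebra hA hX ?_⟩
  · rw [pow_succ' I 2]
    exact Ideal.mul_mono_left (hQq ▸ h.le)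
  · rw [hd] at h3
    exact_mod_cast h3
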